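/- **Setting.** Let $V=\bigoplus_k V^k$ be a $\mathbb Z$-graded real vector space, $I=[0,1]$, and let $\mathfrak g$ be the graded Lie algebra with $\mathfrak g^k=\prod_{n\ge 0}\mathrm{Hom}(V^{\otimes n},V[k+1-n])$ and the Gerstenhaber bracket $[f,g]=f\circ g-(-1)^{|f||g|}g\circ f$, where $$(f\circ g)(a_1,\dots,a_n)=\sum_{j+r\le n}(-1)^{|g|\maltese_j}f(a_1,\dots,a_j,g(a_{j+1},\dots,a_{j+r}),a_{j+r+1},\dots,a_n),\qquad \maltese_j=\sum_{i\le j}(|a_i|-1).$$ Let $\Omega^*(I\times I;\mathfrak g)$ (coordinates $s,t$ on the square) be the dg Lie algebra with the de Rham differential and the bracket $[\xi\otimes f,\theta\otimes g]=(-1)^{|\theta||f|}\,\xi\wedge\theta\otimes[f,g]$. Here a smooth function with values in a vector space $S$ is an element of $C^\infty\otimes S$, and a function with values in $\mathrm{Hom}(V^{\otimes n},V)$ is smooth if its value on each element of $V^{\otimes n}$ is; integrals and derivatives are taken accordingly. An uncurved $A_\infty$ structure on $V$ is $\mu=(\mu^n)_{n\ge1}\in\mathfrak g^1$ with $\mu\circ\mu=0$;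 an $A_\infty$ morphism $(V,\mu_{\mathcal A})\to(W,\mu_{\mathcal B})$ is a sequence $F^n:V^{\otimes n}\to W[1-n]$, $n\ge1$, with $$\sum_{s_1+\dots+s_r=n,\ s_i\ge 1}\mu_{\mathcal B}^r(F^{s_1},\dots,F^{s_r})=(F\circ\mu_{\mathcal A})^n\quad\text{for all }n\ge1 .$$ For an $A_\infty$ algebra $\mathcal B=(V,\mu)$, $\Omega^*(I;\mathcal B)=\Omega^*(I)\otimes\mathcal B$ carries the $A_\infty$ structure $$\mu^1(\omega\otimes b)=d\omega\otimes b+(-1)^{|\omega|}\omega\otimes\mu^1(b),\qquad \mu^n(\omega_1\otimes b_1,\dots,\omega_n\otimes b_n)=(-1)^{\diamond}\,\omega_1\cdots\omega_n\otimes\mu^n(b_1,\dots,b_n),\ n\ge2,$$ with the Koszul sign $\diamond=\sum_{j<k}|b_j||\omega_k|+\sum_k k|\omega_k|$. *Path construction.* Let $a_u$, $u\in[0,1]$, be a smooth family of operators of degree $0$ on a graded space ($a_u^n$ of degree $1-n$). For $p\le q$ and an integer $d\ge0$ put, for $n\ge 1$, $$F^n_{p\to q}=\sum_{i=0}^{n-1+d}(-1)^i\int_{p\le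 t_1\le\dots\le t_i\le q}T_{t_1,\dots,t_i}^n\,dt_1\cdots dt_i ,$$ where $T^n_{\emptyset}=\mathrm{id}$ for $n=1$ and $0$ otherwise, and $T_{t_1,\dots,t_i}=T_{t_2,\dots,t_i}\circ a_{t_1}$; thus $T^n_{t_1,\dots,t_i}$ is the sum over all rooted planar trees with $n$ leaves and $i$ levels with exactly one vertex per level, the vertex of the $j$-th level from the leaves being labelled by $a_{t_j}$ (vertices of valence two are allowed). **Theorem.** Let $\alpha=\alpha^0+\alpha^1+\alpha^2\in\Omega^*(I\times I;\mathfrak g)$ be of total degree $1$ with $d\alpha+\frac12[\alpha,\alpha]=0$. Let $\alpha^{m,n}$ be the component of $\alpha$ of form degree $m$ with $n$ inputs, and write $\alpha^1=a\,ds+c\,dt$, $\alpha^2=b\,ds\wedge dt$. Assume that $\alpha^{0,0}=\alpha^{1,0}=\alpha^{2,0}=0$ and $\alpha^{1,1}=0$, and that the restriction of the form $\alpha$ to each of the edges $s=0$ and $s=1$ is constant, i.e. there $\alpha^{0}$ does not depend on $t$ and $c=0$. Let $\mathcal A_{s=0},\mathcal A_{s=1}$ be $V$ with the $A_\infty$ structures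 $\alpha^0|_{s=0}$, $\alpha^0|_{s=1}$. For $t\in I$ let $F_t$ be the path construction $0\to1$ with $d=0$ for the family $s\mapsto a(s,t)$ on $V$. Let $\hat\alpha$ be the collapsed form on $I$ (coordinate $s$) with values in operators on $\Omega^*(I;V)$ (coordinate $t$): $\hat\alpha^{0,n}=\delta_{1,n}d+\alpha^{0,n}+dt\otimes c^n$ and $\hat\alpha^{1,n}=ds\otimes(a^n+dt\otimes b^n)$, extended to forms in $t$ by the Koszul rule. Let $\hat G$ be the path construction $0\to1$ with $d=1$ for the family $s\mapsto a+dt\otimes b$ on $\Omega^*(I;V)$. Then: 1. $\hat\alpha^{0}|_{s=0}$ and $\hat\alpha^0|_{s=1}$ are the $A_\infty$ structures of $\Omega^*(I;\mathcal A_{s=0})$ and $\Omega^*(I;\mathcal A_{s=1})$, and $\hat G$ is an $A_\infty$ morphism $\Omega^*(I;\mathcal A_{s=0})\to\Omega^*(I;\mathcal A_{s=1})$. 2. $\hat G$ gives a differential homotopy with respect to the family $F_t$: each $F_t$ is an $A_\infty$ morphism $\mathcal A_{s=0}\to\mathcal A_{s=1}$, and, with $\iota:\mathcal A_{s=0}\to\Omega^*(I;\mathcal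 A_{s=0})$ the inclusion of constants, $\phi^n=\hat G^n\circ\iota^{\otimes n}$, $n\ge1$, is an $A_\infty$ morphism $\mathcal A_{s=0}\to\Omega^*(I;\mathcal A_{s=1})$ of the form $\phi^n(a_1,\dots,a_n)(t)=F^n_t(a_1,\dots,a_n)+dt\otimes\Theta^n_t(a_1,\dots,a_n)$. -/

import Mathlib

open scoped ContDiff

noncomputable section

namespace AInf

/-! ### Graded spaces and operators

A sequence of maps `f^n : V^{⊗ n} → W`, one for each `n`, is encoded as one function on words
`[a₁, …, aₙ]`; only its values on words of homogeneous elements matter.  Linearity and degrees are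
imposed by the predicates below. -/

/-- A sequence of maps `f^n` with `n` arguments in `V`, `n ≥ 0`, and values in `W`. -/
abbrev Op (V W : Type*) := List V → W

/-- A `ℤ`-graded real vector space, given by its homogeneous parts inside an ambient space `W`.
`sg` is multiplication by `(-1)^(|v| - 1)` on homogeneous `v`, the sign of the shifted degree.
`test` is a separating family of functionals, with respect to which `W`-valued functions
are integrated. -/
structure GradedSpace (W : Type*) [AddCommGroup W] [Module ℝ W] where
  part : ℤ → Submodule ℝ W
  sg : W →ₗ[ℝ] W
  sg_apply : ∀ k v, v ∈ part k → sg v = ((k - 1).negOnePow : ℤ) • v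
  test : Set (Module.Dual ℝ W)
  test_separates : ∀ v, (∀ ℓ ∈ test, ℓ v = 0) → v = 0

/-- The graded space of a vector space `V = ⨁ₖ 𝒱 k`; all linear functionals are used as tests. -/
def gradedSpace {V : Type*} [AddCommGroup V] [Module ℝ V] (𝒱 : ℤ → Submodule ℝ V)
    [DirectSum.Decomposition 𝒱] : GradedSpace V where
  part := 𝒱
  sg := DirectSum.toModule ℝ ℤ V (fun k => ((k - 1).negOnePow : ℤ) • (𝒱 k).subtype) ∘ₗ
    (DirectSum.decomposeLinearEquiv 𝒱).toLinearMap
  sg_apply := by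
    intro k v hv
    lift v to 𝒱 k using hv
    simp only [LinearMap.comp_apply, LinearEquiv.coe_coe, DirectSum.decomposeLinearEquiv_apply,
      DirectSum.decompose_coe]
    rw [← DirectSum.lof_eq_of ℝ, DirectSum.toModule_lof]
    rfl
  test := Set.univ
  test_separates := fun v h =>
    (Module.forall_dual_apply_eq_zero_iff ℝ v).1 fun ℓ => h ℓ (Set.mem_univ ℓ)

section operators

variable {V W U : Type*} [AddCommGroup V] [Module ℝ V] [AddCommGroup W] [Module ℝ W]
  [AddCommGroup U] [Module ℝ U]

/-- A word of homogeneous elements. -/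
def IsHomog (A : GradedSpace V) (l : List V) : Prop := ∀ v ∈ l, ∃ k, v ∈ A.part k

/-- Each `f^n` has degree `k + 1 - n`, that is `f^n : V^{⊗ n} → W[k + 1 - n]`. -/
def HasDegree (A : GradedSpace V) (B : GradedSpace W) (k : ℤ) (f : Op V W) : Prop :=
  ∀ (ks : List ℤ) (l : List V), List.Forall₂ (fun i v => v ∈ A.part i) ks l →
    f l ∈ B.part (ks.sum + k + 1 - l.length)

/-- `f` belongs to `∏ₙ Hom(V^{⊗ n}, W[k + 1 - n])`: each `f^n` is linear in each homogeneous
argument, and has degree `k + 1 - n`. -/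
structure IsCochain (A : GradedSpace V) (B : GradedSpace W) (k : ℤ) (f : Op V W) : Prop where
  linear : ∀ (x z : List V) (i : ℤ) (a b : V) (c : ℝ), IsHomog A x → IsHomog A z →
    a ∈ A.part i → b ∈ A.part i →
    f (x ++ (c • a + b) :: z) = c • f (x ++ a :: z) + f (x ++ b :: z)
  degree : HasDegree A B k f

/-- The Gerstenhaber circle product with `g` of degree `k`, with its Koszul sign:
`(f ∘ g)(a₁, …, aₙ) = ∑ (-1)^(k ✠ⱼ) f(a₁, …, aⱼ, g(aⱼ₊₁, …, aⱼ₊ᵣ), aⱼ₊ᵣ₊₁, …, aₙ)` over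
`j, r ≥ 0` with `j + r ≤ n`, where `✠ⱼ = ∑_{i ≤ j} (|aᵢ| - 1)`. -/
def circ (A : GradedSpace V) (k : ℤ) (f : Op V W) (g : Op V V) : Op V W := fun l =>
  ∑ j ∈ Finset.range (l.length + 1), ∑ r ∈ Finset.range (l.length - j + 1),
    f ((l.take j).map (fun v => if Even k then v else A.sg v) ++
      g ((l.drop j).take r) :: l.drop (j + r))

/-- The Gerstenhaber bracket of `f` of degree `k` and `g` of degree `m`. -/
def gerst (A : GradedSpace V) (k m : ℤ) (f g : Op V V) : Op V V := fun l =>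
  circ A m f g l - ((k * m).negOnePow : ℤ) • circ A k g f l

/-- `μ` is an (uncurved) `A_∞` structure on the graded space `A`. -/
structure IsAInf (A : GradedSpace V) (μ : Op V V) : Prop where
  uncurved : μ [] = 0
  cochain : IsCochain A A 1 μ
  rel : ∀ l, IsHomog A l → circ A 1 μ μ l = 0

/-- `F` is an `A_∞` morphism from `(A, μA)` to `(B, μB)`:
`∑ μB^r(F^{s₁}(a₁, …), …, F^{s_r}(…, aₙ)) = ∑ (-1)^{✠ⱼ} F(a₁, …, aⱼ, μA(…), …, aₙ)`, the sum on the
left being over all `s₁ + ⋯ + s_r = n` with `sᵢ ≥ 1`. -/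
structure IsAInfMorphism (A : GradedSpace V) (μA : Op V V) (B : GradedSpace W) (μB : Op W W)
    (F : Op V W) : Prop where
  source : IsAInf A μA
  target : IsAInf B μB
  cochain : IsCochain A B 0 F
  rel : ∀ l, l ≠ [] → IsHomog A l →
    ∑ c : Composition l.length, μB ((l.splitWrtComposition c).map F) = circ A 1 F μA l

/-! ### Calculus with values in a vector space without topology -/

/-- The vector `w` with `ℓ w = Φ ℓ` for all `ℓ` in the separating family `Λ` (and `0` if there is
none). -/
def represented (Λ : Set (Module.Dual ℝ W)) (Φ : Module.Dual ℝ W → ℝ) : W := by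
  classical exact if h : ∃ w, ∀ ℓ ∈ Λ, ℓ w = Φ ℓ then h.choose else 0

theorem represented_eq {Λ : Set (Module.Dual ℝ W)} {Φ : Module.Dual ℝ W → ℝ}
    (hΛ : ∀ v : W, (∀ ℓ ∈ Λ, ℓ v = 0) → v = 0) {w : W} (hw : ∀ ℓ ∈ Λ, ℓ w = Φ ℓ) :
    represented Λ Φ = w := by
  have ex : ∃ w, ∀ ℓ ∈ Λ, ℓ w = Φ ℓ := ⟨w, hw⟩
  unfold represented
  rw [dif_pos ex]
  refine sub_eq_zero.1 (hΛ _ fun ℓ hℓ => ?_)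
  rw [map_sub, ex.choose_spec ℓ hℓ, hw ℓ hℓ, sub_self]

/-- `f` belongs to `C^∞(X) ⊗ S`, where `X` is a closed interval or square in `E`, and smooth
functions on `X` are the restrictions of smooth functions on `E`. -/
def IsSmooth {X E : Type*} [NormedAddCommGroup E] [NormedSpace ℝ E] (emb : X → E)
    (S : Submodule ℝ W) (f : X → W) : Prop :=
  ∃ (N : ℕ) (g : Fin N → E → ℝ) (w : Fin N → W), (∀ i, ContDiff ℝ ∞ (g i)) ∧ (∀ i, w i ∈ S) ∧
    ∀ x, f x = ∑ i, g i (emb x) • w i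

/-- The derivative of `f : [0,1] → W` (one-sided at the end points):
`∑ gᵢ • wᵢ ↦ ∑ gᵢ' • wᵢ`. -/
def vderiv (f : unitInterval → W) (t : unitInterval) : W :=
  represented Set.univ fun ℓ =>
    derivWithin (fun y : ℝ => ℓ (f (Set.projIcc 0 1 zero_le_one y))) (Set.Icc 0 1) (t : ℝ)

/-- The integral of `Φ [t₁, …, tᵢ]` over the simplex `p ≤ t₁ ≤ ⋯ ≤ tᵢ ≤ q`. -/
def simplexIntegral : ℕ → unitInterval → unitInterval → (List unitInterval → ℝ) → ℝ
  | 0, _, _, Φ => Φ []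
  | i + 1, p, q, Φ => ∫ t in Set.Icc p q, simplexIntegral i t q (fun ts => Φ (t :: ts))

/-! ### The path construction -/

/-- `trees A a [t₁, …, tᵢ]` at a word of length `n` is the sum of all rooted planar trees with `n`
leaves and `i` levels, with one vertex per level, the vertex of level `j`, counted from the leaves,
being labelled by `a_{tⱼ}` (trees with vertices of valence two are allowed).  The tree of height
zero is the identity. -/
def trees (A : GradedSpace W) (a : unitInterval → Op W W) : List unitInterval → Op W W
  | [] => fun l => match l with
    | [w] => w
    | _ => 0
  | t :: ts => circ A 0 (trees A a ts) (a t)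

/-- The maps `F^n_{p → q} = ∑_{i ≤ n - 1 + d} (-1)^i ∫_{p ≤ t₁ ≤ ⋯ ≤ tᵢ ≤ q} (i,n)-trees`, for
`p ≤ q` and `n ≥ 1`, attached to the one-form `a_t dt` on `[0,1]` with values in operators of
degree `0`; the term `i = 0` is the identity if `n = 1`, and zero otherwise. -/
def pathMap (A : GradedSpace W) (d : ℕ) (a : unitInterval → Op W W) (p q : unitInterval) :
    Op W W := fun l =>
  ∑ i ∈ Finset.range (l.length + d), (-1 : ℝ) ^ i •
    represented A.test (fun ℓ => simplexIntegral i p q (fun ts => ℓ (trees A a ts l)))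

/-! ### The differential graded Lie algebra of the square -/

/-- A form `α = c0 + cs ds + ct dt + cst ds ∧ dt` on the square (coordinates `s`, `t`) with values
in operators, given by its coefficients. -/
structure SqForm (V : Type*) where
  c0 : unitInterval → unitInterval → Op V V
  cs : unitInterval → unitInterval → Op V V
  ct : unitInterval → unitInterval → Op V V
  cst : unitInterval → unitInterval → Op V V

/-- A smooth function on the square with values in `∏ₙ Hom(V^{⊗ n}, V[k + 1 - n])`. -/
structure IsSmoothFamily (A : GradedSpace V) (k : ℤ)
    (f : unitInterval → unitInterval → Op V V) : Prop where
  multilinear : ∀ s t n, ∃ M : MultilinearMap ℝ (fun _ : Fin n => V) V,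
    ∀ v : Fin n → V, f s t (List.ofFn v) = M v
  degree : ∀ s t, HasDegree A A k (f s t)
  smooth : ∀ l, IsSmooth (fun x : unitInterval × unitInterval => ((x.1 : ℝ), (x.2 : ℝ))) ⊤
    (fun x => f x.1 x.2 l)

/-- `α` is an element of total degree `w` of `Ω^*(I × I; 𝔤)`, where
`𝔤^k = ∏ₙ Hom(V^{⊗ n}, V[k + 1 - n])`. -/
structure SqForm.IsForm (A : GradedSpace V) (w : ℤ) (α : SqForm V) : Prop where
  h0 : IsSmoothFamily A w α.c0
  hs : IsSmoothFamily A (w - 1) α.cs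
  ht : IsSmoothFamily A (w - 1) α.ct
  hst : IsSmoothFamily A (w - 2) α.cst

/-- The exterior derivative of a form on the square. -/
def SqForm.d (α : SqForm V) : SqForm V where
  c0 := fun _ _ _ => 0
  cs := fun s t l => vderiv (fun s' => α.c0 s' t l) s
  ct := fun s t l => vderiv (fun t' => α.c0 s t' l) t
  cst := fun s t l => vderiv (fun s' => α.ct s' t l) s - vderiv (fun t' => α.cs s t' l) t

/-- The bracket of forms of total degrees `w` and `w'`:
`[ξ ⊗ f, θ ⊗ g] = (-1)^(|θ| |f|) ξ ∧ θ ⊗ [f, g]`. -/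
def SqForm.bracket (A : GradedSpace V) (w w' : ℤ) (α β : SqForm V) : SqForm V where
  c0 := fun s t => gerst A w w' (α.c0 s t) (β.c0 s t)
  cs := fun s t l => gerst A (w - 1) w' (α.cs s t) (β.c0 s t) l +
    (w.negOnePow : ℤ) • gerst A w (w' - 1) (α.c0 s t) (β.cs s t) l
  ct := fun s t l => gerst A (w - 1) w' (α.ct s t) (β.c0 s t) l +
    (w.negOnePow : ℤ) • gerst A w (w' - 1) (α.c0 s t) (β.ct s t) l
  cst := fun s t l => gerst A (w - 2) w' (α.cst s t) (β.c0 s t) l +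
    gerst A w (w' - 2) (α.c0 s t) (β.cst s t) l +
    ((w - 1).negOnePow : ℤ) • (gerst A (w - 1) (w' - 1) (α.cs s t) (β.ct s t) l -
      gerst A (w - 1) (w' - 1) (α.ct s t) (β.cs s t) l)

/-- `α` is a solution of total degree one of the Maurer–Cartan equation `d α + ½ [α, α] = 0` in
`Ω^*(I × I; 𝔤)`. -/
structure SqForm.IsMC (A : GradedSpace V) (α : SqForm V) : Prop where
  isForm : α.IsForm A 1
  eq0 : ∀ s t l, α.d.c0 s t l + (1 / 2 : ℝ) • (SqForm.bracket A 1 1 α α).c0 s t l = 0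
  eqs : ∀ s t l, α.d.cs s t l + (1 / 2 : ℝ) • (SqForm.bracket A 1 1 α α).cs s t l = 0
  eqt : ∀ s t l, α.d.ct s t l + (1 / 2 : ℝ) • (SqForm.bracket A 1 1 α α).ct s t l = 0
  eqst : ∀ s t l, α.d.cst s t l + (1 / 2 : ℝ) • (SqForm.bracket A 1 1 α α).cst s t l = 0

/-- `α^{0,0} = α^{1,0} = α^{2,0} = 0`. -/
def SqForm.Uncurved (α : SqForm V) : Prop :=
  ∀ s t, α.c0 s t [] = 0 ∧ α.cs s t [] = 0 ∧ α.ct s t [] = 0 ∧ α.cst s t [] = 0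

/-- `α^{1,1} = 0`. -/
def SqForm.OneOneZero (α : SqForm V) : Prop :=
  ∀ s t v, α.cs s t [v] = 0 ∧ α.ct s t [v] = 0

/-- The family is constant on the edge `{s} × I`: the restriction of the form `α` to this edge is
the pullback of its value at a point, so that `α^{0,n}` does not depend on `t` there, and the
`dt`-coefficient of `α^{1,n}` vanishes. -/
def SqForm.ConstantOnEdge (α : SqForm V) (s : unitInterval) : Prop :=
  ∀ t l, α.c0 s t l = α.c0 s 0 l ∧ α.ct s t l = 0

/-! ### Forms on the interval with values in a graded space -/

/-- A pair `(f, g)` stands for the form `f + dt ⊗ g` on `[0,1]`; here `f` and `g` are not required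
to be smooth. -/
abbrev Pre (V : Type*) := (unitInterval → V) × (unitInterval → V)

/-- The graded space `Ω^*([0,1]; V)`: the part of degree `k` consists of the forms `f + dt ⊗ g` with
`f ∈ C^∞([0,1]) ⊗ V^k` and `g ∈ C^∞([0,1]) ⊗ V^{k-1}`.  The tests are evaluations at points
followed by tests on `V`, so integrals are taken pointwise. -/
def forms (A : GradedSpace V) : GradedSpace (Pre V) where
  part := fun k =>
    { carrier := {η | IsSmooth (fun x : unitInterval => (x : ℝ)) (A.part k) η.1 ∧
        IsSmooth (fun x : unitInterval => (x : ℝ)) (A.part (k - 1)) η.2}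
      add_mem' := by
        have key : ∀ (S : Submodule ℝ V) (f g : unitInterval → V),
            IsSmooth (fun x : unitInterval => (x : ℝ)) S f →
            IsSmooth (fun x : unitInterval => (x : ℝ)) S g →
            IsSmooth (fun x : unitInterval => (x : ℝ)) S (f + g) := by
          rintro S f g ⟨N, a, v, ha, hv, hf⟩ ⟨M, b, w, hb, hw, hg⟩
          refine ⟨N + M, Fin.append a b, Fin.append v w, ?_, ?_, ?_⟩
          · intro i
            refine Fin.addCases (fun i => ?_) (fun i => ?_) i
            · simpa using ha i
            · simpa using hb i
          · intro i
            refine Fin.addCases (fun i => ?_) (fun i => ?_) i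
            · simpa using hv i
            · simpa using hw i
          · intro x
            simp [Fin.sum_univ_add, hf, hg]
        intro x y h h'
        exact And.intro (key _ _ _ h.1 h'.1) (key _ _ _ h.2 h'.2)
      zero_mem' := by
        have key : ∀ S : Submodule ℝ V, IsSmooth (fun x : unitInterval => (x : ℝ)) S
            (0 : unitInterval → V) := fun S =>
          ⟨0, Fin.elim0, Fin.elim0, fun i => i.elim0, fun i => i.elim0, fun x => by simp⟩
        exact And.intro (key _) (key _)
      smul_mem' := by
        have key : ∀ (S : Submodule ℝ V) (c : ℝ) (f : unitInterval → V),
            IsSmooth (fun x : unitInterval => (x : ℝ)) S f →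
            IsSmooth (fun x : unitInterval => (x : ℝ)) S (c • f) := by
          rintro S c f ⟨N, a, v, ha, hv, hf⟩
          refine ⟨N, a, fun i => c • v i, ha, fun i => S.smul_mem c (hv i), fun x => ?_⟩
          simp [hf, Finset.smul_sum, smul_comm c]
        intro c x h
        exact And.intro (key _ _ _ h.1) (key _ _ _ h.2) }
  sg := LinearMap.prodMap (A.sg.compLeft unitInterval) (-(A.sg.compLeft unitInterval))
  sg_apply := by
    have key : ∀ (k : ℤ) (f : unitInterval → V),
        IsSmooth (fun x : unitInterval => (x : ℝ)) (A.part k) f →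
        ∀ x, A.sg (f x) = ((k - 1).negOnePow : ℤ) • f x := by
      rintro k f ⟨N, a, v, -, hv, hf⟩ x
      refine A.sg_apply k _ ?_
      rw [hf]
      exact Submodule.sum_mem _ fun i _ => Submodule.smul_mem _ _ (hv i)
    rintro k ⟨f, g⟩ ⟨hf, hg⟩
    refine Prod.ext (funext fun x => ?_) (funext fun x => ?_)
    · simpa using key k f hf x
    · have := key (k - 1) g hg x
      simp only [Int.negOnePow_sub _ 1] at this ⊢
      simp [this]
  test := {ψ | ∃ ℓ ∈ A.test, ∃ t : unitInterval,
    ψ = ℓ ∘ₗ LinearMap.proj t ∘ₗ LinearMap.fst ℝ (unitInterval → V) (unitInterval → V) ∨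
    ψ = ℓ ∘ₗ LinearMap.proj t ∘ₗ LinearMap.snd ℝ (unitInterval → V) (unitInterval → V)}
  test_separates := by
    rintro ⟨f, g⟩ h
    refine Prod.ext (funext fun t => ?_) (funext fun t => ?_)
    · exact A.test_separates _ fun ℓ hℓ => h _ ⟨ℓ, hℓ, t, Or.inl rfl⟩
    · exact A.test_separates _ fun ℓ hℓ => h _ ⟨ℓ, hℓ, t, Or.inr rfl⟩

/-- The form-linear extension of the operator-valued form `P + dt ⊗ Q` on `[0,1]`, of total degree
`k`, to an operator on forms `ηᵢ = fᵢ + dt ⊗ gᵢ`.  By the Koszul rule, `dt` in the `i`-th argument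
has to pass the operator `P` of degree `k` and the arguments before it:
`P(f₁, …, fₙ) + dt ⊗ (Q(f₁, …, fₙ) + ∑ᵢ (-1)^(k + ✠ᵢ₋₁) P(f₁, …, gᵢ, …, fₙ))`. -/
def extend (A : GradedSpace V) (k : ℤ) (P Q : unitInterval → Op V V) : Op (Pre V) (Pre V) :=
  fun L =>
    (fun t => P t (L.map fun η => η.1 t),
     fun t => Q t (L.map fun η => η.1 t) +
      (k.negOnePow : ℤ) • ∑ i : Fin L.length,
        P t ((L.take i).map (fun η => A.sg (η.1 t)) ++
          (L.get i).2 t :: (L.drop (i + 1)).map (fun η => η.1 t)))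

/-- The de Rham differential `f + dt ⊗ g ↦ dt ⊗ f'`, as an operator with one argument. -/
def deRham : Op (Pre V) (Pre V) := fun L => match L with
  | [η] => (0, vderiv η.1)
  | _ => 0

/-- The `A_∞` structure of `Ω^*([0,1]; 𝓑) = Ω^*([0,1]) ⊗ 𝓑`: the de Rham differential plus the
form-linear extension of `μ`. -/
def formsStructure (A : GradedSpace V) (μ : Op V V) : Op (Pre V) (Pre V) :=
  fun L => deRham L + extend A 1 (fun _ => μ) (fun _ _ => 0) L

/-- The inclusion of `V` into `Ω^*([0,1]; V)` as constant functions. -/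
def const (v : V) : Pre V := (fun _ => v, fun _ => 0)

/-! ### Collapsing the square to the interval with coordinate `s` -/

/-- The component `α̂^{0,n}` at `s`, namely `δ_{1,n} d + α^{0,n} + dt ⊗ ι_{∂t} α^{1,n}`. -/
def SqForm.collapse0 (A : GradedSpace V) (α : SqForm V) (s : unitInterval) : Op (Pre V) (Pre V) :=
  fun L => deRham L + extend A 1 (α.c0 s) (α.ct s) L

/-- The coefficient of `ds` in `α̂^{1,n}` at `s`: the operator `a + dt ⊗ b`, where
`a = ι_{∂s} α^{1,n}` and `α^{2,n} = b ds ∧ dt`. -/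
def SqForm.collapse1 (A : GradedSpace V) (α : SqForm V) (s : unitInterval) : Op (Pre V) (Pre V) :=
  extend A 0 (α.cs s) (α.cst s)

/-- The morphism `F_t`: the path construction with `d = 0` along the path `s ↦ (s, t)`. -/
def SqForm.F (A : GradedSpace V) (α : SqForm V) (t : unitInterval) : Op V V :=
  pathMap A 0 (fun s => α.cs s t) 0 1

/-- The maps `Ĝ`: the path construction with `d = 1` for the collapsed form. -/
def SqForm.Ghat (A : GradedSpace V) (α : SqForm V) : Op (Pre V) (Pre V) :=
  pathMap (forms A) 1 (α.collapse1 A) 0 1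

/-- `Θ` is a differential homotopy with respect to the family `F` of `A_∞` morphisms from `(A, μA)`
to `(B, μB)`: there is an `A_∞` morphism `φ` from `A` to `Ω^*([0,1]; B)` with
`φ^n(a₁, …, aₙ)(t) = F_t^n(a₁, …, aₙ) + dt ⊗ Θ_t^n(a₁, …, aₙ)` for all `n ≥ 1`. -/
def IsDifferentialHomotopy (A : GradedSpace V) (μA : Op V V) (B : GradedSpace W) (μB : Op W W)
    (F Θ : unitInterval → Op V W) : Prop :=
  (∀ t, IsAInfMorphism A μA B μB (F t)) ∧
  ∃ φ : Op V (Pre W), IsAInfMorphism A μA (forms B) (formsStructure B μB) φ ∧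
    ∀ l, l ≠ [] → IsHomog A l → φ l = (fun t => F t l, fun t => Θ t l)

end operators

end AInf

end

namespace AInf

set_option linter.unusedSectionVars false

/-! ### Integrals depending smoothly on a parameter -/

/-! A form on the interval is studied through its values `u + dt ⊗ v` at points `t`, that is,
through pairs in `V × V`. There the collapsed data become two families of multilinear operators over
the square: `M = opM`, extending `α⁰ + dt ⊗ c`, and `a = opA`, extending the coefficient of `ds`.
Both commute up to sign with multiplication by `dt` (`ELin`), so identities between them need only
be checked on words without `dt` (`ELin.ext`). In this way the `ds` and `ds ∧ dt` components of the
Maurer–Cartan equation combine into `∂ₛM = M∘a - a∘M + dt ∂ₜa` (`IsMC.dS_opM`).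

The path construction from `s` to `1` is `G = ∑ Gᵢ`, where `G₀ = id` and `Gᵢ₊₁` is the primitive in
`s` of `Gᵢ∘a` that vanishes at `s = 1`. Differentiating an integral in its lower limit costs a sign,
which is the origin of `(-1)^i` (`simplexIntegral_treeSum`). Hence `∂ₛG = G∘a` and `G = id` at `s =
1` (`dS_pathOp`, `pathOp_one`). The defect `X = M(1)(G, …, G) + dt ∂ₜG - G∘M` vanishes at `s = 1`,
and the pre-Lie identity `ins_ins` together with the equation for `M` yields `∂ₛX = X∘a`. Therefore
`X = 0` (`blocks_pathOp`). At `s = 0` this is the morphism equation for `Ĝ`, since the Leibniz rule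
identifies `dt ∂ₜG` with the commutator of `Ĝ` and the de Rham differential (`evalAt_deRham_apply`,
`blocks_Ghat`).

Finiteness and uniqueness come from `α^{1,1} = 0`: the unary part of `a` is divisible by `dt`, and
`dt² = 0`. Each level of a tree either joins at least two inputs or uses up the one available `dt`.
So `Gᵢ` vanishes on `n` letters for `i > n` and is a multiple of `dt` for `i = n`, which explains `d
= 1` for `Ĝ` and `d = 0` for `F_t` (`pathTerm_eq_zero`, `E_pathTerm_eq_zero`, `IsForm.F_eq`). For
the same reason insertions of `a` lower a weight on words (`pairWeight_decreases`), and `∂ₛX = X∘a`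
can be solved by induction on the weight (`eq_zero_of_dS_eq_ins`).

Constancy on the edges turns the collapsed operators at `s = 0` and `s = 1` into the structures on
forms. Inclusion of constants and evaluation at `t` are strictly compatible with these structures;
composing `Ĝ` with them gives `φ` and `F_t`. -/

theorem hasFDerivAt_parametric_intervalIntegral {E F : Type*} [NormedAddCommGroup E]
    [NormedSpace ℝ E] [FiniteDimensional ℝ E] [NormedAddCommGroup F] [NormedSpace ℝ F]
    [CompleteSpace F] (k : E × ℝ → F) (hk : ContDiff ℝ 1 k) (x : E) :
    HasFDerivAt (fun x => ∫ y in (0 : ℝ)..1, k (x, y))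
      (∫ y in (0 : ℝ)..1, (fderiv ℝ k (x, y)).comp (ContinuousLinearMap.inl ℝ E ℝ)) x := by
  have hc : Continuous fun z : E × ℝ => (fderiv ℝ k z).comp (ContinuousLinearMap.inl ℝ E ℝ) :=
    (hk.continuous_fderiv (by simp)).clm_comp continuous_const
  -- Compactness of ball times interval bounds the derivative of the kernel by a constant, which
  -- dominates it near `x`.
  have hcomp : IsCompact (Metric.closedBall x 1 ×ˢ Set.Icc (0 : ℝ) 1) :=
    (isCompact_closedBall x 1).prod isCompact_Icc
  obtain ⟨C, hC⟩ := hcomp.exists_bound_of_continuousOn hc.continuousOn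
  have hk0 : Continuous k := hk.continuous
  refine intervalIntegral.hasFDerivAt_integral_of_dominated_of_fderiv_le
    (F := fun x y => k (x, y)) (bound := fun _ => C)
    (F' := fun x y => (fderiv ℝ k (x, y)).comp (ContinuousLinearMap.inl ℝ E ℝ))
    (Metric.closedBall_mem_nhds x one_pos) ?_ ?_ ?_ ?_ ?_ ?_
  · exact Filter.Eventually.of_forall fun x => (by fun_prop : Continuous fun y => k (x, y)).aestronglyMeasurable
  · exact (by fun_prop : Continuous fun y => k (x, y)).intervalIntegrable _ _
  · exact (hc.comp (by fun_prop : Continuous fun y : ℝ => (x, y))).aestronglyMeasurable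
  · refine Filter.Eventually.of_forall fun y hy z hz => hC (z, y) ⟨hz, ?_⟩
    rw [Set.uIoc_of_le zero_le_one] at hy
    exact ⟨hy.1.le, hy.2⟩
  · exact intervalIntegrable_const
  · refine Filter.Eventually.of_forall fun y hy z hz => ?_
    exact ((hk.differentiable (by simp)) (z, y)).hasFDerivAt.comp z (hasFDerivAt_prodMk_left z y)

/-- Induction on the order of differentiability. The target `F` stays general because the derivative
is again such an integral, with values in `E →L[ℝ] F`. -/
theorem contDiff_parametric_intervalIntegral {E : Type} [NormedAddCommGroup E]
    [NormedSpace ℝ E] [FiniteDimensional ℝ E] (n : ℕ) :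
    ∀ {F : Type} [NormedAddCommGroup F] [NormedSpace ℝ F]
    [CompleteSpace F] (k : E × ℝ → F), ContDiff ℝ n k →
    ContDiff ℝ n (fun x => ∫ y in (0 : ℝ)..1, k (x, y)) := by
  induction n with
  | zero =>
    intro F _ _ _ k hk
    have := hk.continuous
    simp only [CharP.cast_eq_zero, contDiff_zero]
    exact intervalIntegral.continuous_parametric_intervalIntegral_of_continuous'
      (f := fun x y => k (x, y)) this 0 1
  | succ n ih =>
    intro F _ _ _ k hk
    have h1 : ContDiff ℝ 1 k := hk.of_le (by simp)
    have hd := hasFDerivAt_parametric_intervalIntegral k h1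
    push_cast at hk ⊢
    rw [contDiff_succ_iff_fderiv] at hk ⊢
    refine ⟨fun x => (hd x).differentiableAt, by simp, ?_⟩
    rw [funext fun x => (hd x).fderiv]
    exact ih _ (hk.2.2.clm_comp contDiff_const)

/-- The substitution `y ↦ 1 + (x.1 - 1) y` makes the end points constant, so that the parameter
occurs only in the integrand. -/
theorem contDiff_primitive (g : ℝ × ℝ → ℝ) (hg : ContDiff ℝ ∞ g) :
    ContDiff ℝ ∞ (fun x : ℝ × ℝ => ∫ y in (1 : ℝ)..x.1, g (y, x.2)) := by
  have h : (fun x : ℝ × ℝ => ∫ y in (1 : ℝ)..x.1, g (y, x.2)) =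
      fun x => (x.1 - 1) * ∫ y in (0 : ℝ)..1, g (1 + (x.1 - 1) * y, x.2) := by
    funext x
    have := intervalIntegral.smul_integral_comp_add_mul (a := 0) (b := 1)
      (fun y => g (y, x.2)) (x.1 - 1) 1
    simpa using this.symm
  rw [h]
  refine ContDiff.mul (by fun_prop) ?_
  refine contDiff_infty.2 fun n => contDiff_parametric_intervalIntegral n
    (fun z : (ℝ × ℝ) × ℝ => g (1 + (z.1.1 - 1) * z.2, z.1.2)) ?_
  exact ContDiff.comp (hg.of_le (by exact_mod_cast le_top)) (by fun_prop)

/-! ### Smooth functions on the square -/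

section square

variable {U W : Type*} [AddCommGroup U] [Module ℝ U] [AddCommGroup W] [Module ℝ W]

/-- Smooth functions on the square with values in `U`, that is elements of `C^∞ ⊗ U`. -/
def Smooth₂ (f : unitInterval → unitInterval → U) : Prop :=
  ∃ (N : ℕ) (g : Fin N → ℝ × ℝ → ℝ) (w : Fin N → U), (∀ i, ContDiff ℝ ∞ (g i)) ∧
    ∀ s t, f s t = ∑ i, g i (s, t) • w i

/-- The partial derivative in the first variable. -/
noncomputable def derivS (f : unitInterval → unitInterval → U) :
    unitInterval → unitInterval → U :=
  fun s t => vderiv (fun s' => f s' t) s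

/-- The partial derivative in the second variable. -/
noncomputable def derivT (f : unitInterval → unitInterval → U) :
    unitInterval → unitInterval → U :=
  fun s t => vderiv (fun t' => f s t') t

/-- The primitive in the first variable which vanishes at `s = 1`. -/
noncomputable def primitive (f : unitInterval → unitInterval → U) :
    unitInterval → unitInterval → U :=
  fun s t => represented Set.univ fun ℓ =>
    ∫ y in (1 : ℝ)..s, ℓ (f (Set.projIcc 0 1 zero_le_one y) t)

theorem separates_univ (v : U) (h : ∀ ℓ ∈ (Set.univ : Set (Module.Dual ℝ U)), ℓ v = 0) : v = 0 :=
  (Module.forall_dual_apply_eq_zero_iff ℝ v).1 fun ℓ => h ℓ (Set.mem_univ ℓ)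

/-- The tested derivative determines at most one vector, so any smooth presentation of `f` computes
it, and the choice of presentation is immaterial. -/
theorem vderiv_eq_sum {ι : Type*} [Fintype ι] {g : ι → ℝ → ℝ} {g' : ι → ℝ} {w : ι → U}
    {f : unitInterval → U} {t : unitInterval} (hf : ∀ x, f x = ∑ i, g i x • w i)
    (hg : ∀ i, HasDerivAt (g i) (g' i) t) : vderiv f t = ∑ i, g' i • w i := by
  refine represented_eq separates_univ fun ℓ _ => ?_
  have h : HasDerivWithinAt (fun y : ℝ => ℓ (f (Set.projIcc 0 1 zero_le_one y)))
      (∑ i, g' i * ℓ (w i)) (Set.Icc 0 1) t := by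
    have h1 : HasDerivWithinAt (fun y : ℝ => ∑ i, g i y * ℓ (w i))
        (∑ i, g' i * ℓ (w i)) (Set.Icc 0 1) t :=
      HasDerivWithinAt.fun_sum fun i _ => ((hg i).mul_const _).hasDerivWithinAt
    refine h1.congr (fun y hy => ?_) ?_
    · rw [Set.projIcc_of_mem zero_le_one hy, hf]; simp
    · rw [Set.projIcc_val, hf]; simp
  rw [h.derivWithin (uniqueDiffOn_Icc zero_lt_one _ t.2)]
  simp

variable {f f₁ f₂ : unitInterval → unitInterval → U}

theorem derivS_eq_sum {ι : Type*} [Fintype ι] {g : ι → ℝ × ℝ → ℝ} {w : ι → U}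
    (hg : ∀ i, ContDiff ℝ ∞ (g i)) (hf : ∀ s t, f s t = ∑ i, g i (s, t) • w i)
    (s t : unitInterval) : derivS f s t = ∑ i, fderiv ℝ (g i) (s, t) (1, 0) • w i := by
  refine vderiv_eq_sum (g := fun i y => g i (y, t)) (fun x => hf x t) fun i => ?_
  have h1 := ((hg i).differentiable (by simp) ((s : ℝ), (t : ℝ))).hasFDerivAt
  exact h1.comp_hasDerivAt (s : ℝ) ((hasDerivAt_id _).prodMk (hasDerivAt_const _ _))

theorem derivT_eq_sum {ι : Type*} [Fintype ι] {g : ι → ℝ × ℝ → ℝ} {w : ι → U}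
    (hg : ∀ i, ContDiff ℝ ∞ (g i)) (hf : ∀ s t, f s t = ∑ i, g i (s, t) • w i)
    (s t : unitInterval) : derivT f s t = ∑ i, fderiv ℝ (g i) (s, t) (0, 1) • w i := by
  refine vderiv_eq_sum (g := fun i y => g i (s, y)) (fun x => hf s x) fun i => ?_
  have h1 := ((hg i).differentiable (by simp) ((s : ℝ), (t : ℝ))).hasFDerivAt
  exact h1.comp_hasDerivAt (t : ℝ) ((hasDerivAt_const _ _).prodMk (hasDerivAt_id _))

theorem primitive_eq_sum {ι : Type*} [Fintype ι] {g : ι → ℝ × ℝ → ℝ} {w : ι → U}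
    (hg : ∀ i, ContDiff ℝ ∞ (g i)) (hf : ∀ s t, f s t = ∑ i, g i (s, t) • w i)
    (s t : unitInterval) : primitive f s t = ∑ i, (∫ y in (1 : ℝ)..s, g i (y, t)) • w i := by
  refine represented_eq separates_univ fun ℓ _ => ?_
  have h : Set.EqOn (fun y : ℝ => ℓ (f (Set.projIcc 0 1 zero_le_one y) t))
      (fun y => ∑ i, g i (y, t) * ℓ (w i)) (Set.uIcc 1 s) := by
    intro y hy
    have hy' : y ∈ Set.Icc (0 : ℝ) 1 := by
      rw [Set.uIcc_of_ge s.2.2] at hy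
      exact ⟨s.2.1.trans hy.1, hy.2⟩
    simp [Set.projIcc_of_mem zero_le_one hy', hf]
  rw [intervalIntegral.integral_congr h, intervalIntegral.integral_finsetSum]
  · simp
  · intro i _
    have := (hg i).continuous
    exact (by fun_prop : Continuous fun y : ℝ => g i (y, t) * ℓ (w i)).intervalIntegrable _ _

namespace Smooth₂

theorem of_sum {ι : Type*} [Fintype ι] {g : ι → ℝ × ℝ → ℝ} {w : ι → U}
    (hg : ∀ i, ContDiff ℝ ∞ (g i)) (hf : ∀ s t, f s t = ∑ i, g i (s, t) • w i) : Smooth₂ f := by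
  let e := (Fintype.equivFin ι).symm
  exact ⟨Fintype.card ι, g ∘ e, w ∘ e, fun i => hg _, fun s t => by
    rw [hf]; exact (e.sum_comp fun i => g i (s, t) • w i).symm⟩

theorem const (u : U) : Smooth₂ fun _ _ => u :=
  of_sum (ι := Unit) (g := fun _ _ => 1) (w := fun _ => u) (fun _ => contDiff_const) (by simp)

theorem derivS_const (u : U) : derivS (fun _ _ => u) = 0 := by
  funext s t
  rw [derivS_eq_sum (ι := Unit) (g := fun _ _ => 1) (w := fun _ => u) (fun _ => contDiff_const)
    (by simp)]
  simp

theorem derivT_const (u : U) : derivT (fun _ _ => u) = 0 := by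
  funext s t
  rw [derivT_eq_sum (ι := Unit) (g := fun _ _ => 1) (w := fun _ => u) (fun _ => contDiff_const)
    (by simp)]
  simp

theorem derivS (hf : Smooth₂ f) : Smooth₂ (derivS f) := by
  obtain ⟨N, g, w, hg, hf⟩ := hf
  exact of_sum (g := fun i x => fderiv ℝ (g i) x (1, 0))
    (fun i => ((hg i).fderiv_right (by simp)).clm_apply contDiff_const) (derivS_eq_sum hg hf)

theorem derivT (hf : Smooth₂ f) : Smooth₂ (derivT f) := by
  obtain ⟨N, g, w, hg, hf⟩ := hf
  exact of_sum (g := fun i x => fderiv ℝ (g i) x (0, 1))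
    (fun i => ((hg i).fderiv_right (by simp)).clm_apply contDiff_const) (derivT_eq_sum hg hf)

theorem primitive (hf : Smooth₂ f) : Smooth₂ (primitive f) := by
  obtain ⟨N, g, w, hg, hf⟩ := hf
  exact of_sum (g := fun i x => ∫ y in (1 : ℝ)..x.1, g i (y, x.2))
    (fun i => contDiff_primitive _ (hg i)) (primitive_eq_sum hg hf)

/-- Symmetry of the second derivative of each coefficient function. It is needed to differentiate
the evolution equation of `G` with respect to `t`. -/
theorem derivS_derivT (hf : Smooth₂ f) :
    AInf.derivS (AInf.derivT f) = AInf.derivT (AInf.derivS f) := by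
  obtain ⟨N, g, w, hg, hf⟩ := hf
  have h1 : ∀ v i, ContDiff ℝ ∞ fun x => fderiv ℝ (g i) x v :=
    fun v i => ((hg i).fderiv_right (by simp)).clm_apply contDiff_const
  funext s t
  rw [derivS_eq_sum (h1 _) (derivT_eq_sum hg hf), derivT_eq_sum (h1 _) (derivS_eq_sum hg hf)]
  refine Finset.sum_congr rfl fun i _ => ?_
  have hd : DifferentiableAt ℝ (fderiv ℝ (g i)) ((s : ℝ), (t : ℝ)) :=
    ((hg i).fderiv_right (m := ∞) (by simp)).differentiable (by simp) _
  have hsym := ((hg i).contDiffAt (x := ((s : ℝ), (t : ℝ)))).isSymmSndFDerivAt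
    (by rw [minSmoothness_of_isRCLikeNormedField]; exact WithTop.coe_le_coe.2 (le_top (a := (2 : ℕ∞))))
  rw [fderiv_clm_apply hd (differentiableAt_const _), fderiv_clm_apply hd (differentiableAt_const _)]
  simp [hsym.eq (1, 0) (0, 1)]

theorem derivS_primitive (hf : Smooth₂ f) : AInf.derivS (AInf.primitive f) = f := by
  obtain ⟨N, g, w, hg, hf⟩ := hf
  funext s t
  rw [hf]
  refine vderiv_eq_sum (g := fun i x => ∫ y in (1 : ℝ)..x, g i (y, t))
    (fun x => primitive_eq_sum hg hf x t) fun i => ?_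
  have hc : Continuous fun y : ℝ => g i (y, t) := by
    have := (hg i).continuous
    fun_prop
  exact intervalIntegral.integral_hasDerivAt_right (hc.intervalIntegrable _ _)
    (hc.stronglyMeasurableAtFilter _ _) hc.continuousAt

theorem primitive_one (hf : Smooth₂ f) (t : unitInterval) : AInf.primitive f 1 t = 0 := by
  obtain ⟨N, g, w, hg, hf⟩ := hf
  rw [primitive_eq_sum hg hf]
  simp

theorem apply_primitive (hf : Smooth₂ f) (ℓ : Module.Dual ℝ U) (s t : unitInterval) :
    ℓ (AInf.primitive f s t) =
      - ∫ y in Set.Icc s 1, ℓ (f y t) := by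
  obtain ⟨N, g, w, hg, hf⟩ := hf
  have hc : ∀ i, Continuous fun y : ℝ => g i (y, t) := fun i => by
    have := (hg i).continuous
    fun_prop
  have h : ∫ y in Set.Icc s 1, ℓ (f y t) = ∫ y in Set.Icc (s : ℝ) 1, ∑ i, g i (y, t) * ℓ (w i) := by
    -- The measure on `unitInterval` is the restriction of Lebesgue measure, so the integral over
    -- the subtype is transported to an integral over a real interval.
    have he : MeasurableEmbedding (Subtype.val : unitInterval → ℝ) :=
      MeasurableEmbedding.subtype_coe measurableSet_Icc
    have hm : MeasureTheory.Measure.map (Subtype.val : unitInterval → ℝ) MeasureTheory.volume =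
        MeasureTheory.volume.restrict (Set.Icc 0 1) := map_comap_subtype_coe measurableSet_Icc _
    have hi : Set.Icc (s : ℝ) 1 ∩ Set.Icc 0 1 = Set.Icc (s : ℝ) 1 :=
      Set.inter_eq_left.2 (Set.Icc_subset_Icc_left s.2.1)
    have := he.setIntegral_map (μ := MeasureTheory.volume)
      (fun y => ∑ i, g i (y, t) * ℓ (w i)) (Set.Icc (s : ℝ) 1)
    rw [hm, MeasureTheory.Measure.restrict_restrict measurableSet_Icc, hi] at this
    rw [this]
    refine MeasureTheory.setIntegral_congr_fun measurableSet_Icc fun y _ => ?_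
    simp [hf]
  rw [h, MeasureTheory.integral_Icc_eq_integral_Ioc, ← intervalIntegral.integral_of_le s.2.2,
    ← intervalIntegral.integral_symm, primitive_eq_sum hg hf, intervalIntegral.integral_finsetSum]
  · simp
  · intro i _
    exact ((hc i).mul_const _).intervalIntegrable _ _

theorem eq_zero_of_derivS (hf : Smooth₂ f) (h : AInf.derivS f = 0) (h1 : ∀ t, f 1 t = 0) :
    f = 0 := by
  obtain ⟨N, g, w, hg, hf⟩ := hf
  funext s t
  refine separates_univ _ fun ℓ _ => ?_
  let φ : ℝ → ℝ := fun y => ∑ i, g i (y, t) * ℓ (w i)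
  have hφ : ∀ y ∈ Set.Icc (0 : ℝ) 1, HasDerivAt φ 0 y := by
    intro y hy
    have h2 : HasDerivAt φ (∑ i, fderiv ℝ (g i) (y, t) (1, 0) * ℓ (w i)) y := by
      refine HasDerivAt.fun_sum fun i _ => HasDerivAt.mul_const ?_ _
      exact ((hg i).differentiable (by simp) (y, (t : ℝ))).hasFDerivAt.comp_hasDerivAt y
        ((hasDerivAt_id _).prodMk (hasDerivAt_const _ _))
    convert h2 using 1
    have h3 := derivS_eq_sum hg hf ⟨y, hy⟩ t
    rw [h] at h3
    simpa using congrArg ℓ h3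
  have hcon := constant_of_has_deriv_right_zero (f := φ) (a := 0) (b := 1)
    (fun y hy => (hφ y hy).continuousAt.continuousWithinAt)
    (fun y hy => (hφ y ⟨hy.1, hy.2.le⟩).hasDerivWithinAt)
  have e : ∀ s : unitInterval, ℓ (f s t) = φ s := fun s => by simp [hf, φ]
  have e1 := e 1
  rw [h1, map_zero] at e1
  rw [e, hcon s s.2, ← hcon 1 ⟨zero_le_one, le_rfl⟩]
  exact e1.symm

/-- A linear map acts on the vectors of a presentation and leaves the coefficient functions alone.
The rules for sums and scalar multiples below follow by applying this to linear maps on `U × U` and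
on `U`. -/
theorem map (hf : Smooth₂ f) (T : U →ₗ[ℝ] W) : Smooth₂ fun s t => T (f s t) := by
  obtain ⟨N, g, w, hg, hf⟩ := hf
  exact of_sum (w := fun i => T (w i)) hg fun s t => by simp [hf]

theorem derivS_map (hf : Smooth₂ f) (T : U →ₗ[ℝ] W) (s t : unitInterval) :
    AInf.derivS (fun s t => T (f s t)) s t = T (AInf.derivS f s t) := by
  obtain ⟨N, g, w, hg, hf⟩ := hf
  rw [derivS_eq_sum (w := fun i => T (w i)) hg fun s t => by simp [hf], derivS_eq_sum hg hf]
  simp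

theorem derivT_map (hf : Smooth₂ f) (T : U →ₗ[ℝ] W) (s t : unitInterval) :
    AInf.derivT (fun s t => T (f s t)) s t = T (AInf.derivT f s t) := by
  obtain ⟨N, g, w, hg, hf⟩ := hf
  rw [derivT_eq_sum (w := fun i => T (w i)) hg fun s t => by simp [hf], derivT_eq_sum hg hf]
  simp

theorem primitive_map (hf : Smooth₂ f) (T : U →ₗ[ℝ] W) (s t : unitInterval) :
    AInf.primitive (fun s t => T (f s t)) s t = T (AInf.primitive f s t) := by
  obtain ⟨N, g, w, hg, hf⟩ := hf
  rw [primitive_eq_sum (w := fun i => T (w i)) hg fun s t => by simp [hf], primitive_eq_sum hg hf]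
  simp

theorem prodMk {f : unitInterval → unitInterval → U} {g : unitInterval → unitInterval → W}
    (hf : Smooth₂ f) (hg : Smooth₂ g) : Smooth₂ fun s t => (f s t, g s t) := by
  obtain ⟨N, a, u, ha, hf⟩ := hf
  obtain ⟨M, b, w, hb, hg⟩ := hg
  refine of_sum (g := Sum.elim a b) (w := Sum.elim (fun i => (u i, 0)) fun i => (0, w i)) ?_ ?_
  · rintro (i | i)
    · exact ha i
    · exact hb i
  · intro s t
    simp [hf, hg, Prod.ext_iff, Prod.fst_sum, Prod.snd_sum]

theorem add (h₁ : Smooth₂ f₁) (h₂ : Smooth₂ f₂) : Smooth₂ fun s t => f₁ s t + f₂ s t :=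
  (h₁.prodMk h₂).map (LinearMap.fst ℝ U U + LinearMap.snd ℝ U U)

theorem derivS_add (h₁ : Smooth₂ f₁) (h₂ : Smooth₂ f₂) (s t : unitInterval) :
    AInf.derivS (fun s t => f₁ s t + f₂ s t) s t = AInf.derivS f₁ s t + AInf.derivS f₂ s t := by
  have h := h₁.prodMk h₂
  rw [show AInf.derivS f₁ s t = _ from h.derivS_map (LinearMap.fst ℝ U U) s t,
    show AInf.derivS f₂ s t = _ from h.derivS_map (LinearMap.snd ℝ U U) s t]
  exact h.derivS_map (LinearMap.fst ℝ U U + LinearMap.snd ℝ U U) s t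

theorem derivT_add (h₁ : Smooth₂ f₁) (h₂ : Smooth₂ f₂) (s t : unitInterval) :
    AInf.derivT (fun s t => f₁ s t + f₂ s t) s t = AInf.derivT f₁ s t + AInf.derivT f₂ s t := by
  have h := h₁.prodMk h₂
  rw [show AInf.derivT f₁ s t = _ from h.derivT_map (LinearMap.fst ℝ U U) s t,
    show AInf.derivT f₂ s t = _ from h.derivT_map (LinearMap.snd ℝ U U) s t]
  exact h.derivT_map (LinearMap.fst ℝ U U + LinearMap.snd ℝ U U) s t

theorem primitive_add (h₁ : Smooth₂ f₁) (h₂ : Smooth₂ f₂) (s t : unitInterval) :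
    AInf.primitive (fun s t => f₁ s t + f₂ s t) s t = AInf.primitive f₁ s t + AInf.primitive f₂ s t := by
  have h := h₁.prodMk h₂
  rw [show AInf.primitive f₁ s t = _ from h.primitive_map (LinearMap.fst ℝ U U) s t,
    show AInf.primitive f₂ s t = _ from h.primitive_map (LinearMap.snd ℝ U U) s t]
  exact h.primitive_map (LinearMap.fst ℝ U U + LinearMap.snd ℝ U U) s t

theorem smul (hf : Smooth₂ f) (c : ℝ) : Smooth₂ fun s t => c • f s t :=
  hf.map (c • LinearMap.id)

theorem derivS_smul (hf : Smooth₂ f) (c : ℝ) (s t : unitInterval) :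
    AInf.derivS (fun s t => c • f s t) s t = c • AInf.derivS f s t :=
  hf.derivS_map (c • LinearMap.id) s t

theorem derivT_smul (hf : Smooth₂ f) (c : ℝ) (s t : unitInterval) :
    AInf.derivT (fun s t => c • f s t) s t = c • AInf.derivT f s t :=
  hf.derivT_map (c • LinearMap.id) s t

theorem primitive_smul (hf : Smooth₂ f) (c : ℝ) (s t : unitInterval) :
    AInf.primitive (fun s t => c • f s t) s t = c • AInf.primitive f s t :=
  hf.primitive_map (c • LinearMap.id) s t

theorem sum {ι : Type*} (A : Finset ι) {f : ι → unitInterval → unitInterval → U}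
    (h : ∀ i ∈ A, Smooth₂ (f i)) : Smooth₂ fun s t => ∑ i ∈ A, f i s t := by
  classical
  induction A using Finset.induction_on with
  | empty => simpa using const (0 : U)
  | insert i A hi ih =>
    simp only [Finset.sum_insert hi]
    exact (h i (by simp)).add (ih fun j hj => h j (by simp [hj]))

theorem derivS_sum {ι : Type*} (A : Finset ι) {f : ι → unitInterval → unitInterval → U}
    (h : ∀ i ∈ A, Smooth₂ (f i)) (s t : unitInterval) :
    AInf.derivS (fun s t => ∑ i ∈ A, f i s t) s t = ∑ i ∈ A, AInf.derivS (f i) s t := by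
  classical
  induction A using Finset.induction_on with
  | empty => simp [derivS_const]
  | insert i A hi ih =>
    simp only [Finset.sum_insert hi]
    rw [derivS_add (h i (by simp)) (sum A fun j hj => h j (by simp [hj])),
      ih fun j hj => h j (by simp [hj])]

theorem derivT_sum {ι : Type*} (A : Finset ι) {f : ι → unitInterval → unitInterval → U}
    (h : ∀ i ∈ A, Smooth₂ (f i)) (s t : unitInterval) :
    AInf.derivT (fun s t => ∑ i ∈ A, f i s t) s t = ∑ i ∈ A, AInf.derivT (f i) s t := by
  classical
  induction A using Finset.induction_on with
  | empty => simp [derivT_const]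
  | insert i A hi ih =>
    simp only [Finset.sum_insert hi]
    rw [derivT_add (h i (by simp)) (sum A fun j hj => h j (by simp [hj])),
      ih fun j hj => h j (by simp [hj])]

theorem primitive_sum {ι : Type*} (A : Finset ι) {f : ι → unitInterval → unitInterval → U}
    (h : ∀ i ∈ A, Smooth₂ (f i)) (s t : unitInterval) :
    AInf.primitive (fun s t => ∑ i ∈ A, f i s t) s t = ∑ i ∈ A, AInf.primitive (f i) s t := by
  classical
  induction A using Finset.induction_on with
  | empty =>
    simp only [Finset.sum_empty]
    rw [primitive_eq_sum (ι := Empty) (g := fun _ _ => 0) (w := fun _ => 0)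
      (fun _ => contDiff_const) (by simp)]
    simp
  | insert i A hi ih =>
    simp only [Finset.sum_insert hi]
    rw [primitive_add (h i (by simp)) (sum A fun j hj => h j (by simp [hj])),
      ih fun j hj => h j (by simp [hj])]

end Smooth₂

end square

/-! ### Sums over deconcatenations of a word -/

section split

variable {V X Y : Type*} [AddCommGroup X] [AddCommGroup Y]

/-- The sum of `φ x y` over all `x ++ y = l`. -/
def split (φ : List V → List V → X) (l : List V) : X :=
  ∑ j ∈ Finset.range (l.length + 1), φ (l.take j) (l.drop j)

theorem split_nil (φ : List V → List V → X) : split φ [] = φ [] [] := by simp [split]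

theorem split_cons (φ : List V → List V → X) (v : V) (l : List V) :
    split φ (v :: l) = φ [] (v :: l) + split (fun x y => φ (v :: x) y) l := by
  simp only [split, List.length_cons]
  rw [Finset.sum_range_succ']
  simp [add_comm]

theorem split_congr {φ ψ : List V → List V → X} {l : List V}
    (h : ∀ x y, x ++ y = l → φ x y = ψ x y) : split φ l = split ψ l :=
  Finset.sum_congr rfl fun _ _ => h _ _ (List.take_append_drop _ _)

theorem split_eq_zero {φ : List V → List V → X} {l : List V}
    (h : ∀ x y, x ++ y = l → φ x y = 0) : split φ l = 0 :=
  Finset.sum_eq_zero fun _ _ => h _ _ (List.take_append_drop _ _)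

theorem split_add (φ ψ : List V → List V → X) (l : List V) :
    split (fun x y => φ x y + ψ x y) l = split φ l + split ψ l :=
  Finset.sum_add_distrib

theorem split_smul [Module ℝ X] (c : ℝ) (φ : List V → List V → X) (l : List V) :
    split (fun x y => c • φ x y) l = c • split φ l :=
  Finset.smul_sum.symm

theorem map_split {T : Type*} [FunLike T X Y] [AddMonoidHomClass T X Y] (f : T)
    (φ : List V → List V → X) (l : List V) : f (split φ l) = split (fun x y => f (φ x y)) l :=
  map_sum f _ _

/-- The cut falls either to the left or to the right of the marked letter `v`. -/
theorem split_append_cons (φ : List V → List V → X) (x : List V) (v : V) (z : List V) :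
    split φ (x ++ v :: z) = split (fun a b => φ a (b ++ v :: z)) x +
      split (fun a b => φ (x ++ v :: a) b) z := by
  induction x generalizing φ with
  | nil => simp [split_cons, split_nil]
  | cons u x ih => simp [split_cons, ih, add_assoc]

theorem split_map {V' : Type*} (f : V → V') (φ : List V' → List V' → X) (l : List V) :
    split φ (l.map f) = split (fun x y => φ (x.map f) (y.map f)) l := by
  simp [split, List.map_take, List.map_drop]

/-- Coassociativity of deconcatenation. -/
theorem split_assoc (φ : List V → List V → List V → X) (l : List V) :
    split (fun w z => split (fun x y => φ x y z) w) l =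
      split (fun x w => split (fun y z => φ x y z) w) l := by
  induction l generalizing φ with
  | nil => simp [split_nil]
  | cons v l ih =>
    simp only [split_cons, split_nil, split_add, ih]
    abel

theorem split_comm {V' : Type*} (φ : List V → List V → List V' → List V' → X) (l : List V)
    (l' : List V') : split (fun x y => split (fun x' y' => φ x y x' y') l') l =
      split (fun x' y' => split (fun x y => φ x y x' y') l) l' :=
  Finset.sum_comm

/-- The sum of `φ x y z` over all `x ++ y ++ z = l`. -/
def split₃ (φ : List V → List V → List V → X) (l : List V) : X :=
  split (fun x w => split (fun y z => φ x y z) w) l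

theorem split₃_congr {φ ψ : List V → List V → List V → X} {l : List V}
    (h : ∀ x y z, x ++ y ++ z = l → φ x y z = ψ x y z) : split₃ φ l = split₃ ψ l :=
  split_congr fun x w hw => split_congr fun y z hz => h x y z (by rw [← hw, ← hz, List.append_assoc])

theorem split₃_eq_zero {φ : List V → List V → List V → X} {l : List V}
    (h : ∀ x y z, x ++ y ++ z = l → φ x y z = 0) : split₃ φ l = 0 :=
  split_eq_zero fun x w hw => split_eq_zero fun y z hz =>
    h x y z (by rw [← hw, ← hz, List.append_assoc])

theorem split₃_add (φ ψ : List V → List V → List V → X) (l : List V) :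
    split₃ (fun x y z => φ x y z + ψ x y z) l = split₃ φ l + split₃ ψ l := by
  simp only [split₃, split_add]

theorem split₃_smul [Module ℝ X] (c : ℝ) (φ : List V → List V → List V → X) (l : List V) :
    split₃ (fun x y z => c • φ x y z) l = c • split₃ φ l := by
  simp only [split₃, split_smul]

theorem map_split₃ {T : Type*} [FunLike T X Y] [AddMonoidHomClass T X Y] (f : T)
    (φ : List V → List V → List V → X) (l : List V) :
    f (split₃ φ l) = split₃ (fun x y z => f (φ x y z)) l := by
  simp only [split₃, map_split]

theorem split₃_map {V' : Type*} (f : V → V') (φ : List V' → List V' → List V' → X) (l : List V) :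
    split₃ φ (l.map f) = split₃ (fun x y z => φ (x.map f) (y.map f) (z.map f)) l := by
  simp only [split₃, split_map]

/-- Both sides run over the decompositions of `l` into five consecutive words, reached by cutting in
different orders. This regroups a nested insertion, where one block lies inside another. -/
theorem split₃_split_split (ψ : List V → List V → List V → List V → List V → X) (l : List V) :
    split₃ (fun x y z => split (fun p q => split (fun q' r => ψ p q y q' r) z) x) l =
      split₃ (fun p w r => split₃ (fun q y q' => ψ p q y q' r) w) l := by
  have h : ∀ x w, split (fun y z => split (fun p q => split (fun q' r => ψ p q y q' r) z) x) w =
      split (fun p q => split (fun y z => split (fun q' r => ψ p q y q' r) z) w) x :=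
    fun x w => split_comm _ _ _
  simp only [split₃, h, split_assoc]

theorem split₃_split₃_left (ψ : List V → List V → List V → List V → List V → X) (l : List V) :
    split₃ (fun x y z => split₃ (fun p q r => ψ p q r y z) x) l =
      split₃ (fun p q w => split₃ (fun r y z => ψ p q r y z) w) l := by
  have h : ∀ x w, split (fun y z => split (fun p u => split (fun q r => ψ p q r y z) u) x) w =
      split (fun p u => split (fun q r => split (fun y z => ψ p q r y z) w) u) x := by
    intro x w
    rw [split_comm]
    exact split_congr fun _ _ _ => split_comm _ _ _
  simp only [split₃, h]
  rw [split_assoc (fun p u w => split (fun q r => split (fun y z => ψ p q r y z) w) u)]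
  simp only [split_assoc]

end split

/-! ### Multilinear operators and insertions -/

section insertion

variable {V W X : Type*} [AddCommGroup V] [Module ℝ V] [AddCommGroup W] [Module ℝ W]
  [AddCommGroup X] [Module ℝ X]

/-- Linearity in each argument. -/
def Multilin (f : Op V W) : Prop := ∀ (x z : List V) (c : ℝ) (a b : V),
  f (x ++ (c • a + b) :: z) = c • f (x ++ a :: z) + f (x ++ b :: z)

/-- A multilinear operator as a linear map of one of its arguments. -/
def Multilin.slot {f : Op V W} (hf : Multilin f) (x z : List V) : V →ₗ[ℝ] W where
  toFun v := f (x ++ v :: z)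
  map_add' a b := by simpa using hf x z 1 a b
  map_smul' c a := by
    have h0 : f (x ++ 0 :: z) = 0 := by simpa using hf x z 1 0 0
    simpa [h0] using hf x z c a 0

theorem Multilin.slot_apply {f : Op V W} (hf : Multilin f) (x z : List V) (v : V) :
    hf.slot x z v = f (x ++ v :: z) := rfl

theorem Multilin.map_zero {f : Op V W} (hf : Multilin f) (x z : List V) :
    f (x ++ 0 :: z) = 0 := _root_.map_zero (hf.slot x z)

theorem Multilin.map_add {f : Op V W} (hf : Multilin f) (x z : List V) (a b : V) :
    f (x ++ (a + b) :: z) = f (x ++ a :: z) + f (x ++ b :: z) := _root_.map_add (hf.slot x z) a b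

theorem Multilin.cons {f : Op V W} (hf : Multilin f) (v : V) : Multilin fun l => f (v :: l) :=
  fun x z => hf (v :: x) z

theorem Multilin.add {f g : Op V W} (hf : Multilin f) (hg : Multilin g) :
    Multilin fun l => f l + g l := by
  intro x z c a b
  simp only [hf x z, hg x z, smul_add]
  abel

theorem Multilin.comp {f : Op V W} (hf : Multilin f) (T : W →ₗ[ℝ] X) :
    Multilin fun l => T (f l) := by
  intro x z c a b
  simp only [hf x z, _root_.map_add, map_smul]

/-- The sum of `f (σ x ++ g y :: z)` over all `x ++ y ++ z = l`. -/
def ins (σ : V → V) (f : Op V W) (g : Op V V) : Op V W := fun l =>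
  split₃ (fun x y z => f (x.map σ ++ g y :: z)) l

theorem circ_eq_ins (A : GradedSpace V) (k : ℤ) (f : Op V W) (g : Op V V) :
    circ A k f g = ins (fun v => if Even k then v else A.sg v) f g := by
  funext l
  simp only [circ, ins, split₃, split, List.length_drop, List.drop_drop]

theorem circ_zero (A : GradedSpace V) (f : Op V W) (g : Op V V) : circ A 0 f g = ins id f g := by
  rw [circ_eq_ins]; simp; rfl

theorem circ_one (A : GradedSpace V) (f : Op V W) (g : Op V V) : circ A 1 f g = ins A.sg f g := by
  rw [circ_eq_ins]; simp

theorem circ_neg_one (A : GradedSpace V) (f : Op V W) (g : Op V V) :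
    circ A (-1) f g = ins A.sg f g := by
  rw [circ_eq_ins]; simp

theorem ins_cons (f : Op V W) (g : Op V V) (v : V) (l : List V) :
    ins id f g (v :: l) = split (fun y z => f (g y :: z)) (v :: l) +
      ins id (fun l => f (v :: l)) g l := by
  simp [ins, split₃, split_cons (X := W) (fun x w => split _ w)]

/-- The inserted block lies to the left of the marked letter, contains it, or lies to its right. -/
theorem ins_append_cons (σ : V → V) (f : Op V W) (g : Op V V) (x : List V) (v : V) (z : List V) :
    ins σ f g (x ++ v :: z) =
      split₃ (fun p q r => f (p.map σ ++ g q :: (r ++ v :: z))) x +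
      split (fun p q => split (fun q' r => f (p.map σ ++ g (q ++ v :: q') :: r)) z) x +
      split₃ (fun p q r => f ((x ++ v :: p).map σ ++ g q :: r)) z := by
  simp only [ins, split₃]
  rw [split_append_cons]
  simp only [split_append_cons, split_add]

theorem ins_add_left (σ : V → V) (f f' : Op V W) (g : Op V V) (l : List V) :
    ins σ (fun l => f l + f' l) g l = ins σ f g l + ins σ f' g l :=
  split₃_add _ _ _

theorem ins_add_right (σ : V → V) {f : Op V W} (hf : Multilin f) (g g' : Op V V) (l : List V) :
    ins σ f (fun l => g l + g' l) l = ins σ f g l + ins σ f g' l := by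
  simp only [ins, hf.map_add, split₃_add]

theorem ins_neg_right (σ : V → V) {f : Op V W} (hf : Multilin f) (g : Op V V) (l : List V) :
    ins σ f (fun l => - g l) l = - ins σ f g l := by
  have := ins_add_right σ hf g (fun l => - g l) l
  refine (neg_eq_of_add_eq_zero_right ?_).symm
  rw [← this]
  refine split₃_eq_zero fun x y z _ => ?_
  simpa using hf.map_zero (x.map σ) z

theorem comp_ins {Y : Type*} [AddCommGroup Y] [Module ℝ Y] (σ : V → V) (f : Op V W) (g : Op V V)
    (T : W →ₗ[ℝ] Y) (l : List V) : T (ins σ f g l) = ins σ (fun l => T (f l)) g l :=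
  map_split₃ T _ _

theorem map_ins {V' W' : Type*} [AddCommGroup V'] [AddCommGroup W'] [Module ℝ W']
    [Module ℝ V'] {σ : V → V} {σ' : V' → V'}
    {f : Op V W} {f' : Op V' W'} {g : Op V V} {g' : Op V' V'} (T : W →ₗ[ℝ] W') (ρ : V → V')
    (hσ : ∀ v, ρ (σ v) = σ' (ρ v)) (hf : ∀ l, T (f l) = f' (l.map ρ))
    (hg : ∀ l, ρ (g l) = g' (l.map ρ)) (l : List V) :
    T (ins σ f g l) = ins σ' f' g' (l.map ρ) := by
  rw [ins, map_split₃, ins, split₃_map]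
  refine split₃_congr fun x y z _ => ?_
  rw [hf]
  simp [hg, Function.comp_def, hσ]

theorem Multilin.ins {f : Op V W} {g : Op V V} (hf : Multilin f) (hg : Multilin g)
    (σ : V →ₗ[ℝ] V) : Multilin (ins σ f g) := by
  intro x z c a b
  simp only [ins_append_cons, smul_add, ← split₃_smul, ← split_smul]
  rw [show ∀ a b c d e f : W, a + b + c + (d + e + f) = (a + d) + (b + e) + (c + f) by
    intros; abel, ← split₃_add, ← split₃_add, ← split_add]
  simp only [← split_add]
  congr 1
  · congr 1
    · refine split₃_congr fun p q r _ => ?_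
      simpa using hf (p.map σ ++ g q :: r) z c a b
    · refine split_congr fun p q _ => split_congr fun q' r _ => ?_
      rw [hg, hf]
  · refine split₃_congr fun p q r _ => ?_
    simpa using hf (x.map σ) (p.map σ ++ g q :: r) c (σ a) (σ b)

theorem Multilin.map_split₃ {f : Op V W} (hf : Multilin f) {V' : Type*}
    (φ : List V' → List V' → List V' → V) (x l z) :
    f (x ++ split₃ φ l :: z) = split₃ (fun p q r => f (x ++ φ p q r :: z)) l :=
  AInf.map_split₃ (hf.slot x z) φ l

/-- The pre-Lie identity of the circle product, for `a` commuting with the sign `σ`. -/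
theorem ins_ins (σ : V →ₗ[ℝ] V) {F : Op V W} (hF : Multilin F) {a m : Op V V}
    (ha : ∀ l, σ (a l) = a (l.map σ)) (l : List V) :
    ins σ (ins id F a) m l + ins σ F (ins id m a) l =
      ins id (ins σ F m) a l + ins σ F (ins σ a m) l := by
  -- The letter `m y` is marked, and the block of `a` is left of it, contains it, or is right of it.
  -- In the first case `σ` has acted on all letters of that block, and `ha` turns this into `σ (a
  -- q)`.
  have h1 : ins σ (ins id F a) m l =
      split₃ (fun x y z => split₃ (fun p q r =>
        F (p.map σ ++ σ (a q) :: (r.map σ ++ m y :: z))) x) l +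
      ins σ F (ins σ a m) l +
      split₃ (fun x y z => split₃ (fun p q r =>
        F (x.map σ ++ m y :: (p ++ a q :: r))) z) l := by
    rw [ins]
    simp only [ins_append_cons, split₃_add, split₃_map, split_map]
    congr 1
    · congr 1
      · simp [ha]
      · rw [ins]
        simp only [ins, hF.map_split₃]
        rw [← split₃_split_split]
        simp
    · simp
  have h2 : ins id (ins σ F m) a l =
      split₃ (fun x y z => split₃ (fun p q r =>
        F (p.map σ ++ m q :: (r ++ a y :: z))) x) l +
      ins σ F (ins id m a) l +
      split₃ (fun x y z => split₃ (fun p q r =>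
        F (x.map σ ++ σ (a y) :: (p.map σ ++ m q :: r))) z) l := by
    rw [ins]
    simp only [ins_append_cons, split₃_add]
    congr 1
    · congr 1
      · simp
      · rw [ins]
        simp only [ins, hF.map_split₃]
        rw [← split₃_split_split]
        simp
    · simp
  -- The terms with disjoint blocks agree on both sides; only the nested ones differ.
  rw [h1, h2, split₃_split₃_left, split₃_split₃_left]
  abel

end insertion

/-! ### Compositions with a sequence of maps in all arguments -/

section blocks

variable {V W X : Type*} [AddCommGroup V] [Module ℝ V] [AddCommGroup W] [Module ℝ W]
  [AddCommGroup X] [Module ℝ X]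

/-- The sum of `m [F y₁, …, F yᵣ]` over all decompositions of a word into nonempty words `yᵢ`. -/
def blocks (m : Op W X) (F : Op V W) : Op V X
  | [] => m []
  | v :: l => ∑ j ∈ Finset.range (l.length + 1),
      blocks (fun w => m (F (v :: l.take j) :: w)) F (l.drop j)
termination_by l => l.length
decreasing_by simp

theorem blocks_nil (m : Op W X) (F : Op V W) : blocks m F [] = m [] := by rw [blocks]

theorem blocks_cons (m : Op W X) (F : Op V W) (v : V) (l : List V) :
    blocks m F (v :: l) = split (fun y z => blocks (fun w => m (F (v :: y) :: w)) F z) l := by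
  rw [blocks]; rfl

/-- The sum of `m [F y₁, …, F' yᵢ, …, F yᵣ]` over all decompositions of a word into nonempty words
and all positions `i`. -/
def blocks₁ (m : Op W X) (F F' : Op V W) : Op V X
  | [] => 0
  | v :: l => ∑ j ∈ Finset.range (l.length + 1),
      (blocks (fun w => m (F' (v :: l.take j) :: w)) F (l.drop j) +
        blocks₁ (fun w => m (F (v :: l.take j) :: w)) F F' (l.drop j))
termination_by l => l.length
decreasing_by simp

theorem blocks₁_nil (m : Op W X) (F F' : Op V W) : blocks₁ m F F' [] = 0 := by rw [blocks₁]

theorem blocks₁_cons (m : Op W X) (F F' : Op V W) (v : V) (l : List V) :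
    blocks₁ m F F' (v :: l) = split (fun y z => blocks (fun w => m (F' (v :: y) :: w)) F z +
      blocks₁ (fun w => m (F (v :: y) :: w)) F F' z) l := by
  rw [blocks₁]; rfl

/-- `blocks` cuts off a nonempty initial word, so the induction hypothesis is required for every
remaining suffix. -/
theorem length_induction {V : Type*} {P : List V → Prop} (l : List V)
    (nil : P []) (cons : ∀ v l, (∀ y z, y ++ z = l → P z) → P (v :: l)) : P l := by
  induction hn : l.length using Nat.strong_induction_on generalizing l with
  | _ n ih =>
    cases l with
    | nil => exact nil
    | cons v l =>
      refine cons v l fun y z h => ih z.length ?_ z rfl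
      rw [← hn, ← h]
      simp

theorem blocks_linear (m m' : Op W X) (F : Op V W) (c : ℝ) (l : List V) :
    blocks (fun w => c • m w + m' w) F l = c • blocks m F l + blocks m' F l := by
  induction l using length_induction generalizing m m' with
  | nil => simp [blocks_nil]
  | cons v l ih =>
    simp only [blocks_cons, ← split_smul, ← split_add]
    exact split_congr fun y z h => ih y z h _ _

theorem blocks_add (m m' : Op W X) (F : Op V W) (l : List V) :
    blocks (fun w => m w + m' w) F l = blocks m F l + blocks m' F l := by
  simpa using blocks_linear m m' F 1 l

theorem map_blocks {V' W' X' : Type*} [AddCommGroup V'] [Module ℝ V'] [AddCommGroup W']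
    [Module ℝ W'] [AddCommGroup X'] [Module ℝ X']
    {m : Op W X} {m' : Op W' X'} {F : Op V W} {F' : Op V' W'} (T : X →ₗ[ℝ] X') (τ : W → W')
    (ρ : V → V') (hm : ∀ l, T (m l) = m' (l.map τ))
    (hF : ∀ l, τ (F l) = F' (l.map ρ)) (l : List V) :
    T (blocks m F l) = blocks m' F' (l.map ρ) := by
  induction l using length_induction generalizing m m' with
  | nil => simp [blocks_nil, hm, blocks_nil (W := W')]
  | cons v l ih =>
    rw [blocks_cons, map_split, List.map_cons, blocks_cons, split_map]
    refine split_congr fun y z h => ih y z h fun l => ?_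
    rw [hm]
    simp [hF]

/-- `blocks` as a linear map of the first argument of `m`. -/
def blocksSlot {m : Op W X} (hm : Multilin m) (F : Op V W) (l : List V) : W →ₗ[ℝ] X where
  toFun u := blocks (fun w => m (u :: w)) F l
  map_add' a b := by
    rw [← blocks_add]
    exact congrArg (fun m => blocks m F l) (funext fun w => hm.map_add [] w a b)
  map_smul' c a := by
    have := blocks_linear (fun w => m (a :: w)) (fun _ => 0) F c l
    have h0 := blocks_linear (fun _ => (0 : X)) (fun _ => 0) F 1 l
    simp only [smul_zero, add_zero, one_smul, left_eq_add] at h0 this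
    rw [h0, add_zero] at this
    rw [RingHom.id_apply, ← this]
    exact congrArg (fun m => blocks m F l) (funext fun w => map_smul (hm.slot [] w) c a)

theorem blocksSlot_apply {m : Op W X} (hm : Multilin m) (F : Op V W) (l : List V) (u : W) :
    blocksSlot hm F l u = blocks (fun w => m (u :: w)) F l := rfl

theorem blocks_append_zero {m : Op W X} (hm : Multilin m) {F : Op V W} (hF : Multilin F)
    (x z : List V) : blocks m F (x ++ 0 :: z) = 0 := by
  induction x using length_induction generalizing m with
  | nil =>
    rw [List.nil_append, blocks_cons]
    refine split_eq_zero fun y z _ => ?_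
    rw [← blocksSlot_apply hm, show F (0 :: y) = 0 from hF.map_zero [] y, map_zero]
  | cons v x ih =>
    rw [List.cons_append, blocks_cons, split_append_cons]
    rw [split_eq_zero fun y z h => ih y z h (hm.cons _), zero_add]
    refine split_eq_zero fun y z _ => ?_
    rw [← blocksSlot_apply hm, show F (v :: (x ++ 0 :: y)) = 0 from hF.map_zero (v :: x) y,
      map_zero]

/-- `m(F, …, F) ∘ a = ∑ m(F, …, F ∘ a, …, F)`. -/
theorem ins_blocks {m : Op W X} (hm : Multilin m) {F : Op V W} (hF : Multilin F) {a : Op V V}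
    (ha : a [] = 0) (l : List V) :
    ins id (blocks m F) a l = blocks₁ m F (ins id F a) l := by
  induction l using length_induction generalizing m with
  | nil =>
    simp only [ins, split₃, split_nil, blocks₁_nil, ha]
    exact blocks_append_zero hm hF [] []
  | cons v l ih =>
    -- An insertion into the first block `v :: y` either swallows `v` or starts after it; the empty
    -- insertion before `v` vanishes since `a [] = 0`.
    have h1 : ∀ y, ins id F a (v :: y) = split (fun p q => F (a (v :: p) :: q)) y +
        split₃ (fun p q r => F (v :: (p ++ a q :: r))) y := by
      intro y
      rw [ins_cons, split_cons, ha, show F (0 :: v :: y) = 0 from hF.map_zero [] _, zero_add]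
      simp [ins]
    have h2 : split (fun y z => blocks (fun w => m (ins id F a (v :: y) :: w)) F z) l =
        split (fun y z => split (fun p q =>
          blocks (fun w => m (F (a (v :: y) :: p) :: w)) F q) z) l +
        split₃ (fun p q r => split (fun y z =>
          blocks (fun w => m (F (v :: (p ++ a q :: y)) :: w)) F z) r) l := by
      have : ∀ y z, blocks (fun w => m (ins id F a (v :: y) :: w)) F z =
          split (fun p q => blocks (fun w => m (F (a (v :: p) :: q) :: w)) F z) y +
          split₃ (fun p q r => blocks (fun w => m (F (v :: (p ++ a q :: r)) :: w)) F z) y := by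
        intro y z
        rw [← blocksSlot_apply hm, h1, map_add, map_split, map_split₃]
        rfl
      simp only [this, split_add, split₃, split_assoc]
    rw [blocks₁_cons, split_add, h2, ins_cons, split_cons, ha,
      show blocks m F (0 :: v :: l) = 0 from blocks_append_zero hm hF [] _, zero_add, add_assoc]
    congr 1
    · simp only [blocks_cons]
    -- What remains are the insertions that start after `v`: those in the first block, and those in
    -- a later block, which the induction hypothesis covers.
    · rw [← split_congr fun y z h => ih y z h (hm.cons (F (v :: y)))]
      simp only [ins, List.map_id, blocks_cons, split_append_cons, split₃_add]
      rw [add_comm]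
      congr 1
      have h3 : ∀ x w, split (fun y z => split (fun p q =>
          blocks (fun w => m (F (v :: p) :: w)) F (q ++ a y :: z)) x) w =
          split (fun p q => split (fun y z =>
            blocks (fun w => m (F (v :: p) :: w)) F (q ++ a y :: z)) w) x :=
        fun x w => split_comm _ _ _
      simp only [split₃, h3, split_assoc]

/-- Only the decomposition into single letters survives. This evaluates the left side of the
morphism equation at `s = 1`, where `G` is the identity. -/
theorem blocks_of_unit {m : Op V X} (hm : Multilin m) {F : Op V V} (h1 : ∀ v, F [v] = v)
    (h2 : ∀ u v l, F (u :: v :: l) = 0) (l : List V) : blocks m F l = m l := by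
  induction l generalizing m with
  | nil => rw [blocks_nil]
  | cons v l ih =>
    rw [blocks_cons]
    cases l with
    | nil => rw [split_nil, blocks_nil, h1]
    | cons u l =>
      rw [split_cons, h1, ih (hm.cons v), split_eq_zero, add_zero]
      intro y z _
      rw [h2, ← blocksSlot_apply hm, map_zero]

/-- Only the decomposition into a single block survives. It is applied to the de Rham differential.
-/
theorem blocks_of_unary {m : Op W X} (hm : ∀ u v l, m (u :: v :: l) = 0)
    {F : Op V W} {l : List V} (hl : l ≠ []) : blocks m F l = m [F l] := by
  have h0 : ∀ (u : W) (v : V) (l : List V), blocks (fun w => m (u :: w)) F (v :: l) = 0 := by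
    intro u v l
    rw [blocks_cons]
    refine split_eq_zero fun y z _ => ?_
    simp only [hm]
    simpa using blocks_linear (fun _ => (0 : X)) (fun _ => 0) F 1 z
  obtain ⟨v, l, rfl⟩ := List.exists_cons_of_ne_nil hl
  rw [blocks_cons]
  have : ∀ (φ : List V → List V → X) (l : List V), (∀ x v z, φ x (v :: z) = 0) →
      split φ l = φ l [] := by
    intro φ l hφ
    induction l generalizing φ with
    | nil => rw [split_nil]
    | cons v l ih => rw [split_cons, hφ, zero_add, ih _ fun x => hφ (_ :: x)]
  rw [this _ _ fun y v z => h0 _ v z, blocks_nil]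

/-- Splitting off the first part, which is positive and hence written `j + 1`, gives the sum over
compositions the same recursion as `blocks`. -/
theorem sum_composition_succ {X : Type*} [AddCommMonoid X] (n : ℕ) (Φ : List ℕ → X) :
    ∑ c : Composition (n + 1), Φ c.blocks =
      ∑ j ∈ Finset.range (n + 1), ∑ c : Composition (n - j), Φ ((j + 1) :: c.blocks) := by
  rw [Finset.sum_sigma']
  symm
  refine Finset.sum_bij (fun x hx => ⟨(x.1 + 1) :: x.2.blocks, ?_, ?_⟩) ?_ ?_ ?_ ?_
  · intro i hi
    rcases List.mem_cons.1 hi with rfl | hi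
    · omega
    · exact x.2.blocks_pos hi
  · have : x.1 < n + 1 := by simpa using hx
    rw [List.sum_cons, x.2.blocks_sum]
    omega
  · simp
  · rintro ⟨i, c⟩ _ ⟨j, c'⟩ _ h
    rw [Composition.mk.injEq, List.cons.injEq] at h
    dsimp only at h
    obtain rfl : i = j := by omega
    obtain rfl : c = c' := Composition.ext h.2
    rfl
  · rintro ⟨bs, hpos, hsum⟩ _
    cases bs with
    | nil => simp at hsum
    | cons b bs =>
      have hb : 0 < b := hpos (by simp)
      rw [List.sum_cons] at hsum
      refine ⟨⟨b - 1, ⟨bs, fun hi => hpos (by simp [hi]), by omega⟩⟩, ?_, ?_⟩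
      · simp; omega
      · simp; omega
  · intro x _
    rfl

theorem sum_composition_eq_blocks_aux (m : Op W X) (F : Op V W) (l : List V) (n : ℕ)
    (hn : n = l.length) :
    ∑ c : Composition n, m ((l.splitWrtCompositionAux c.blocks).map F) = blocks m F l := by
  induction l using length_induction generalizing m n with
  | nil =>
    subst hn
    have h0 : ∀ c : Composition ([] : List V).length, c.blocks = [] :=
      fun c => c.blocks_eq_nil.2 rfl
    rw [blocks_nil]
    refine (Finset.sum_eq_single_of_mem (Composition.ones 0) (Finset.mem_univ _)
      fun c _ hc => (hc (Composition.ext ((h0 c).trans (h0 _).symm))).elim).trans ?_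
    rfl
  | cons v l ih =>
    subst hn
    rw [List.length_cons, sum_composition_succ _ fun bs =>
      m (((v :: l).splitWrtCompositionAux bs).map F), blocks_cons, split]
    refine Finset.sum_congr rfl fun j hj => ?_
    rw [← ih (l.take j) (l.drop j) (List.take_append_drop _ _) _ (l.length - j) (by simp)]
    simp [List.splitWrtCompositionAux_cons]

theorem sum_composition_eq_blocks (m : Op W X) (F : Op V W) (l : List V) :
    ∑ c : Composition l.length, m ((l.splitWrtComposition c).map F) = blocks m F l :=
  sum_composition_eq_blocks_aux m F l _ rfl

end blocks

/-! ### Smooth families of operators on the square -/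

section families

variable {U V W : Type*} [AddCommGroup U] [Module ℝ U] [AddCommGroup V] [Module ℝ V]
  [AddCommGroup W] [Module ℝ W]

theorem vderiv_const (u : U) (t : unitInterval) : vderiv (fun _ => u) t = 0 :=
  congrFun (congrFun (Smooth₂.derivT_const u) 0) t

theorem Smooth₂.restrict {f : unitInterval → unitInterval → U} (hf : Smooth₂ f)
    (s₀ : unitInterval) : Smooth₂ fun _ t => f s₀ t := by
  obtain ⟨N, g, w, hg, hf⟩ := hf
  exact of_sum (g := fun i x => g i (s₀, x.2)) (fun i => (hg i).comp (by fun_prop))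
    fun s t => hf s₀ t

theorem Smooth₂.fun_smul {f : unitInterval → unitInterval → U} (hf : Smooth₂ f) {g : ℝ × ℝ → ℝ}
    (hg : ContDiff ℝ ∞ g) : Smooth₂ fun s t => g (s, t) • f s t := by
  obtain ⟨N, h, w, hh, hf⟩ := hf
  exact of_sum (g := fun i x => g x * h i x) (w := w) (fun i => hg.mul (hh i)) fun s t => by
    simp [hf, Finset.smul_sum, mul_smul]

theorem Smooth₂.derivS_fun_smul {f : unitInterval → unitInterval → U} (hf : Smooth₂ f)
    {g : ℝ × ℝ → ℝ} (hg : ContDiff ℝ ∞ g) (s t : unitInterval) :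
    AInf.derivS (fun s t => g (s, t) • f s t) s t =
      fderiv ℝ g (s, t) (1, 0) • f s t + g (s, t) • AInf.derivS f s t := by
  obtain ⟨N, h, w, hh, hf⟩ := hf
  rw [derivS_eq_sum (g := fun i x => g x * h i x) (w := w) (fun i => hg.mul (hh i)) fun s t => by
    simp [hf, Finset.smul_sum, mul_smul], derivS_eq_sum hh hf, hf, Finset.smul_sum,
    Finset.smul_sum, ← Finset.sum_add_distrib]
  refine Finset.sum_congr rfl fun i _ => ?_
  rw [fderiv_fun_mul (hg.differentiable (by simp) _) ((hh i).differentiable (by simp) _)]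
  simp only [add_apply, smul_apply, smul_eq_mul,
    smul_smul, ← add_smul]
  congr 1
  ring

theorem Smooth₂.derivT_fun_smul {f : unitInterval → unitInterval → U} (hf : Smooth₂ f)
    {g : ℝ × ℝ → ℝ} (hg : ContDiff ℝ ∞ g) (s t : unitInterval) :
    AInf.derivT (fun s t => g (s, t) • f s t) s t =
      fderiv ℝ g (s, t) (0, 1) • f s t + g (s, t) • AInf.derivT f s t := by
  obtain ⟨N, h, w, hh, hf⟩ := hf
  rw [derivT_eq_sum (g := fun i x => g x * h i x) (w := w) (fun i => hg.mul (hh i)) fun s t => by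
    simp [hf, Finset.smul_sum, mul_smul], derivT_eq_sum hh hf, hf, Finset.smul_sum,
    Finset.smul_sum, ← Finset.sum_add_distrib]
  refine Finset.sum_congr rfl fun i _ => ?_
  rw [fderiv_fun_mul (hg.differentiable (by simp) _) ((hh i).differentiable (by simp) _)]
  simp only [add_apply, smul_apply, smul_eq_mul,
    smul_smul, ← add_smul]
  congr 1
  ring

/-- A smooth family of multilinear operators. -/
structure SmoothFam (f : unitInterval → unitInterval → Op V W) : Prop where
  multilin : ∀ s t, Multilin (f s t)
  smooth : ∀ l, Smooth₂ fun s t => f s t l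

/-- The partial derivative of a family of operators in the first variable. -/
noncomputable def dS (f : unitInterval → unitInterval → Op V W) :
    unitInterval → unitInterval → Op V W :=
  fun s t l => derivS (fun s t => f s t l) s t

/-- The partial derivative of a family of operators in the second variable. -/
noncomputable def dT (f : unitInterval → unitInterval → Op V W) :
    unitInterval → unitInterval → Op V W :=
  fun s t l => derivT (fun s t => f s t l) s t

theorem smooth₂_split {f : List V → List V → unitInterval → unitInterval → W} (l : List V)
    (h : ∀ x y, Smooth₂ (f x y)) : Smooth₂ fun s t => split (fun x y => f x y s t) l :=
  Smooth₂.sum _ fun _ _ => h _ _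

theorem smooth₂_split₃ {f : List V → List V → List V → unitInterval → unitInterval → W}
    (l : List V) (h : ∀ x y z, Smooth₂ (f x y z)) :
    Smooth₂ fun s t => split₃ (fun x y z => f x y z s t) l :=
  smooth₂_split l fun _ _ => smooth₂_split _ fun _ _ => h _ _ _

theorem derivS_split {f : List V → List V → unitInterval → unitInterval → W} (l : List V)
    (h : ∀ x y, Smooth₂ (f x y)) (s t : unitInterval) :
    derivS (fun s t => split (fun x y => f x y s t) l) s t =
      split (fun x y => derivS (f x y) s t) l :=
  Smooth₂.derivS_sum _ (fun _ _ => h _ _) s t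

theorem derivS_split₃ {f : List V → List V → List V → unitInterval → unitInterval → W}
    (l : List V) (h : ∀ x y z, Smooth₂ (f x y z)) (s t : unitInterval) :
    derivS (fun s t => split₃ (fun x y z => f x y z s t) l) s t =
      split₃ (fun x y z => derivS (f x y z) s t) l := by
  unfold split₃
  rw [derivS_split l fun _ _ => smooth₂_split _ fun _ _ => h _ _ _]
  exact split_congr fun x w _ => derivS_split w (fun _ _ => h _ _ _) s t

theorem derivT_split {f : List V → List V → unitInterval → unitInterval → W} (l : List V)
    (h : ∀ x y, Smooth₂ (f x y)) (s t : unitInterval) :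
    derivT (fun s t => split (fun x y => f x y s t) l) s t =
      split (fun x y => derivT (f x y) s t) l :=
  Smooth₂.derivT_sum _ (fun _ _ => h _ _) s t

theorem derivT_split₃ {f : List V → List V → List V → unitInterval → unitInterval → W}
    (l : List V) (h : ∀ x y z, Smooth₂ (f x y z)) (s t : unitInterval) :
    derivT (fun s t => split₃ (fun x y z => f x y z s t) l) s t =
      split₃ (fun x y z => derivT (f x y z) s t) l := by
  unfold split₃
  rw [derivT_split l fun _ _ => smooth₂_split _ fun _ _ => h _ _ _]
  exact split_congr fun x w _ => derivT_split w (fun _ _ => h _ _ _) s t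

namespace SmoothFam

variable {F : unitInterval → unitInterval → Op V W}

/-- Linearity pulls the coefficient functions of a varying argument out of the operator. The Leibniz
rules thereby reduce to products of a scalar function with a family evaluated on constant words. -/
theorem slot_eq_sum (hF : SmoothFam F) {N : ℕ} {g : Fin N → ℝ × ℝ → ℝ} {w : Fin N → V}
    {u : unitInterval → unitInterval → V} (hu : ∀ s t, u s t = ∑ i, g i (s, t) • w i)
    (x z : List V) (s t : unitInterval) :
    F s t (x ++ u s t :: z) = ∑ i, g i (s, t) • F s t (x ++ w i :: z) := by
  rw [← (hF.multilin s t).slot_apply, hu, map_sum]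
  simp only [map_smul]
  rfl

theorem smooth_slot (hF : SmoothFam F) {u : unitInterval → unitInterval → V} (hu : Smooth₂ u)
    (x z : List V) : Smooth₂ fun s t => F s t (x ++ u s t :: z) := by
  obtain ⟨N, g, w, hg, hu⟩ := hu
  simp only [hF.slot_eq_sum hu]
  exact Smooth₂.sum _ fun i _ => (hF.smooth _).fun_smul (hg i)

theorem cons (hF : SmoothFam F) {u : unitInterval → unitInterval → V} (hu : Smooth₂ u) :
    SmoothFam fun s t l => F s t (u s t :: l) :=
  ⟨fun s t => (hF.multilin s t).cons _, fun l => hF.smooth_slot hu [] l⟩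

theorem comp (hF : SmoothFam F) (T : W →ₗ[ℝ] U) : SmoothFam fun s t l => T (F s t l) :=
  ⟨fun s t => (hF.multilin s t).comp T, fun l => (hF.smooth l).map T⟩

theorem restrict (hF : SmoothFam F) (s₀ : unitInterval) : SmoothFam fun _ t => F s₀ t :=
  ⟨fun _ t => hF.multilin s₀ t, fun l => (hF.smooth l).restrict s₀⟩

theorem ins (hF : SmoothFam F) {M : unitInterval → unitInterval → Op V V} (hM : SmoothFam M)
    (σ : V →ₗ[ℝ] V) : SmoothFam fun s t => AInf.ins σ (F s t) (M s t) :=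
  ⟨fun s t => (hF.multilin s t).ins (hM.multilin s t) σ,
    fun l => smooth₂_split₃ l fun _ y _ => hF.smooth_slot (hM.smooth y) _ _⟩

theorem dS (hF : SmoothFam F) : SmoothFam (dS F) := by
  refine ⟨fun s t x z c a b => ?_, fun l => (hF.smooth l).derivS⟩
  have h := fun s t => hF.multilin s t x z c a b
  simp only [AInf.dS, h]
  rw [Smooth₂.derivS_add ((hF.smooth _).smul c) (hF.smooth _), (hF.smooth _).derivS_smul]

theorem derivS_slot (hF : SmoothFam F) {u : unitInterval → unitInterval → V} (hu : Smooth₂ u)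
    (x z : List V) (s t : unitInterval) :
    derivS (fun s t => F s t (x ++ u s t :: z)) s t =
      AInf.dS F s t (x ++ u s t :: z) + F s t (x ++ derivS u s t :: z) := by
  obtain ⟨N, g, w, hg, hu⟩ := hu
  rw [hF.dS.slot_eq_sum hu, ← (hF.multilin s t).slot_apply, derivS_eq_sum hg hu, map_sum]
  simp only [hF.slot_eq_sum hu]
  rw [Smooth₂.derivS_sum _ fun i _ => (hF.smooth _).fun_smul (hg i), ← Finset.sum_add_distrib]
  refine Finset.sum_congr rfl fun i _ => ?_
  rw [(hF.smooth _).derivS_fun_smul (hg i), add_comm, map_smul]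
  rfl

theorem dS_ins (hF : SmoothFam F) {M : unitInterval → unitInterval → Op V V} (hM : SmoothFam M)
    (σ : V → V) (s t : unitInterval) (l : List V) :
    AInf.dS (fun s t => AInf.ins σ (F s t) (M s t)) s t l =
      AInf.ins σ (AInf.dS F s t) (M s t) l + AInf.ins σ (F s t) (AInf.dS M s t) l := by
  unfold AInf.dS AInf.ins
  rw [derivS_split₃ l fun _ y _ => hF.smooth_slot (hM.smooth y) _ _, ← split₃_add]
  exact split₃_congr fun x y z _ => hF.derivS_slot (hM.smooth y) _ _ s t

theorem dT (hF : SmoothFam F) : SmoothFam (dT F) := by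
  refine ⟨fun s t x z c a b => ?_, fun l => (hF.smooth l).derivT⟩
  have h := fun s t => hF.multilin s t x z c a b
  simp only [AInf.dT, h]
  rw [Smooth₂.derivT_add ((hF.smooth _).smul c) (hF.smooth _), (hF.smooth _).derivT_smul]

theorem derivT_slot (hF : SmoothFam F) {u : unitInterval → unitInterval → V} (hu : Smooth₂ u)
    (x z : List V) (s t : unitInterval) :
    derivT (fun s t => F s t (x ++ u s t :: z)) s t =
      AInf.dT F s t (x ++ u s t :: z) + F s t (x ++ derivT u s t :: z) := by
  obtain ⟨N, g, w, hg, hu⟩ := hu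
  rw [hF.dT.slot_eq_sum hu, ← (hF.multilin s t).slot_apply, derivT_eq_sum hg hu, map_sum]
  simp only [hF.slot_eq_sum hu]
  rw [Smooth₂.derivT_sum _ fun i _ => (hF.smooth _).fun_smul (hg i), ← Finset.sum_add_distrib]
  refine Finset.sum_congr rfl fun i _ => ?_
  rw [(hF.smooth _).derivT_fun_smul (hg i), add_comm, map_smul]
  rfl

theorem dT_ins (hF : SmoothFam F) {M : unitInterval → unitInterval → Op V V} (hM : SmoothFam M)
    (σ : V → V) (s t : unitInterval) (l : List V) :
    AInf.dT (fun s t => AInf.ins σ (F s t) (M s t)) s t l =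
      AInf.ins σ (AInf.dT F s t) (M s t) l + AInf.ins σ (F s t) (AInf.dT M s t) l := by
  unfold AInf.dT AInf.ins
  rw [derivT_split₃ l fun _ y _ => hF.smooth_slot (hM.smooth y) _ _, ← split₃_add]
  exact split₃_congr fun x y z _ => hF.derivT_slot (hM.smooth y) _ _ s t

theorem smooth_blocks {M : unitInterval → unitInterval → Op W U} (hM : SmoothFam M)
    (hF : SmoothFam F) (l : List V) : Smooth₂ fun s t => blocks (M s t) (F s t) l := by
  induction l using length_induction generalizing M with
  | nil => simpa only [blocks_nil] using hM.smooth []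
  | cons v l ih =>
    simp only [blocks_cons]
    refine Smooth₂.sum _ fun j _ => ?_
    exact ih _ _ (List.take_append_drop _ _) (hM.cons (hF.smooth _))

theorem derivS_blocks {M : unitInterval → unitInterval → Op W U} (hM : SmoothFam M)
    (hF : SmoothFam F) (l : List V) (s t : unitInterval) :
    derivS (fun s t => blocks (M s t) (F s t) l) s t =
      blocks (AInf.dS M s t) (F s t) l + blocks₁ (M s t) (F s t) (AInf.dS F s t) l := by
  induction l using length_induction generalizing M with
  | nil => simp only [blocks_nil, blocks₁_nil, add_zero]; rfl
  | cons v l ih =>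
    simp only [blocks_cons, blocks₁_cons]
    rw [derivS_split l fun _ _ => smooth_blocks (hM.cons (hF.smooth _)) hF _, ← split_add]
    refine split_congr fun y z h => ?_
    rw [ih y z h (hM.cons (hF.smooth _)), ← add_assoc, ← blocks_add]
    congr 2
    funext w
    exact hM.derivS_slot (hF.smooth _) [] w s t

theorem smooth_apply (hF : SmoothFam F) (L : List (unitInterval → unitInterval → V))
    (hL : ∀ u ∈ L, Smooth₂ u) : Smooth₂ fun s t => F s t (L.map fun u => u s t) := by
  induction L generalizing F with
  | nil => exact hF.smooth []
  | cons u L ih =>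
    exact ih (hF.cons (hL u (by simp))) fun v hv => hL v (by simp [hv])

/-- The derivative, as an operator with one argument. -/
noncomputable def derivOp (s t : unitInterval) : List (unitInterval → unitInterval → V) → V
  | [u] => derivT u s t
  | _ => 0

/-- The Leibniz rule with all arguments moving. The derivative of an argument is written as
insertion of a one-letter operator so that the result has the form of the de Rham terms in a circle
product. -/
theorem derivT_apply (hF : SmoothFam F) (L : List (unitInterval → unitInterval → V))
    (hL : ∀ u ∈ L, Smooth₂ u) (s t : unitInterval) :
    derivT (fun s t => F s t (L.map fun u => u s t)) s t =
      AInf.dT F s t (L.map fun u => u s t) +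
      split₃ (fun x y z => F s t (x.map (fun u => u s t) ++ derivOp s t y ::
        z.map fun u => u s t)) L := by
  induction L generalizing F with
  | nil =>
    simp only [split₃, split_nil, List.map_nil, List.nil_append, derivOp]
    rw [show F s t [0] = 0 from (hF.multilin s t).map_zero [] [], add_zero]
    rfl
  | cons u L ih =>
    have hu := hL u (by simp)
    refine (ih (hF.cons hu) fun v hv => hL v (by simp [hv])).trans ?_
    have h1 : AInf.dT (fun s t l => F s t (u s t :: l)) s t (L.map fun u => u s t) =
        AInf.dT F s t (u s t :: L.map fun u => u s t) +
          F s t (derivT u s t :: L.map fun u => u s t) := hF.derivT_slot hu [] _ s t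
    have h2 : split (fun y z => F s t (derivOp s t y :: z.map fun u => u s t)) (u :: L) =
        F s t (derivT u s t :: L.map fun u => u s t) := by
      rw [split_cons, show derivOp s t ([] : List (unitInterval → unitInterval → V)) = 0 from rfl,
        show ∀ l, F s t (0 :: l) = 0 from (hF.multilin s t).map_zero [], zero_add]
      cases L with
      | nil => rw [split_nil]; rfl
      | cons v L =>
        rw [split_cons, split_eq_zero, add_zero]
        · rfl
        · intro x y _
          exact (hF.multilin s t).map_zero [] _
    rw [h1, add_assoc, ← h2]
    simp only [split₃]
    rw [split_cons (fun x w => split _ w)]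
    rfl

end SmoothFam

end families

/-! ### The path construction for a nilpotent family of operators -/

section path

variable {U : Type*} [AddCommGroup U] [Module ℝ U]

/-- The identity map, as a sequence of maps. -/
def unitOp : Op U U
  | [u] => u
  | _ => 0

theorem unitOp_append_cons (x : List U) (u : U) (z : List U) (h : x ≠ [] ∨ z ≠ []) :
    unitOp (x ++ u :: z) = 0 := by
  match x, z, h with
  | [], [], h => simp at h
  | [], v :: z, _ => rfl
  | [w], z, _ => rfl
  | w :: w' :: x, z, _ => rfl

theorem multilin_unitOp : Multilin (unitOp (U := U)) := by
  intro x z c a b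
  by_cases h : x ≠ [] ∨ z ≠ []
  · simp [unitOp_append_cons x _ z h]
  · simp only [ne_eq, not_or, not_not] at h
    obtain ⟨rfl, rfl⟩ := h
    rfl

theorem split_eq_of_right {X : Type*} [AddCommGroup X] {φ : List U → List U → X} {l : List U}
    (h : ∀ x v z, φ x (v :: z) = 0) : split φ l = φ l [] := by
  induction l generalizing φ with
  | nil => rw [split_nil]
  | cons v l ih => rw [split_cons, h, zero_add, ih fun x => h (_ :: x)]

theorem ins_of_unary {f : Op U U} (hf : ∀ u v l, f (u :: v :: l) = 0) (σ : U → U) (g : Op U U)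
    (l : List U) : ins σ f g l = f [g l] := by
  have hf' : ∀ x u z v, f ((v :: x) ++ u :: z) = 0 := by
    intro x u z v
    cases x <;> exact hf _ _ _
  cases l with
  | nil => simp only [ins, split₃, split_nil]; rfl
  | cons v l =>
    unfold ins split₃
    rw [split_cons, split_eq_zero (l := l), add_zero, split_eq_of_right]
    · rfl
    · intro x v z
      exact hf _ _ _
    · intro x w _
      exact split_eq_zero fun y z _ => hf' _ _ _ _

theorem ins_unitOp (σ : U → U) (g : Op U U) (l : List U) : ins σ unitOp g l = g l :=
  ins_of_unary (fun _ _ _ => rfl) σ g l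

/-- Compatibility with the operator `E` of degree one: `Φ (x, E u, z) = ε E (Φ (σ x, u, z))`. -/
def ELin (σ E : U →ₗ[ℝ] U) (ε : ℝ) (Φ : Op U U) : Prop :=
  ∀ (x : List U) (u : U) (z : List U), Φ (x ++ E u :: z) = ε • E (Φ (x.map σ ++ u :: z))

/-- Wherever the block of `Ψ` lies, it contributes `ε'` exactly once: if it is left of `E u`, from
`σ` crossing `Ψ`; if it contains `E u`, from `Ψ` itself; if it is right of `E u`, from `τ` crossing
`E`. -/
theorem ELin.ins {σ E τ : U →ₗ[ℝ] U} {ε ε' : ℝ} {Φ Ψ : Op U U} (hΦ : ELin σ E ε Φ)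
    (hΨ : ELin σ E ε' Ψ) (mΦ : Multilin Φ) (hσ : ∀ l, σ (Ψ l) = ε' • Ψ (l.map σ))
    (hτ : ∀ u, τ (E u) = ε' • E (τ u)) (hτσ : ∀ u, σ (τ u) = τ (σ u)) :
    ELin σ E (ε * ε') (ins τ Φ Ψ) := by
  have hsm : ∀ x (c : ℝ) u z, Φ (x ++ (c • u) :: z) = c • Φ (x ++ u :: z) :=
    fun x c u z => map_smul (mΦ.slot x z) c u
  have hm : ∀ p : List U, (p.map τ).map σ = (p.map σ).map τ := fun p => by simp [hτσ]
  intro x u z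
  rw [ins_append_cons, ins_append_cons, map_add, map_add, smul_add, smul_add]
  congr 1
  · congr 1
    · rw [split₃_map, map_split₃, ← split₃_smul]
      refine split₃_congr fun p q r _ => ?_
      have := hΦ (p.map τ ++ Ψ q :: r) u z
      simp only [List.append_assoc, List.cons_append, List.map_append, List.map_cons] at this
      rw [this, hσ, hsm, hm, map_smul, smul_smul]
    · rw [split_map, map_split, ← split_smul]
      refine split_congr fun p q _ => ?_
      rw [map_split, ← split_smul]
      refine split_congr fun q' r _ => ?_
      rw [hΨ, hsm, hΦ, smul_smul, hm, mul_comm]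
  · rw [map_split₃, ← split₃_smul]
    refine split₃_congr fun p q r _ => ?_
    simp only [List.map_append, List.map_cons, List.append_assoc, List.cons_append]
    rw [hτ, hsm, hΦ, smul_smul, hm, mul_comm]

theorem ELin.eq_zero {σ E : U →ₗ[ℝ] U} {ε : ℝ} {Φ : Op U U} (h : ELin σ E ε Φ)
    (hE : ∀ u, E (E u) = 0) (x : List U) (u : U) (z : List U) : E (Φ (x ++ E u :: z)) = 0 := by
  rw [h, map_smul, hE, smul_zero]

/-- A smooth family of operators of degree zero, compatible with `E`, whose unary part has values
in the range of `E`. -/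
structure IsNilFamily (σ E : U →ₗ[ℝ] U) (a : unitInterval → unitInterval → Op U U) : Prop where
  sq : ∀ u, σ (σ u) = u
  E_sq : ∀ u, E (E u) = 0
  smooth : SmoothFam a
  comm : ∀ s t l, σ (a s t l) = a s t (l.map σ)
  elin : ∀ s t, ELin σ E 1 (a s t)
  nil : ∀ s t, a s t [] = 0
  unary : ∀ s t u, ∃ v, a s t [u] = E v

/-- The `i`-th term of the path construction, from `s` to `1`. -/
noncomputable def pathTerm (a : unitInterval → unitInterval → Op U U) :
    ℕ → unitInterval → unitInterval → Op U U
  | 0 => fun _ _ => unitOp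
  | i + 1 => fun s t l => primitive (fun s t => ins id (pathTerm a i s t) (a s t) l) s t

/-- The path construction, from `s` to `1`. -/
noncomputable def pathOp (a : unitInterval → unitInterval → Op U U) (s t : unitInterval) : Op U U :=
  fun l => ∑ i ∈ Finset.range (l.length + 1), pathTerm a i s t l

theorem SmoothFam.primitive {F : unitInterval → unitInterval → Op U U} (hF : SmoothFam F) :
    SmoothFam fun s t l => AInf.primitive (fun s t => F s t l) s t := by
  refine ⟨fun s t x z c a b => ?_, fun l => (hF.smooth l).primitive⟩
  have h := fun s t => hF.multilin s t x z c a b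
  simp only [h]
  rw [Smooth₂.primitive_add ((hF.smooth _).smul c) (hF.smooth _), (hF.smooth _).primitive_smul]

/-- The sum over trees with levels labelled by `ts`, in terms of insertions. -/
def treeSum (a : unitInterval → Op U U) : List unitInterval → Op U U
  | [] => unitOp
  | t :: ts => ins id (treeSum a ts) (a t)

theorem ins_eq_sum (f g : Op U U) (l : List U) : ins id f g l =
    ∑ p ∈ (Finset.range (l.length + 1)).sigma fun j => Finset.range ((l.drop j).length + 1),
      f (l.take p.1 ++ g ((l.drop p.1).take p.2) :: (l.drop p.1).drop p.2) := by
  rw [Finset.sum_sigma]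
  simp [ins, split₃, split]

/-! ### Tree integrals as iterated primitives -/

section general

variable {a : unitInterval → unitInterval → Op U U} (ha : SmoothFam a)
include ha

theorem smoothFam_pathTerm (i : ℕ) : SmoothFam (pathTerm a i) := by
  induction i with
  | zero => exact ⟨fun _ _ => multilin_unitOp, fun l => Smooth₂.const _⟩
  | succ i ih => exact (ih.ins ha LinearMap.id).primitive

theorem smoothFam_ins_pathTerm (i : ℕ) : SmoothFam fun s t => ins id (pathTerm a i s t) (a s t) :=
  (smoothFam_pathTerm ha i).ins ha LinearMap.id

/-- Induction on the number of levels. Finite sums over words are part of the statement because the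
lowest level replaces one word by the sum of all its insertions; the induction then needs no
additivity of the iterated integral. -/
theorem simplexIntegral_treeSum (ℓ : Module.Dual ℝ U) (t : unitInterval) (i : ℕ) :
    ∀ (s : unitInterval) {ι : Type} (A : Finset ι) (L : ι → List U),
    (-1) ^ i * simplexIntegral i s 1 (fun ts => ∑ k ∈ A, ℓ (treeSum (fun s => a s t) ts (L k))) =
      ∑ k ∈ A, ℓ (pathTerm a i s t (L k)) := by
  induction i with
  | zero =>
    intro s ι A L
    simp [simplexIntegral, treeSum, pathTerm]
  | succ i ih =>
    intro s ι A L
    have h : ∀ y : unitInterval, simplexIntegral i y 1 (fun ts => ∑ k ∈ A,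
        ℓ (treeSum (fun s => a s t) (y :: ts) (L k))) =
        (-1) ^ i * ℓ (∑ k ∈ A, ins id (pathTerm a i y t) (a y t) (L k)) := by
      intro y
      simp only [treeSum, ins_eq_sum, map_sum]
      have := ih y (A.sigma fun k => (Finset.range ((L k).length + 1)).sigma fun j =>
        Finset.range (((L k).drop j).length + 1)) fun p =>
          (L p.1).take p.2.1 ++ a y t (((L p.1).drop p.2.1).take p.2.2) ::
            ((L p.1).drop p.2.1).drop p.2.2
      simp only [Finset.sum_sigma] at this ⊢
      rw [← this, ← mul_assoc, ← mul_pow]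
      simp
    have hs := fun l => (smoothFam_ins_pathTerm ha i).smooth l
    simp only [simplexIntegral, h]
    have h1 := (Smooth₂.sum A fun k _ => hs (L k)).apply_primitive ℓ s t
    rw [Smooth₂.primitive_sum A fun k _ => hs (L k), map_sum] at h1
    have hp : (-1 : ℝ) ^ i * (-1) ^ i = 1 := by rw [← mul_pow]; simp
    rw [MeasureTheory.integral_const_mul]
    refine Eq.trans ?_ h1.symm
    rw [pow_succ, mul_neg_one, neg_mul, ← mul_assoc, hp, one_mul]

theorem dS_pathTerm_succ (i : ℕ) (s t : unitInterval) (l : List U) :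
    dS (pathTerm a (i + 1)) s t l = ins id (pathTerm a i s t) (a s t) l :=
  congrFun (congrFun ((smoothFam_ins_pathTerm ha i).smooth l).derivS_primitive s) t

theorem pathTerm_succ_one (i : ℕ) (t : unitInterval) (l : List U) :
    pathTerm a (i + 1) 1 t l = 0 :=
  ((smoothFam_ins_pathTerm ha i).smooth l).primitive_one t

theorem smoothFam_pathOp : SmoothFam (pathOp a) := by
  refine ⟨fun s t x z c u v => ?_, fun l => Smooth₂.sum _ fun i _ =>
    (smoothFam_pathTerm ha i).smooth l⟩
  simp only [pathOp, List.length_append, List.length_cons, Finset.smul_sum,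
    ← Finset.sum_add_distrib]
  exact Finset.sum_congr rfl fun i _ => (smoothFam_pathTerm ha i).multilin s t x z c u v

theorem pathOp_one (t : unitInterval) : pathOp a 1 t = unitOp := by
  funext l
  rw [pathOp, Finset.sum_range_succ', Finset.sum_eq_zero fun i _ => pathTerm_succ_one ha i t l,
    zero_add]
  rfl

end general

/-! ### Vanishing of tall trees and the evolution equation -/

namespace IsNilFamily

variable {σ E : U →ₗ[ℝ] U} {a : unitInterval → unitInterval → Op U U} (ha : IsNilFamily σ E a)
include ha

theorem elin_pathTerm (i : ℕ) (s t : unitInterval) : ELin σ E 1 (pathTerm a i s t) := by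
  induction i generalizing s t with
  | zero =>
    intro x u z
    by_cases h : x ≠ [] ∨ z ≠ []
    · have h' : x.map σ ≠ [] ∨ z ≠ [] := by simpa using h
      simp [pathTerm, unitOp_append_cons x _ z h, unitOp_append_cons _ _ z h']
    · simp only [ne_eq, not_or, not_not] at h
      obtain ⟨rfl, rfl⟩ := h
      exact (one_smul ℝ _).symm
  | succ i ih =>
    intro x u z
    have h : ∀ s t, ins id (pathTerm a i s t) (a s t) (x ++ E u :: z) =
        E (ins id (pathTerm a i s t) (a s t) (x.map σ ++ u :: z)) := by
      intro s t
      have := (ih s t).ins (τ := LinearMap.id) (ha.elin s t)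
        ((smoothFam_pathTerm ha.smooth i).multilin s t) (by simpa using ha.comm s t) (by simp)
        (by simp) x u z
      simpa using this
    rw [one_smul]
    refine Eq.trans ?_ (((smoothFam_ins_pathTerm ha.smooth i).smooth _).primitive_map E s t)
    simp only [pathTerm, h]

theorem elin_pathOp (s t : unitInterval) : ELin σ E 1 (pathOp a s t) := by
  intro x u z
  simp only [pathOp, one_smul, map_sum, List.length_append, List.length_cons, List.length_map]
  exact Finset.sum_congr rfl fun i _ => by rw [ha.elin_pathTerm, one_smul]

/-- A vertex with at least two inputs shortens the word, while a unary vertex produces a factor `E`,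
which the outer `E` kills. On a word of length at most `i`, some one of `i` levels fails to shorten
it. -/
theorem E_pathTerm_eq_zero (i : ℕ) (s t : unitInterval) (l : List U) (hi : l.length ≤ i) :
    E (pathTerm a i s t l) = 0 := by
  induction i generalizing s t l with
  | zero =>
    obtain rfl : l = [] := List.length_eq_zero_iff.1 (by omega)
    exact map_zero E
  | succ i ih =>
    refine (((smoothFam_ins_pathTerm ha.smooth i).smooth l).primitive_map E s t).symm.trans ?_
    have : ∀ s t, E (ins id (pathTerm a i s t) (a s t) l) = 0 := by
      intro s t
      rw [ins, map_split₃]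
      refine split₃_eq_zero fun x y z h => ?_
      match y with
      | [] => rw [ha.nil, ((smoothFam_pathTerm ha.smooth i).multilin s t).map_zero, map_zero]
      | [u] =>
        obtain ⟨v, hv⟩ := ha.unary s t u
        rw [hv, (ha.elin_pathTerm i s t).eq_zero ha.E_sq]
      | u :: v :: y =>
        refine ih s t _ ?_
        rw [← h] at hi
        simp at hi ⊢
        omega
    simp only [this]
    exact (congrArg (fun f => primitive f s t) rfl).trans
      ((Smooth₂.const (0 : U)).primitive_map (0 : U →ₗ[ℝ] U) s t)

/-- A single unary vertex may survive here: its factor `E` moves to the outside, and the remaining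
levels are then too many by `E_pathTerm_eq_zero`. This is the reason for the extra term of `pathMap`
with `d = 1`. -/
theorem pathTerm_eq_zero (i : ℕ) (s t : unitInterval) (l : List U) (hi : l.length + 1 ≤ i) :
    pathTerm a i s t l = 0 := by
  induction i generalizing s t l with
  | zero => omega
  | succ i ih =>
    have : ∀ s t, ins id (pathTerm a i s t) (a s t) l = 0 := by
      intro s t
      refine split₃_eq_zero fun x y z h => ?_
      match y with
      | [] => rw [ha.nil, ((smoothFam_pathTerm ha.smooth i).multilin s t).map_zero]
      | [u] =>
        obtain ⟨v, hv⟩ := ha.unary s t u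
        rw [hv, ha.elin_pathTerm, one_smul]
        refine ha.E_pathTerm_eq_zero i s t _ ?_
        rw [← h] at hi
        simp at hi ⊢
        omega
      | u :: v :: y =>
        refine ih s t _ ?_
        rw [← h] at hi
        simp at hi ⊢
        omega
    simp only [pathTerm, this]
    exact (congrArg (fun f => primitive f s t) rfl).trans
      ((Smooth₂.const (0 : U)).primitive_map (0 : U →ₗ[ℝ] U) s t)

theorem pathOp_eq_sum (s t : unitInterval) (l : List U) (N : ℕ) (hN : l.length + 1 ≤ N) :
    pathOp a s t l = ∑ i ∈ Finset.range N, pathTerm a i s t l := by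
  refine Finset.sum_subset (Finset.range_mono hN) fun i _ hi => ha.pathTerm_eq_zero i s t l ?_
  simpa using hi

theorem dS_pathOp (s t : unitInterval) (l : List U) :
    dS (pathOp a) s t l = ins id (pathOp a s t) (a s t) l := by
  have h1 : ins id (pathOp a s t) (a s t) l =
      ∑ i ∈ Finset.range (l.length + 1), ins id (pathTerm a i s t) (a s t) l := by
    -- Inserting at a nonempty word does not lengthen `l`, so one summation range serves all
    -- insertions; empty insertions vanish.
    have : ins id (pathOp a s t) (a s t) l = split₃ (fun x y z =>
        ∑ i ∈ Finset.range (l.length + 1), pathTerm a i s t (x.map id ++ a s t y :: z)) l := by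
      refine split₃_congr fun x y z h => ?_
      cases y with
      | nil =>
        rw [ha.nil, ((smoothFam_pathOp ha.smooth).multilin s t).map_zero]
        exact (Finset.sum_eq_zero fun i _ =>
          ((smoothFam_pathTerm ha.smooth i).multilin s t).map_zero _ _).symm
      | cons v y =>
        refine ha.pathOp_eq_sum s t _ _ ?_
        rw [← h]
        simp
    rw [this]
    simp only [ins_eq_sum]
    rw [Finset.sum_comm, Finset.sum_sigma]
    simp [split₃, split]
  rw [h1]
  -- One vanishing term is added, so that lowering the index by differentiation gives exactly the
  -- range of `h1`.
  have h2 : ∀ s t, pathOp a s t l =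
      ∑ i ∈ Finset.range (l.length + 2), pathTerm a i s t l := fun s t =>
    ha.pathOp_eq_sum s t l _ (by omega)
  unfold dS
  simp only [h2]
  rw [Smooth₂.derivS_sum _ fun i _ => (smoothFam_pathTerm ha.smooth i).smooth l,
    Finset.sum_range_succ', show derivS (fun s t => pathTerm a 0 s t l) s t = 0 from
      vderiv_const _ _, add_zero]
  exact Finset.sum_congr rfl fun i _ => dS_pathTerm_succ ha.smooth i s t l

end IsNilFamily

/-- Uniqueness of solutions of `∂ₛ X = X ∘ a` with `X = 0` at `s = 1`, if insertions of `a` decrease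
the total weight. -/
theorem eq_zero_of_dS_eq_ins {X a : unitInterval → unitInterval → Op U U}
    (hX : ∀ l, Smooth₂ fun s t => X s t l)
    (hX0 : ∀ s t x z, X s t (x ++ 0 :: z) = 0)
    (hd : ∀ s t l, dS X s t l = ins id (X s t) (a s t) l) (h1 : ∀ t l, X 1 t l = 0)
    (wt : U → ℕ) (hwt : ∀ s t y, 0 ∉ y → a s t y = 0 ∨ wt (a s t y) < (y.map wt).sum) (l : List U) :
    ∀ s t, X s t l = 0 := by
  induction hn : (l.map wt).sum using Nat.strong_induction_on generalizing l with
  | _ n ih =>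
    by_cases h0 : 0 ∈ l
    · intro s t
      obtain ⟨x, z, rfl⟩ := List.append_of_mem h0
      exact hX0 s t x z
    · have hz : derivS (fun s t => X s t l) = 0 := by
        funext s t
        refine (hd s t l).trans (split₃_eq_zero fun x y z h => ?_)
        -- The word after insertion has smaller weight unless the inserted value is `0`. Hence `X`
        -- is constant in `s` on `l`, and it vanishes at `s = 1`.
        rcases hwt s t y (fun hy => h0 (by rw [← h]; simp [hy])) with hy | hy
        · rw [hy, hX0]
        · refine ih _ ?_ _ rfl s t
          rw [← hn, ← h]
          simp
          omega
      intro s t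
      exact congrFun (congrFun ((hX l).eq_zero_of_derivS hz fun t => h1 t l) s) t

/-- The path construction intertwines the structures at the two ends of the path. -/
theorem IsNilFamily.blocks_pathOp {σ E : U →ₗ[ℝ] U} {a M : unitInterval → unitInterval → Op U U}
    (ha : IsNilFamily σ E a) (hM : SmoothFam M)
    (hMC : ∀ s t l, dS M s t l =
      ins id (M s t) (a s t) l + (- ins σ (a s t) (M s t) l + E (dT a s t l)))
    (wt : U → ℕ) (hwt : ∀ s t y, 0 ∉ y → a s t y = 0 ∨ wt (a s t y) < (y.map wt).sum)
    (s t : unitInterval) (l : List U) :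
    blocks (M 1 t) (pathOp a s t) l + E (dT (pathOp a) s t l) =
      ins σ (pathOp a s t) (M s t) l := by
  have hG := smoothFam_pathOp ha.smooth
  have hM1 := hM.restrict 1
  have hX1 := hM1.smooth_blocks hG
  have hX2 := (hG.dT).comp E
  have hX3 := hG.ins hM σ
  -- The defect of the intertwining relation, which satisfies `∂ₛX = X∘a` with zero value at `s =
  -- 1`.
  let X : unitInterval → unitInterval → Op U U := fun s t l =>
    blocks (M 1 t) (pathOp a s t) l +
      (E (dT (pathOp a) s t l) + (-1 : ℝ) • ins σ (pathOp a s t) (M s t) l)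
  have h23 := fun l => (hX2.smooth l).add ((hX3.smooth l).smul (-1))
  have hX := fun l => (hX1 l).add (h23 l)
  have key : X s t l = 0 := by
    refine eq_zero_of_dS_eq_ins (X := X) (a := a) hX ?_ ?_ ?_ wt hwt l s t
    · intro s t x z
      simp only [X]
      rw [blocks_append_zero (hM1.multilin s t) (hG.multilin s t), (hG.dT.multilin s t).map_zero,
        (hX3.multilin s t).map_zero]
      simp
    · intro s t l
      have e1 : derivS (fun s t => blocks (M 1 t) (pathOp a s t) l) s t =
          ins id (blocks (M 1 t) (pathOp a s t)) (a s t) l := by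
        rw [hM1.derivS_blocks hG, ins_blocks (hM1.multilin s t) (hG.multilin s t) (ha.nil s t),
          show dS (pathOp a) s t = ins id (pathOp a s t) (a s t) from
            funext (ha.dS_pathOp s t)]
        have h0 : dS (fun _ t => M 1 t) s t = fun _ => (0 : U) :=
          funext fun l => vderiv_const _ _
        rw [h0]
        have := blocks_linear (fun _ => (0 : U)) (fun _ => 0) (pathOp a s t) 1 l
        simpa using this
      -- Differentiating `∂ₛG = G∘a` in `t` also produces `E (G ∘ ∂ₜa)`. By `ELin`, `E` moves next
      -- to `∂ₜa`, and `σ² = 1` removes the sign left on the preceding letters.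
      have e2 : derivS (fun s t => E (dT (pathOp a) s t l)) s t =
          ins id (fun l => E (dT (pathOp a) s t l)) (a s t) l +
            ins σ (pathOp a s t) (fun l => E (dT a s t l)) l := by
        rw [(hG.dT.smooth l).derivS_map E]
        have c1 : derivS (fun s t => dT (pathOp a) s t l) s t =
            dT (fun s t => ins id (pathOp a s t) (a s t)) s t l := by
          have : dT (fun s t => ins id (pathOp a s t) (a s t)) s t l =
              derivT (derivS fun s t => pathOp a s t l) s t := by
            have h := fun s t => (ha.dS_pathOp s t l).symm
            simp only [dT, h]
            rfl
          rw [this, ← (hG.smooth l).derivS_derivT]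
          rfl
        rw [c1, hG.dT_ins ha.smooth, map_add, comp_ins, comp_ins]
        congr 1
        refine split₃_congr fun x y z _ => ?_
        rw [ha.elin_pathOp, one_smul]
        simp [ha.sq, Function.comp_def]
      -- The pre-Lie identity turns `(G∘a)∘M + G∘(M∘a) - G∘(a∘M)` into `(G∘M)∘a`. The remaining
      -- term, with `E ∂ₜa` inserted, is the one in `e2` and cancels it.
      have e3 : derivS (fun s t => ins σ (pathOp a s t) (M s t) l) s t =
          ins id (ins σ (pathOp a s t) (M s t)) (a s t) l +
            ins σ (pathOp a s t) (fun l => E (dT a s t l)) l := by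
        refine (hG.dS_ins hM σ s t l).trans ?_
        rw [show dS (pathOp a) s t = ins id (pathOp a s t) (a s t) from
          funext (ha.dS_pathOp s t), show dS M s t = _ from funext (hMC s t),
          ins_add_right _ (hG.multilin s t), ins_add_right _ (hG.multilin s t),
          ins_neg_right _ (hG.multilin s t), ← add_assoc, ← add_assoc,
          ins_ins σ (hG.multilin s t) (ha.comm s t)]
        abel
      have hd : dS X s t l = derivS (fun s t => blocks (M 1 t) (pathOp a s t) l) s t +
          (derivS (fun s t => E (dT (pathOp a) s t l)) s t +
            (-1 : ℝ) • derivS (fun s t => ins σ (pathOp a s t) (M s t) l) s t) := by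
        simp only [dS, X]
        rw [Smooth₂.derivS_add (hX1 l) (h23 l), Smooth₂.derivS_add (hX2.smooth l)
          ((hX3.smooth l).smul _), (hX3.smooth l).derivS_smul]
      rw [hd, e1, e2, e3]
      simp only [X]
      rw [ins_add_left, ins_add_left]
      have : ins id (fun l => (-1 : ℝ) • ins σ (pathOp a s t) (M s t) l) (a s t) l =
        (-1 : ℝ) • ins id (ins σ (pathOp a s t) (M s t)) (a s t) l := split₃_smul _ _ _
      rw [this]
      simp only [neg_smul, one_smul]
      abel
    · intro t l
      have h0 : dT (pathOp a) 1 t l = 0 := by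
        simp only [dT, derivT, pathOp_one ha.smooth]
        exact vderiv_const _ _
      simp only [X]
      rw [h0, pathOp_one ha.smooth, ins_unitOp, blocks_of_unit (hM.multilin 1 t)]
      · simp
      · intro v; rfl
      · intro u v l; rfl
  have h := key
  simp only [X, neg_smul, one_smul, ← sub_eq_add_neg, ← add_sub_assoc] at h
  exact sub_eq_zero.1 h

end path

/-! ### Degrees -/

section degrees

variable {V W : Type*} [AddCommGroup V] [Module ℝ V] [AddCommGroup W] [Module ℝ W]

/-- A word of homogeneous elements with total shifted degree `d`. -/
def WordDeg (A : GradedSpace V) : List V → ℤ → Prop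
  | [], d => d = 0
  | v :: l, d => ∃ k, v ∈ A.part k ∧ WordDeg A l (d - (k - 1))

/-- Only the total shifted degree enters `HasDegree`, and it is additive under concatenation, which
makes insertions easy to handle. -/
theorem wordDeg_iff {A : GradedSpace V} {l : List V} {d : ℤ} : WordDeg A l d ↔
    ∃ ks, List.Forall₂ (fun i v => v ∈ A.part i) ks l ∧ d = ks.sum - l.length := by
  induction l generalizing d with
  | nil => simp [WordDeg]
  | cons v l ih =>
    simp only [WordDeg, ih, List.forall₂_cons_right_iff]
    constructor
    · rintro ⟨k, hk, ks, hks, h⟩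
      refine ⟨k :: ks, ⟨k, ks, hk, hks, rfl⟩, ?_⟩
      simp
      omega
    · rintro ⟨_, ⟨k, ks, hk, hks, rfl⟩, h⟩
      refine ⟨k, hk, ks, hks, ?_⟩
      simp at h
      omega

theorem hasDegree_iff {A : GradedSpace V} {B : GradedSpace W} {k : ℤ} {f : Op V W} :
    HasDegree A B k f ↔ ∀ l d, WordDeg A l d → f l ∈ B.part (d + k + 1) := by
  constructor
  · intro h l d hd
    obtain ⟨ks, hks, rfl⟩ := wordDeg_iff.1 hd
    have := h ks l hks
    rwa [show ks.sum - (l.length : ℤ) + k + 1 = ks.sum + k + 1 - l.length by ring]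
  · intro h ks l hks
    have := h l _ (wordDeg_iff.2 ⟨ks, hks, rfl⟩)
    rwa [show ks.sum - (l.length : ℤ) + k + 1 = ks.sum + k + 1 - l.length by ring] at this

theorem wordDeg_append {A : GradedSpace V} {x y : List V} {d : ℤ} :
    WordDeg A (x ++ y) d ↔ ∃ e, WordDeg A x e ∧ WordDeg A y (d - e) := by
  induction x generalizing d with
  | nil => simp [WordDeg]
  | cons v x ih =>
    simp only [List.cons_append, WordDeg, ih]
    constructor
    · rintro ⟨k, hk, e, he, h⟩
      exact ⟨e + (k - 1), ⟨k, hk, by simpa using he⟩, by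
        rwa [show d - (e + (k - 1)) = d - (k - 1) - e by ring]⟩
    · rintro ⟨e, ⟨k, hk, he⟩, h⟩
      exact ⟨k, hk, _, he, by rwa [show d - (k - 1) - (e - (k - 1)) = d - e by ring]⟩

theorem IsHomog.exists_wordDeg {A : GradedSpace V} {l : List V} (h : IsHomog A l) :
    ∃ d, WordDeg A l d := by
  induction l with
  | nil => exact ⟨0, rfl⟩
  | cons v l ih =>
    obtain ⟨d, hd⟩ := ih fun u hu => h u (by simp [hu])
    obtain ⟨k, hk⟩ := h v (by simp)
    exact ⟨d + (k - 1), k, hk, by simpa using hd⟩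

theorem WordDeg.map {A : GradedSpace V} {B : GradedSpace W} {τ : V → W}
    (hτ : ∀ k v, v ∈ A.part k → τ v ∈ B.part k) {l : List V} {d : ℤ} (h : WordDeg A l d) :
    WordDeg B (l.map τ) d := by
  induction l generalizing d with
  | nil => exact h
  | cons v l ih =>
    obtain ⟨k, hk, h⟩ := h
    exact ⟨k, hτ k v hk, ih h⟩

theorem HasDegree.ins {A : GradedSpace V} {B : GradedSpace W} {k k' : ℤ} {f : Op V W}
    {g : Op V V} (hf : HasDegree A B k f) (hg : HasDegree A A k' g) {τ : V → V}
    (hτ : ∀ k v, v ∈ A.part k → τ v ∈ A.part k) : HasDegree A B (k + k') (ins τ f g) := by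
  rw [hasDegree_iff] at *
  intro l d hd
  unfold AInf.ins split₃ split
  refine Submodule.sum_mem (B.part _) fun j _ => Submodule.sum_mem (B.part _) fun r _ => ?_
  rw [← List.take_append_drop j l, wordDeg_append] at hd
  obtain ⟨e, he, hd⟩ := hd
  rw [← List.take_append_drop r (l.drop j), wordDeg_append] at hd
  obtain ⟨e', he', hd⟩ := hd
  have := hf (((l.take j).map τ) ++ g ((l.drop j).take r) :: (l.drop j).drop r) (d + k') ?_
  · rwa [show d + (k + k') + 1 = d + k' + k + 1 by ring]
  · refine wordDeg_append.2 ⟨e, he.map hτ, _, hg _ _ he', ?_⟩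
    rwa [show d + k' - e - (e' + k' + 1 - 1) = d - e - e' by ring]

/-- The homogeneous parts span, and are the ranges of projections. -/
structure GradedSpace.IsDecomposed (A : GradedSpace V) : Prop where
  span : ⨆ k, A.part k = ⊤
  proj : ∀ k, ∃ π : V →ₗ[ℝ] V, (∀ v, π v ∈ A.part k) ∧ ∀ v ∈ A.part k, π v = v

theorem isDecomposed_gradedSpace (𝒱 : ℤ → Submodule ℝ V) [DirectSum.Decomposition 𝒱] :
    (gradedSpace 𝒱).IsDecomposed where
  span := (DirectSum.Decomposition.isInternal 𝒱).submodule_iSup_eq_top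
  proj := fun k => ⟨(𝒱 k).subtype ∘ₗ DirectSum.component ℝ ℤ (fun k => 𝒱 k) k ∘ₗ
      (DirectSum.decomposeLinearEquiv 𝒱).toLinearMap, fun v => by simp [gradedSpace],
    fun v hv => by
      simp only [LinearMap.comp_apply, LinearEquiv.coe_coe, DirectSum.decomposeLinearEquiv_apply,
        Submodule.subtype_apply]
      exact DirectSum.decompose_of_mem_same 𝒱 hv⟩

/-- Homogeneous vectors span, so the letters are decomposed one after the other; the prefix `x`
collects those already made homogeneous. -/
theorem Multilin.ext_homog {A : GradedSpace V} (hA : A.IsDecomposed) {f g : Op V W}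
    (hf : Multilin f) (hg : Multilin g) (h : ∀ l, IsHomog A l → f l = g l) : f = g := by
  have key : ∀ z x, IsHomog A x → f (x ++ z) = g (x ++ z) := by
    intro z
    induction z with
    | nil => intro x hx; rw [List.append_nil]; exact h x hx
    | cons v z ih =>
      intro x hx
      have hv : v ∈ ⨆ k, A.part k := by rw [hA.span]; trivial
      rw [← hf.slot_apply, ← hg.slot_apply]
      induction hv using Submodule.iSup_induction' with
      | mem k v hv =>
        have := ih (x ++ [v]) ?_
        · simpa [Multilin.slot_apply] using this
        · intro u hu
          rcases List.mem_append.1 hu with hu | hu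
          · exact hx u hu
          · exact ⟨k, by simpa [List.mem_singleton.1 hu] using hv⟩
      | zero => simp
      | add a b _ _ ha hb => rw [_root_.map_add, _root_.map_add, ha, hb]
  funext l
  exact key l [] (by simp [IsHomog])

theorem Multilin.map_sg {A : GradedSpace V} {f : Op V W} (hf : Multilin f) {l : List V} {d : ℤ}
    (hl : WordDeg A l d) : f (l.map A.sg) = (d.negOnePow : ℤ) • f l := by
  induction l generalizing f d with
  | nil => rw [show d = 0 from hl]; simp
  | cons v l ih =>
    obtain ⟨k, hk, hl⟩ := hl
    rw [List.map_cons]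
    refine (ih (hf.cons (A.sg v)) hl).trans ?_
    have : f (A.sg v :: l) = ((k - 1).negOnePow : ℤ) • f (v :: l) := by
      rw [A.sg_apply k v hk]
      exact map_zsmul (hf.slot [] l) _ v
    rw [this, smul_smul, ← Units.val_mul, ← Int.negOnePow_add, sub_add_cancel]

theorem GradedSpace.IsDecomposed.sg_sg {A : GradedSpace V} (hA : A.IsDecomposed) (v : V) :
    A.sg (A.sg v) = v := by
  have hv : v ∈ ⨆ k, A.part k := by rw [hA.span]; trivial
  induction hv using Submodule.iSup_induction' with
  | mem k v hv =>
    rw [A.sg_apply k v hv, map_zsmul, A.sg_apply k v hv, smul_smul, ← Units.val_mul,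
      ← Int.negOnePow_add, Int.negOnePow_even _ ⟨k - 1, rfl⟩]
    simp
  | zero => simp
  | add a b _ _ ha hb => rw [map_add, map_add, ha, hb]

theorem GradedSpace.sg_mem (A : GradedSpace V) {k : ℤ} {v : V} (hv : v ∈ A.part k) :
    A.sg v ∈ A.part k := by
  rw [A.sg_apply k v hv]
  exact zsmul_mem hv _

/-- On a word of shifted degree `d` the value has shifted degree `d + k`, while the signs of the
letters multiply to `(-1)^d`. Multilinearity extends this to all words. -/
theorem HasDegree.sg_apply {A : GradedSpace V} (hA : A.IsDecomposed) {f : Op V V}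
    (hf : Multilin f) {k : ℤ} (hk : HasDegree A A k f) (l : List V) :
    A.sg (f l) = (k.negOnePow : ℤ) • f (l.map A.sg) := by
  have h1 : Multilin fun l => A.sg (f l) := hf.comp A.sg
  have h2 : Multilin fun l => (k.negOnePow : ℤ) • f (l.map A.sg) := by
    intro x z c a b
    simp only [List.map_append, List.map_cons, _root_.map_add, map_smul]
    rw [hf, smul_add, smul_comm]
  refine congrFun (Multilin.ext_homog hA h1 h2 fun l hl => ?_) l
  obtain ⟨d, hd⟩ := hl.exists_wordDeg
  rw [hf.map_sg hd, A.sg_apply _ _ (hasDegree_iff.1 hk l d hd), smul_smul, ← Units.val_mul,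
    ← Int.negOnePow_add]
  congr 3
  ring

/-- A presentation of `f` may use vectors outside `S`. The projection onto `S` fixes `f` and
commutes with taking primitives. -/
theorem Smooth₂.primitive_mem {f : unitInterval → unitInterval → V} (hf : Smooth₂ f)
    {S : Submodule ℝ V} (hS : ∃ π : V →ₗ[ℝ] V, (∀ v, π v ∈ S) ∧ ∀ v ∈ S, π v = v)
    (h : ∀ s t, f s t ∈ S) (s t : unitInterval) : AInf.primitive f s t ∈ S := by
  obtain ⟨π, hπ, hπ'⟩ := hS
  have := hf.primitive_map π s t
  simp only [hπ' _ (h _ _)] at this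
  rw [this]
  exact hπ _

theorem Smooth₂.isSmooth {f : unitInterval → unitInterval → V} (hf : Smooth₂ f)
    {S : Submodule ℝ V} (hS : ∃ π : V →ₗ[ℝ] V, (∀ v, π v ∈ S) ∧ ∀ v ∈ S, π v = v)
    (s : unitInterval) (h : ∀ t, f s t ∈ S) :
    IsSmooth (fun x : unitInterval => (x : ℝ)) S (f s) := by
  obtain ⟨π, hπ, hπ'⟩ := hS
  obtain ⟨N, g, w, hg, hf⟩ := hf
  refine ⟨N, fun i x => g i (s, x), fun i => π (w i), fun i => (hg i).comp (by fun_prop),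
    fun i => hπ _, fun t => ?_⟩
  rw [← hπ' _ (h t), hf]
  simp

theorem HasDegree.pathTerm {A : GradedSpace V} (hA : A.IsDecomposed)
    {a : unitInterval → unitInterval → Op V V} (ha : SmoothFam a)
    (hd : ∀ s t, HasDegree A A 0 (a s t)) (i : ℕ) (s t : unitInterval) :
    HasDegree A A 0 (pathTerm a i s t) := by
  induction i generalizing s t with
  | zero =>
    rw [hasDegree_iff]
    intro l d hl
    match l, hl with
    | [], _ => exact Submodule.zero_mem _
    | [u], ⟨k, hk, h⟩ =>
      have h : d - (k - 1) = 0 := h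
      rw [show d + 0 + 1 = k by omega]
      exact hk
    | u :: v :: l, _ => exact Submodule.zero_mem _
  | succ i ih =>
    rw [hasDegree_iff]
    intro l d hl
    refine ((smoothFam_ins_pathTerm ha i).smooth l).primitive_mem (hA.proj _) (fun s t => ?_) s t
    exact hasDegree_iff.1 ((ih s t).ins (hd s t) (τ := id) fun _ _ h => h) l d hl

theorem HasDegree.pathOp {A : GradedSpace V} (hA : A.IsDecomposed)
    {a : unitInterval → unitInterval → Op V V} (ha : SmoothFam a)
    (hd : ∀ s t, HasDegree A A 0 (a s t)) (s t : unitInterval) :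
    HasDegree A A 0 (pathOp a s t) := fun ks l h =>
  Submodule.sum_mem _ fun i _ => HasDegree.pathTerm hA ha hd i s t ks l h

theorem multilin_of_multilinearMap {f : Op V W} (h : ∀ n, ∃ M : MultilinearMap ℝ
    (fun _ : Fin n => V) W, ∀ v : Fin n → V, f (List.ofFn v) = M v) : Multilin f := by
  intro x z c a b
  obtain ⟨M, hM⟩ := h (x ++ 0 :: z).length
  let i : Fin (x ++ 0 :: z).length := ⟨x.length, by simp⟩
  have key : ∀ v, f (x ++ v :: z) = M (Function.update (x ++ 0 :: z).get i v) := by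
    intro v
    rw [← hM]
    congr 1
    refine List.ext_getElem (by simp; omega) fun n h1 h2 => ?_
    rw [List.getElem_ofFn, Function.update_apply]
    by_cases hn : n = x.length
    · subst hn
      simp [i]
    · rw [if_neg (by simpa [i, Fin.ext_iff] using hn)]
      rcases lt_or_gt_of_ne hn with hn | hn
      · simp [List.getElem_append_left, hn]
      · simp [List.getElem_append_right, hn.le, List.getElem_cons, Nat.sub_ne_zero_of_lt hn]
  simp [key]

theorem IsSmoothFamily.smoothFam {A : GradedSpace V} {k : ℤ}
    {f : unitInterval → unitInterval → Op V V} (hf : IsSmoothFamily A k f) : SmoothFam f where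
  multilin s t := multilin_of_multilinearMap (hf.multilinear s t)
  smooth l := by
    obtain ⟨N, g, w, hg, -, h⟩ := hf.smooth l
    exact ⟨N, g, w, hg, fun s t => h (s, t)⟩

end degrees

/-! ### The values at a point of forms on the interval

A pair `(u, v) : V × V` stands for `u + dt ⊗ v`. -/

section pairs

variable {V W : Type*} [AddCommGroup V] [Module ℝ V] [AddCommGroup W] [Module ℝ W]

/-- The sum of `P (p x, q u, r z)` over all `x ++ u :: z = L`. -/
def markedSum {α : Type*} (p q r : α → V) (P : Op V W) : List α → W
  | [] => 0
  | u :: L => P (q u :: L.map r) + markedSum p q r (fun l => P (p u :: l)) L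

theorem sum_fin_eq_markedSum {α : Type*} (p q r : α → V) (P : Op V W) (L : List α) :
    ∑ i : Fin L.length, P ((L.take i).map p ++ q (L.get i) :: (L.drop (i + 1)).map r) =
      markedSum p q r P L := by
  induction L generalizing P with
  | nil => rfl
  | cons u L ih =>
    rw [markedSum, ← ih]
    exact (Fin.sum_univ_succ _).trans (by simp)

theorem markedSum_map {α β : Type*} (f : β → α) (p q r : α → V) (P : Op V W) (L : List β) :
    markedSum p q r P (L.map f) = markedSum (p ∘ f) (q ∘ f) (r ∘ f) P L := by
  induction L generalizing P with
  | nil => rfl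
  | cons u L ih => simp [markedSum, ih]

theorem markedSum_linear {α : Type*} (p q r : α → V) (c : ℝ) (P P' : Op V W) (L : List α) :
    markedSum p q r (fun l => c • P l + P' l) L =
      c • markedSum p q r P L + markedSum p q r P' L := by
  induction L generalizing P P' with
  | nil => simp [markedSum]
  | cons u L ih =>
    simp only [markedSum, ih, smul_add]
    abel

theorem markedSum_zero {α : Type*} (p q r : α → V) (L : List α) :
    markedSum p q r (fun _ => (0 : W)) L = 0 := by
  simpa using markedSum_linear p q r 1 (fun _ => (0 : W)) (fun _ => 0) L

theorem markedSum_eq_zero {α : Type*} (p q r : α → V) {P : Op V W} (hP : Multilin P)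
    {L : List α} (h : ∀ u ∈ L, q u = 0) : markedSum p q r P L = 0 := by
  induction L generalizing P with
  | nil => rfl
  | cons u L ih =>
    rw [markedSum, h u (by simp), show P (0 :: L.map r) = 0 from hP.map_zero [] _, zero_add]
    exact ih (hP.cons _) fun v hv => h v (by simp [hv])

/-- The terms of the extension of `P` to forms in which `dt` comes from an argument. -/
def dtTerms (σ : V →ₗ[ℝ] V) (P : Op V W) : Op (V × V) W :=
  markedSum (fun η => σ η.1) Prod.snd Prod.fst P

variable {σ : V →ₗ[ℝ] V}

theorem Multilin.dtTerms {P : Op V W} (hP : Multilin P) : Multilin (dtTerms σ P) := by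
  intro x z c a b
  induction x generalizing P with
  | nil =>
    simp only [List.nil_append, AInf.dtTerms, markedSum, Prod.snd_add, Prod.smul_snd, Prod.fst_add,
      Prod.smul_fst, _root_.map_add, map_smul]
    rw [show P ((c • a.2 + b.2) :: z.map Prod.fst) = _ from hP [] _ c _ _,
      show (fun l => P ((c • σ a.1 + σ b.1) :: l)) = fun l => c • P (σ a.1 :: l) + P (σ b.1 :: l)
        from funext fun l => hP [] l c _ _, markedSum_linear, smul_add]
    simp only [List.nil_append]
    abel
  | cons u x ih =>
    have h1 := ih (hP.cons (σ u.1))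
    have h2 := hP (u.2 :: x.map Prod.fst) (z.map Prod.fst) c a.1 b.1
    simp only [AInf.dtTerms, List.cons_append, markedSum, List.map_append, List.map_cons,
      Prod.fst_add, Prod.smul_fst] at h1 h2 ⊢
    rw [h1, h2, smul_add]
    abel

/-- The letter `dt ⊗ u` has no `dt`-free part, so every term marking another letter contains a zero
argument. -/
theorem dtTerms_append_dt {P : Op V W} (hP : Multilin P) (x z : List (V × V)) (u : V) :
    dtTerms σ P (x ++ (0, u) :: z) =
      P (x.map (fun η => σ η.1) ++ u :: z.map Prod.fst) := by
  induction x generalizing P with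
  | nil =>
    simp only [List.nil_append, dtTerms, markedSum, map_zero]
    rw [show (fun l => P (0 :: l)) = fun _ => 0 from funext fun l => hP.map_zero [] l,
      markedSum_zero, add_zero]
    rfl
  | cons v x ih =>
    have h1 := ih (hP.cons (σ v.1))
    have h2 := hP.map_zero (v.2 :: x.map Prod.fst) (z.map Prod.fst)
    simp only [dtTerms, List.cons_append, markedSum, List.map_append, List.map_cons] at h1 h2 ⊢
    rw [h1, h2, zero_add]

theorem dtTerms_inl {P : Op V W} (hP : Multilin P) (l : List V) :
    dtTerms σ P (l.map fun v => (v, 0)) = 0 := by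
  refine markedSum_eq_zero _ _ _ hP fun u hu => ?_
  obtain ⟨v, -, rfl⟩ := List.mem_map.1 hu
  rfl

theorem SmoothFam.smooth_dtTerms {P : unitInterval → unitInterval → Op V W} (hP : SmoothFam P)
    (L : List (V × V)) : Smooth₂ fun s t => dtTerms σ (P s t) L := by
  induction L generalizing P with
  | nil => exact Smooth₂.const 0
  | cons u L ih => exact (hP.smooth _).add (ih (hP.cons (Smooth₂.const (σ u.1))))

/-- The form-linear extension of `P + dt ⊗ Q`, of total degree `k`, to values of forms. -/
def extendPt (A : GradedSpace V) (k : ℤ) (P Q : Op V V) : Op (V × V) (V × V) := fun L =>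
  (P (L.map Prod.fst), Q (L.map Prod.fst) + (k.negOnePow : ℤ) • dtTerms A.sg P L)

/-- Multiplication by `dt` from the left. -/
def dtMul : V × V →ₗ[ℝ] V × V := LinearMap.inr ℝ V V ∘ₗ LinearMap.fst ℝ V V

@[simp] theorem dtMul_apply (u : V × V) : dtMul u = (0, u.1) := rfl

/-- The sign of the shifted degree. -/
def sgPair (σ : V →ₗ[ℝ] V) : V × V →ₗ[ℝ] V × V := LinearMap.prodMap σ (-σ)

@[simp] theorem sgPair_apply (u : V × V) : sgPair σ u = (σ u.1, - σ u.2) := rfl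

/-- The graded space of values of forms. -/
def pairs (A : GradedSpace V) : GradedSpace (V × V) where
  part k := (A.part k).prod (A.part (k - 1))
  sg := sgPair A.sg
  sg_apply := by
    rintro k ⟨u, v⟩ ⟨hu, hv⟩
    have h2 := A.sg_apply (k - 1) v hv
    rw [Int.negOnePow_sub _ 1] at h2
    simp [A.sg_apply k u hu, h2]
  test := Set.univ
  test_separates := separates_univ

theorem IsDecomposed.pairs {A : GradedSpace V} (hA : A.IsDecomposed) :
    (pairs A).IsDecomposed where
  span := by
    rw [eq_top_iff]
    rintro ⟨u, v⟩ -
    have key : ∀ w : V, (w, (0 : V)) ∈ ⨆ k, (AInf.pairs A).part k ∧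
        ((0 : V), w) ∈ ⨆ k, (AInf.pairs A).part k := by
      intro w
      have hw : w ∈ ⨆ k, A.part k := by rw [hA.span]; trivial
      induction hw using Submodule.iSup_induction' with
      | mem k w hw =>
        refine ⟨Submodule.mem_iSup_of_mem k ⟨hw, Submodule.zero_mem _⟩,
          Submodule.mem_iSup_of_mem (k + 1) ⟨Submodule.zero_mem _, ?_⟩⟩
        simpa using hw
      | zero => exact ⟨Submodule.zero_mem _, Submodule.zero_mem _⟩
      | add a b _ _ ha hb =>
        refine ⟨?_, ?_⟩
        · simpa using Submodule.add_mem _ ha.1 hb.1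
        · simpa using Submodule.add_mem _ ha.2 hb.2
    simpa using Submodule.add_mem _ (key u).1 (key v).2
  proj k := by
    obtain ⟨π, h1, h2⟩ := hA.proj k
    obtain ⟨ρ, h3, h4⟩ := hA.proj (k - 1)
    refine ⟨LinearMap.prodMap π ρ, fun v => ⟨h1 _, h3 _⟩, fun v hv => ?_⟩
    exact Prod.ext (h2 _ hv.1) (h4 _ hv.2)

section extendPt

variable {A : GradedSpace V} {k : ℤ} {P Q : Op V V}

theorem Multilin.map_fst {P : Op V W} (hP : Multilin P) :
    Multilin fun L : List (V × V) => P (L.map Prod.fst) := by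
  intro x z c a b
  simpa using hP (x.map Prod.fst) (z.map Prod.fst) c a.1 b.1

theorem multilin_extendPt (hP : Multilin P) (hQ : Multilin Q) : Multilin (extendPt A k P Q) := by
  intro x z c a b
  have h1 := hP.map_fst x z c a b
  have h2 := hQ.map_fst x z c a b
  have h3 := hP.dtTerms (σ := A.sg) x z c a b
  simp only at h1 h2
  refine Prod.ext ?_ ?_
  · exact h1
  · simp only [extendPt, h2, h3, Prod.snd_add, Prod.smul_snd, smul_add]
    rw [smul_comm c]
    abel

theorem elin_extendPt (hP : Multilin P) (hQ : Multilin Q) :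
    ELin (sgPair A.sg) dtMul ((k.negOnePow : ℤ) : ℝ) (extendPt A k P Q) := by
  intro x u z
  have h1 := hP.map_zero (x.map Prod.fst) (z.map Prod.fst)
  have h2 := hQ.map_zero (x.map Prod.fst) (z.map Prod.fst)
  refine Prod.ext ?_ ?_
  · simp [extendPt, h1]
  · simp only [extendPt, dtMul_apply, List.map_append, List.map_cons, h2, zero_add,
      dtTerms_append_dt hP, Prod.smul_snd, Int.cast_smul_eq_zsmul]
    simp [Function.comp_def]

theorem extendPt_inl (hP : Multilin P) (l : List V) :
    extendPt A k P Q (l.map fun v => (v, 0)) = (P l, Q l) := by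
  simp [extendPt, dtTerms_inl hP, Function.comp_def]

theorem smoothFam_extendPt {P Q : unitInterval → unitInterval → Op V V} (hP : SmoothFam P)
    (hQ : SmoothFam Q) : SmoothFam fun s t => extendPt A k (P s t) (Q s t) where
  multilin s t := multilin_extendPt (hP.multilin s t) (hQ.multilin s t)
  smooth L := by
    refine (hP.smooth _).prodMk ((hQ.smooth _).add ?_)
    simp only [← Int.cast_smul_eq_zsmul ℝ]
    exact (hP.smooth_dtTerms L).smul _

theorem dtTerms_mem {A : GradedSpace V} {k : ℤ} {P : Op V V} (hP : HasDegree A A k P)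
    {L : List (V × V)} {d : ℤ} (h : WordDeg (pairs A) L d) :
    dtTerms A.sg P L ∈ A.part (d + k) := by
  induction L generalizing P k d with
  | nil => exact Submodule.zero_mem _
  | cons u L ih =>
    obtain ⟨i, hi, h⟩ := h
    refine Submodule.add_mem _ ?_ ?_
    · have := hasDegree_iff.1 hP (u.2 :: L.map Prod.fst) (d - 1)
        ⟨i - 1, hi.2, by
          have := WordDeg.map (A := pairs A) (B := A) (τ := Prod.fst) (fun k v hv => hv.1) h
          rwa [show d - 1 - (i - 1 - 1) = d - (i - 1) by ring]⟩
      rwa [show d - 1 + k + 1 = d + k by ring] at this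
    -- Fixing a first argument of degree `i` raises the degree of the operator by `i - 1`, which is
    -- why `k` varies in the induction.
    · have hP' : HasDegree A A (k + (i - 1)) fun l => P (A.sg u.1 :: l) := by
        rw [hasDegree_iff] at hP ⊢
        intro l e he
        have := hP (A.sg u.1 :: l) (e + (i - 1)) ⟨i, A.sg_mem hi.1, by simpa using he⟩
        rwa [show e + (i - 1) + k + 1 = e + (k + (i - 1)) + 1 by ring] at this
      have := ih hP' h
      rwa [show d - (i - 1) + (k + (i - 1)) = d + k by ring] at this

theorem hasDegree_extendPt (hP : HasDegree A A k P) (hQ : HasDegree A A (k - 1) Q) :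
    HasDegree (pairs A) (pairs A) k (extendPt A k P Q) := by
  rw [hasDegree_iff]
  intro L d h
  have h' := WordDeg.map (A := pairs A) (B := A) (τ := Prod.fst) (fun k v hv => hv.1) h
  refine ⟨hasDegree_iff.1 hP _ d h', Submodule.add_mem _ ?_ (zsmul_mem ?_ _)⟩
  · have := hasDegree_iff.1 hQ _ d h'
    rwa [show d + (k - 1) + 1 = d + k + 1 - 1 by ring] at this
  · have := dtTerms_mem hP h
    rwa [show d + k = d + k + 1 - 1 by ring] at this

end extendPt

/-- Two multilinear operators compatible with `dt` agree if they agree on words without `dt`. -/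
theorem ELin.ext {τ : V × V →ₗ[ℝ] V × V} (hτ : ∀ v, τ (v, 0) = (σ v, 0)) {ε : ℝ}
    {Φ Ψ : Op (V × V) (V × V)} (mΦ : Multilin Φ) (mΨ : Multilin Ψ)
    (hΦ : ELin τ dtMul ε Φ) (hΨ : ELin τ dtMul ε Ψ)
    (h : ∀ l : List V, Φ (l.map fun v => (v, 0)) = Ψ (l.map fun v => (v, 0))) : Φ = Ψ := by
  have key : ∀ (L : List (V × V)) (x : List V),
      Φ (x.map (fun v => (v, 0)) ++ L) = Ψ (x.map (fun v => (v, 0)) ++ L) := by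
    intro L
    induction L with
    | nil => intro x; simpa using h x
    | cons u L ih =>
      intro x
      have hu : u = (u.1, 0) + dtMul (u.2, 0) := by simp
      rw [hu, mΦ.map_add, mΨ.map_add, hΦ, hΨ]
      have h1 := ih (x ++ [u.1])
      have h2 := ih (x.map σ ++ [u.2])
      simp only [List.map_append, List.map_cons, List.map_nil, List.append_assoc,
        List.cons_append, List.nil_append, List.map_map] at h1 h2 ⊢
      rw [h1, show (⇑τ ∘ fun v : V => (v, (0 : V))) = (fun v => (v, 0)) ∘ ⇑σ from
        funext fun v => hτ v, h2]
  exact funext fun L => key L []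

/-- The extension of a composition, on words without `dt`. -/
theorem ins_extendPt_inl {A : GradedSpace V} {k k' : ℤ} {P Q P' Q' : Op V V} (hP : Multilin P)
    (hQ : Multilin Q) (hP' : Multilin P') {τ : V × V → V × V} {τ' : V → V}
    (hτ : ∀ v, τ (v, 0) = (τ' v, 0)) (l : List V) :
    ins τ (extendPt A k P Q) (extendPt A k' P' Q') (l.map fun v => (v, 0)) =
      (ins τ' P P' l,
        ins τ' Q P' l + (k.negOnePow : ℤ) • ins (fun v => A.sg (τ' v)) P Q' l) := by
  have hm := multilin_extendPt (A := A) (k := k) hP hQ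
  have h : ∀ x y z : List V, extendPt A k P Q ((x.map fun v => (v, (0 : V))).map τ ++
      extendPt A k' P' Q' (y.map fun v => (v, 0)) :: z.map fun v => (v, 0)) =
      (P (x.map τ' ++ P' y :: z), Q (x.map τ' ++ P' y :: z) + (k.negOnePow : ℤ) •
        P (x.map (fun v => A.sg (τ' v)) ++ Q' y :: z)) := by
    intro x y z
    -- The inserted value is split into its `dt`-free part and `dt ⊗ Q' y`. Moving this `dt` out
    -- past the letters before it adds the second sign to them.
    have h1 : extendPt A k' P' Q' (y.map fun v => (v, 0)) =
        (P' y, 0) + dtMul (Q' y, 0) := by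
      rw [extendPt_inl hP']; simp
    have h2 : (x.map fun v => (v, (0 : V))).map τ = (x.map τ').map fun v => (v, 0) := by
      simp [hτ]
    have h3 : ((x.map τ').map fun v => (v, (0 : V))).map (sgPair A.sg) =
        (x.map fun v => A.sg (τ' v)).map fun v => (v, 0) := by
      simp
    have h4 := extendPt_inl (A := A) (k := k) (Q := Q) hP (x.map τ' ++ P' y :: z)
    have h5 := extendPt_inl (A := A) (k := k) (Q := Q) hP
      (x.map (fun v => A.sg (τ' v)) ++ Q' y :: z)
    rw [List.map_append, List.map_cons] at h4 h5
    rw [h1, h2, hm.map_add, elin_extendPt hP hQ, h3, h4, h5, Int.cast_smul_eq_zsmul]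
    simp
  have h6 := map_split₃ (LinearMap.fst ℝ V V) (fun x y z => (P (x.map τ' ++ P' y :: z),
    Q (x.map τ' ++ P' y :: z) + (k.negOnePow : ℤ) •
        P (x.map (fun v => A.sg (τ' v)) ++ Q' y :: z))) l
  have h7 := map_split₃ (LinearMap.snd ℝ V V) (fun x y z => (P (x.map τ' ++ P' y :: z),
    Q (x.map τ' ++ P' y :: z) + (k.negOnePow : ℤ) •
        P (x.map (fun v => A.sg (τ' v)) ++ Q' y :: z))) l
  rw [ins, split₃_map]
  simp only [h]
  refine Prod.ext h6 (h7.trans ?_)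
  simp only [LinearMap.snd_apply, split₃_add, ← Int.cast_smul_eq_zsmul ℝ, split₃_smul]
  rfl

end pairs

/-! ### The Maurer–Cartan equation at a point -/

section mc

variable {V W : Type*} [AddCommGroup V] [Module ℝ V] [AddCommGroup W] [Module ℝ W]

theorem Smooth₂.derivS_prodMk {f : unitInterval → unitInterval → V}
    {g : unitInterval → unitInterval → W} (hf : Smooth₂ f) (hg : Smooth₂ g) (s t : unitInterval) :
    AInf.derivS (fun s t => (f s t, g s t)) s t = (AInf.derivS f s t, AInf.derivS g s t) :=
  Prod.ext ((hf.prodMk hg).derivS_map (LinearMap.fst ℝ V W) s t).symm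
    ((hf.prodMk hg).derivS_map (LinearMap.snd ℝ V W) s t).symm

theorem Smooth₂.derivT_prodMk {f : unitInterval → unitInterval → V}
    {g : unitInterval → unitInterval → W} (hf : Smooth₂ f) (hg : Smooth₂ g) (s t : unitInterval) :
    AInf.derivT (fun s t => (f s t, g s t)) s t = (AInf.derivT f s t, AInf.derivT g s t) :=
  Prod.ext ((hf.prodMk hg).derivT_map (LinearMap.fst ℝ V W) s t).symm
    ((hf.prodMk hg).derivT_map (LinearMap.snd ℝ V W) s t).symm

theorem ELin.add {σ E : V →ₗ[ℝ] V} {ε : ℝ} {Φ Ψ : Op V V} (hΦ : ELin σ E ε Φ)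
    (hΨ : ELin σ E ε Ψ) : ELin σ E ε fun l => Φ l + Ψ l := by
  intro x u z
  simp only [hΦ x u z, hΨ x u z, map_add, smul_add]

theorem ELin.neg {σ E : V →ₗ[ℝ] V} {ε : ℝ} {Φ : Op V V} (hΦ : ELin σ E ε Φ) :
    ELin σ E ε fun l => - Φ l := by
  intro x u z
  simp only [hΦ x u z, map_neg, smul_neg]

theorem Multilin.neg {f : Op V W} (hf : Multilin f) : Multilin fun l => - f l :=
  hf.comp (-LinearMap.id)

theorem ELin.dS {σ E : V →ₗ[ℝ] V} {ε : ℝ} {Φ : unitInterval → unitInterval → Op V V}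
    (hs : SmoothFam Φ) (h : ∀ s t, ELin σ E ε (Φ s t)) (s t : unitInterval) :
    ELin σ E ε (dS Φ s t) := by
  intro x u z
  have h1 := fun s t => h s t x u z
  have h2 := (hs.smooth (x.map σ ++ u :: z)).derivS_map (ε • E) s t
  simp only [AInf.dS, h1]
  exact h2

theorem ELin.dT {σ E : V →ₗ[ℝ] V} {ε : ℝ} {Φ : unitInterval → unitInterval → Op V V}
    (hs : SmoothFam Φ) (h : ∀ s t, ELin σ E ε (Φ s t)) (s t : unitInterval) :
    ELin σ E ε (dT Φ s t) := by
  intro x u z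
  have h1 := fun s t => h s t x u z
  have h2 := (hs.smooth (x.map σ ++ u :: z)).derivT_map (ε • E) s t
  simp only [AInf.dT, h1]
  exact h2

/-- Both sides vanish since `E² = 0`, so any sign `ε'` is allowed. -/
theorem ELin.comp_left {σ E : V →ₗ[ℝ] V} {ε ε' : ℝ} {Φ : Op V V} (h : ELin σ E ε Φ)
    (hE : ∀ u, E (E u) = 0) : ELin σ E ε' fun l => E (Φ l) := by
  intro x u z
  simp only [h x u z, map_smul, hE, smul_zero]

namespace SqForm

variable {A : GradedSpace V} {α : SqForm V}

/-- In degree one the bracket of `α⁰` with itself is twice its circle square. In the next two lemmas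
the factor `½` is likewise absorbed by equal pairs of brackets. -/
theorem IsMC.ins_c0_c0 (hα : α.IsMC A) (s t : unitInterval) (l : List V) :
    ins A.sg (α.c0 s t) (α.c0 s t) l = 0 := by
  have h := hα.eq0 s t l
  simp only [SqForm.d, SqForm.bracket, gerst, circ_one] at h
  rw [zero_add, mul_one, Int.negOnePow_one, Units.val_neg, Units.val_one, neg_one_smul,
    sub_neg_eq_add, ← two_smul ℝ, smul_smul] at h
  simpa using h

theorem IsMC.dS_c0 (hα : α.IsMC A) (s t : unitInterval) (l : List V) :
    dS α.c0 s t l = ins id (α.c0 s t) (α.cs s t) l - ins A.sg (α.cs s t) (α.c0 s t) l := by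
  have h := hα.eqs s t l
  simp only [SqForm.d, SqForm.bracket, gerst, circ_one, sub_self, circ_zero, mul_one,
    mul_zero, Int.negOnePow_zero, Int.negOnePow_one, Units.val_one, Units.val_neg, one_smul,
    neg_smul] at h
  rw [← sub_eq_zero, ← h, show dS α.c0 s t l = vderiv (fun s' => α.c0 s' t l) s from rfl]
  module

theorem IsMC.dS_ct (hα : α.IsMC A) (s t : unitInterval) (l : List V) :
    dS α.ct s t l = dT α.cs s t l + ins id (α.ct s t) (α.cs s t) l -
      ins id (α.cs s t) (α.ct s t) l - ins A.sg (α.cst s t) (α.c0 s t) l -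
      ins A.sg (α.c0 s t) (α.cst s t) l := by
  have h := hα.eqst s t l
  simp only [SqForm.d, SqForm.bracket, gerst, circ_one, sub_self, circ_zero, mul_one,
    mul_zero, Int.negOnePow_zero, Int.negOnePow_one, Units.val_one, Units.val_neg, one_smul,
    neg_smul, show (1 : ℤ) - 2 = -1 by norm_num, circ_neg_one, one_mul, Int.negOnePow_neg] at h
  rw [← sub_eq_zero, ← h, show dS α.ct s t l = vderiv (fun s' => α.ct s' t l) s from rfl,
    show dT α.cs s t l = vderiv (fun t' => α.cs s t' l) t from rfl]
  module

/-- The values of `α̂⁰ - d`. -/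
def opM (A : GradedSpace V) (α : SqForm V) (s t : unitInterval) : Op (V × V) (V × V) :=
  extendPt A 1 (α.c0 s t) (α.ct s t)

/-- The values of the coefficient of `ds` in `α̂¹`. -/
def opA (A : GradedSpace V) (α : SqForm V) (s t : unitInterval) : Op (V × V) (V × V) :=
  extendPt A 0 (α.cs s t) (α.cst s t)

theorem IsForm.smoothFam_opM (hα : α.IsForm A 1) : SmoothFam (opM A α) :=
  smoothFam_extendPt hα.h0.smoothFam hα.ht.smoothFam

theorem IsForm.smoothFam_opA (hα : α.IsForm A 1) : SmoothFam (opA A α) :=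
  smoothFam_extendPt hα.hs.smoothFam hα.hst.smoothFam

theorem IsForm.hasDegree_opM (hα : α.IsForm A 1) (s t : unitInterval) :
    HasDegree (pairs A) (pairs A) 1 (opM A α s t) :=
  hasDegree_extendPt (hα.h0.degree s t) (hα.ht.degree s t)

theorem IsForm.hasDegree_opA (hα : α.IsForm A 1) (s t : unitInterval) :
    HasDegree (pairs A) (pairs A) 0 (opA A α s t) :=
  hasDegree_extendPt (hα.hs.degree s t) (hα.hst.degree s t)

theorem IsForm.elin_opM (hα : α.IsForm A 1) (s t : unitInterval) :
    ELin (sgPair A.sg) dtMul (-1) (opM A α s t) := by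
  have := elin_extendPt (A := A) (k := 1) (hα.h0.smoothFam.multilin s t)
    (hα.ht.smoothFam.multilin s t)
  simpa [opM] using this

theorem IsForm.elin_opA (hα : α.IsForm A 1) (s t : unitInterval) :
    ELin (sgPair A.sg) dtMul 1 (opA A α s t) := by
  have := elin_extendPt (A := A) (k := 0) (hα.hs.smoothFam.multilin s t)
    (hα.hst.smoothFam.multilin s t)
  simpa [opA] using this

theorem dtMul_dtMul (u : V × V) : dtMul (dtMul u) = 0 := by simp

theorem IsForm.isNilFamily_opA (hA : A.IsDecomposed) (hα : α.IsForm A 1) (h0 : α.Uncurved)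
    (h1 : α.OneOneZero) : IsNilFamily (sgPair A.sg) dtMul (opA A α) where
  sq u := by simp [hA.sg_sg]
  E_sq := dtMul_dtMul
  smooth := hα.smoothFam_opA
  comm s t l := by
    have := (hα.hasDegree_opA s t).sg_apply (IsDecomposed.pairs hA) (hα.smoothFam_opA.multilin s t) l
    rwa [Int.negOnePow_zero, Units.val_one, one_smul] at this
  elin := hα.elin_opA
  nil s t := by
    simp only [opA, extendPt, List.map_nil, dtTerms, markedSum, (h0 s t).2.1, (h0 s t).2.2.2]
    simp
  unary s t u := by
    -- Since `α^{1,1} = 0`, only the term with `b` is left in the unary part.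
    refine ⟨(α.cst s t [u.1], 0), ?_⟩
    simp [opA, extendPt, dtTerms, markedSum, (h1 s t _).1]

/-- Both sides are multilinear and pass `dt` with sign `-1`, so words without `dt` suffice. There
the two components of the pair are the `ds` and `ds ∧ dt` components of the Maurer–Cartan equation.
-/
theorem IsMC.dS_opM (hA : A.IsDecomposed) (hα : α.IsMC A) (s t : unitInterval) :
    dS (opM A α) s t = fun l => ins id (opM A α s t) (opA A α s t) l +
      (- ins (sgPair A.sg) (opA A α s t) (opM A α s t) l + dtMul (dT (opA A α) s t l)) := by
  have hf := hα.isForm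
  have sM := hf.smoothFam_opM
  have sA := hf.smoothFam_opA
  have cA : ∀ l, sgPair A.sg (opA A α s t l) = opA A α s t (l.map (sgPair A.sg)) := by
    intro l
    have := (hf.hasDegree_opA s t).sg_apply (IsDecomposed.pairs hA) (sA.multilin s t) l
    rwa [Int.negOnePow_zero, Units.val_one, one_smul] at this
  have cM : ∀ l, sgPair A.sg (opM A α s t l) = (-1 : ℝ) • opM A α s t (l.map (sgPair A.sg)) := by
    intro l
    have := (hf.hasDegree_opM s t).sg_apply (IsDecomposed.pairs hA) (sM.multilin s t) l
    rw [Int.negOnePow_one, Units.val_neg, Units.val_one, neg_one_smul] at this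
    rw [neg_one_smul]
    exact this
  have mMA : Multilin (ins id (opM A α s t) (opA A α s t)) :=
    (sM.multilin s t).ins (sA.multilin s t) LinearMap.id
  have mAM := (sA.multilin s t).ins (sM.multilin s t) (sgPair A.sg)
  have eMA : ELin (sgPair A.sg) dtMul (-1) (ins id (opM A α s t) (opA A α s t)) := by
    have := (hf.elin_opM s t).ins (hf.elin_opA s t) (τ := LinearMap.id) (sM.multilin s t)
      (by simpa using cA) (by simp) (by simp)
    rwa [mul_one] at this
  have eAM : ELin (sgPair A.sg) dtMul (-1) (ins (sgPair A.sg) (opA A α s t) (opM A α s t)) := by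
    have := (hf.elin_opA s t).ins (hf.elin_opM s t) (τ := sgPair A.sg) (sA.multilin s t)
      cM (by simp) (by simp)
    rwa [one_mul] at this
  refine ELin.ext (σ := A.sg) (τ := sgPair A.sg) (ε := -1) (by simp) (sM.dS.multilin s t)
    (mMA.add (mAM.neg.add ((sA.dT.multilin s t).comp dtMul)))
    (ELin.dS sM hf.elin_opM s t)
    (eMA.add (eAM.neg.add ((ELin.dT sA hf.elin_opA s t).comp_left dtMul_dtMul))) fun l => ?_
  have p0 := hf.h0.smoothFam
  have ps := hf.hs.smoothFam
  have pt := hf.ht.smoothFam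
  have pst := hf.hst.smoothFam
  have e1 : dS (opM A α) s t (l.map fun v => (v, 0)) = (dS α.c0 s t l, dS α.ct s t l) := by
    have : ∀ s t, opM A α s t (l.map fun v => (v, 0)) = (α.c0 s t l, α.ct s t l) :=
      fun s t => extendPt_inl (p0.multilin s t) l
    simp only [dS, this]
    exact (p0.smooth l).derivS_prodMk (pt.smooth l) s t
  have e2 : dT (opA A α) s t (l.map fun v => (v, 0)) = (dT α.cs s t l, dT α.cst s t l) := by
    have : ∀ s t, opA A α s t (l.map fun v => (v, 0)) = (α.cs s t l, α.cst s t l) :=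
      fun s t => extendPt_inl (ps.multilin s t) l
    simp only [dT, this]
    exact (ps.smooth l).derivT_prodMk (pst.smooth l) s t
  have e3 := ins_extendPt_inl (A := A) (k := 1) (k' := 0) (Q' := α.cst s t) (p0.multilin s t)
    (pt.multilin s t) (ps.multilin s t) (τ := id) (τ' := id) (fun _ => rfl) l
  have e4 := ins_extendPt_inl (A := A) (k := 0) (k' := 1) (Q' := α.ct s t) (ps.multilin s t)
    (pst.multilin s t) (p0.multilin s t) (τ := sgPair A.sg) (τ' := A.sg) (by simp) l
  have e5 : (fun v => A.sg (A.sg v)) = id := funext hA.sg_sg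
  rw [e1]
  simp only [e2]
  rw [show ins id (opM A α s t) (opA A α s t) _ = _ from e3,
    show ins (sgPair A.sg) (opA A α s t) (opM A α s t) _ = _ from e4, hα.dS_c0, hα.dS_ct, e5]
  refine Prod.ext ?_ ?_
  · simp
    abel
  · simp
    abel

/-- A weight which insertions of `opA` decrease. -/
noncomputable def pairWeight (u : V × V) : ℕ := by
  classical exact if u = 0 then 0 else if u.1 = 0 then 1 else 2

theorem pairWeight_le (u : V × V) : pairWeight u ≤ 2 := by
  unfold pairWeight; split_ifs <;> omega

theorem pairWeight_dtMul (u : V × V) : pairWeight (dtMul u) ≤ 1 := by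
  unfold pairWeight; split_ifs <;> simp_all

theorem pairWeight_pos {u : V × V} (h : u ≠ 0) : 1 ≤ pairWeight u := by
  unfold pairWeight; split_ifs <;> simp_all

theorem eq_dtMul_of_pairWeight {u : V × V} (h : pairWeight u ≤ 1) : ∃ v, u = dtMul v := by
  refine ⟨(u.2, 0), ?_⟩
  unfold pairWeight at h
  split_ifs at h with h1 h2
  · simp [h1]
    rfl
  · exact Prod.ext h2 rfl
  · omega

/-- A unary vertex takes weight `2` to at most `1`, and kills multiples of `dt`. With at least two
inputs, either the first two are both multiples of `dt` and the value is zero, or the total weight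
is at least `3`, whereas a value has weight at most `2`. -/
theorem pairWeight_decreases {a : unitInterval → unitInterval → Op (V × V) (V × V)}
    {σ : V × V →ₗ[ℝ] V × V} (ha : IsNilFamily σ dtMul a) (s t : unitInterval)
    (y : List (V × V)) (hy : 0 ∉ y) :
    a s t y = 0 ∨ pairWeight (a s t y) < (y.map pairWeight).sum := by
  match y, hy with
  | [], _ => exact Or.inl (ha.nil s t)
  | [u], hy =>
    by_cases hu : pairWeight u ≤ 1
    · obtain ⟨v, rfl⟩ := eq_dtMul_of_pairWeight hu
      obtain ⟨w, hw⟩ := ha.unary s t v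
      left
      have := ha.elin s t [] v []
      simp only [List.nil_append, List.map_nil, one_smul] at this
      rw [this, hw, ha.E_sq]
    · right
      obtain ⟨w, hw⟩ := ha.unary s t u
      have := pairWeight_dtMul w
      rw [hw]
      simp only [List.map_cons, List.map_nil, List.sum_cons, List.sum_nil]
      omega
  | u :: v :: y, hy =>
    have hu : 1 ≤ pairWeight u := pairWeight_pos (by rintro rfl; simp at hy)
    have hv : 1 ≤ pairWeight v := pairWeight_pos (by rintro rfl; simp at hy)
    by_cases huv : pairWeight u ≤ 1 ∧ pairWeight v ≤ 1
    · obtain ⟨u, rfl⟩ := eq_dtMul_of_pairWeight huv.1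
      obtain ⟨v, rfl⟩ := eq_dtMul_of_pairWeight huv.2
      left
      have := ha.elin s t [] u (dtMul v :: y)
      simp only [List.nil_append, List.map_nil, one_smul] at this
      rw [this]
      exact (ha.elin s t).eq_zero ha.E_sq [u] v y
    · right
      have := pairWeight_le (a s t (u :: v :: y))
      simp only [List.map_cons, List.sum_cons]
      omega

/-- The values of `Ĝ`, along the path from `s` to `1`. -/
noncomputable def opG (A : GradedSpace V) (α : SqForm V) :
    unitInterval → unitInterval → Op (V × V) (V × V) := pathOp (opA A α)

theorem IsMC.blocks_opG (hA : A.IsDecomposed) (hα : α.IsMC A) (h0 : α.Uncurved)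
    (h1 : α.OneOneZero) (s t : unitInterval) (l : List (V × V)) :
    blocks (opM A α 1 t) (opG A α s t) l + dtMul (dT (opG A α) s t l) =
      ins (sgPair A.sg) (opG A α s t) (opM A α s t) l := by
  have ha := hα.isForm.isNilFamily_opA hA h0 h1
  exact ha.blocks_pathOp hα.isForm.smoothFam_opM (fun s t l => congrFun (hα.dS_opM hA s t) l)
    pairWeight (pairWeight_decreases ha) s t l

end SqForm

end mc

/-! ### Operators on forms and their values at points -/

section forms

variable {V W : Type*} [AddCommGroup V] [Module ℝ V] [AddCommGroup W] [Module ℝ W]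

/-- Evaluation at `t`. -/
def evalAt (t : unitInterval) : Pre V →ₗ[ℝ] V × V where
  toFun η := (η.1 t, η.2 t)
  map_add' _ _ := rfl
  map_smul' _ _ := rfl

theorem evalAt_apply (t : unitInterval) (η : Pre V) : evalAt t η = (η.1 t, η.2 t) := rfl

theorem evalAt_ext {η θ : Pre V} (h : ∀ t, evalAt t η = evalAt t θ) : η = θ :=
  Prod.ext (funext fun t => congrArg Prod.fst (h t)) (funext fun t => congrArg Prod.snd (h t))

variable {A : GradedSpace V}

theorem evalAt_extend (k : ℤ) (P Q : unitInterval → Op V V) (t : unitInterval)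
    (L : List (Pre V)) :
    evalAt t (extend A k P Q L) = extendPt A k (P t) (Q t) (L.map (evalAt t)) := by
  have h := sum_fin_eq_markedSum (fun η : Pre V => A.sg (η.1 t)) (fun η => η.2 t)
    (fun η => η.1 t) (P t) L
  simp only [evalAt_apply, extend, extendPt, dtTerms, markedSum_map, h, List.map_map]
  rfl

theorem evalAt_mem {k : ℤ} {η : Pre V} (h : η ∈ (forms A).part k) (t : unitInterval) :
    evalAt t η ∈ (pairs A).part k := by
  obtain ⟨⟨N, g, w, -, hw, h1⟩, ⟨N', g', w', -, hw', h2⟩⟩ := h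
  refine ⟨?_, ?_⟩
  · change η.1 t ∈ _
    rw [h1]
    exact Submodule.sum_mem _ fun i _ => Submodule.smul_mem _ _ (hw i)
  · change η.2 t ∈ _
    rw [h2]
    exact Submodule.sum_mem _ fun i _ => Submodule.smul_mem _ _ (hw' i)

theorem smooth₂_evalAt {k : ℤ} {η : Pre V} (h : η ∈ (forms A).part k) :
    Smooth₂ fun _ t => evalAt t η := by
  obtain ⟨⟨N, g, w, hg, -, h1⟩, ⟨N', g', w', hg', -, h2⟩⟩ := h
  refine Smooth₂.prodMk (Smooth₂.of_sum (g := fun i x => g i x.2) (w := w)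
    (fun i => (hg i).comp (by fun_prop)) fun s t => h1 t)
    (Smooth₂.of_sum (g := fun i x => g' i x.2) (w := w')
    (fun i => (hg' i).comp (by fun_prop)) fun s t => h2 t)

theorem smooth₂_apply_evalAt {F : unitInterval → unitInterval → Op (V × V) W} (hF : SmoothFam F)
    {L : List (Pre V)} (hL : IsHomog (forms A) L) :
    Smooth₂ fun s t => F s t (L.map (evalAt t)) := by
  have := hF.smooth_apply (L.map fun η _ t => evalAt t η) fun u hu => by
    obtain ⟨η, hη, rfl⟩ := List.mem_map.1 hu
    obtain ⟨k, hk⟩ := hL η hη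
    exact smooth₂_evalAt hk
  simpa [Function.comp_def] using this

theorem WordDeg.isHomog {l : List V} {d : ℤ} (h : WordDeg A l d) : IsHomog A l := by
  induction l generalizing d with
  | nil => simp [IsHomog]
  | cons v l ih =>
    obtain ⟨k, hk, h⟩ := h
    intro u hu
    rcases List.mem_cons.1 hu with rfl | hu
    · exact ⟨k, hk⟩
    · exact ih h u hu

/-- Applying `Φ` to smooth forms is pointwise application of a smooth family, so the result is
smooth in `t`. Projections put the vectors of its presentation into the required homogeneous part.
-/
theorem hasDegree_of_evalAt (hA : A.IsDecomposed) {k : ℤ} {Φ : Op (Pre V) (Pre V)}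
    {F : unitInterval → unitInterval → Op (V × V) (V × V)} (hF : SmoothFam F)
    (hd : ∀ t, HasDegree (pairs A) (pairs A) k (F 0 t))
    (h : ∀ t L, evalAt t (Φ L) = F 0 t (L.map (evalAt t))) :
    HasDegree (forms A) (forms A) k Φ := by
  rw [hasDegree_iff]
  intro L d hL
  have hs := smooth₂_apply_evalAt hF hL.isHomog
  have hm : ∀ t, F 0 t (L.map (evalAt t)) ∈ (pairs A).part (d + k + 1) := fun t =>
    hasDegree_iff.1 (hd t) _ d (hL.map fun k η hη => evalAt_mem hη t)
  refine ⟨?_, ?_⟩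
  · rw [show (Φ L).1 = fun t => (F 0 t (L.map (evalAt t))).1 from
      funext fun t => congrArg Prod.fst (h t L)]
    exact (hs.map (LinearMap.fst ℝ V V)).isSmooth (hA.proj _) 0 fun t => (hm t).1
  · rw [show (Φ L).2 = fun t => (F 0 t (L.map (evalAt t))).2 from
      funext fun t => congrArg Prod.snd (h t L)]
    exact (hs.map (LinearMap.snd ℝ V V)).isSmooth (hA.proj _) 0 fun t => (hm t).2

theorem multilin_of_evalAt {Φ : Op (Pre V) (Pre V)} {F : unitInterval → Op (V × V) (V × V)}
    (hF : ∀ t, Multilin (F t)) (h : ∀ t L, evalAt t (Φ L) = F t (L.map (evalAt t))) :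
    Multilin Φ := by
  intro x z c a b
  refine evalAt_ext fun t => ?_
  have := hF t (x.map (evalAt t)) (z.map (evalAt t)) c (evalAt t a) (evalAt t b)
  simpa [h] using this

theorem deRham_of_two (u v : Pre V) (l : List (Pre V)) : deRham (u :: v :: l) = 0 := rfl

theorem evalAt_deRham {k : ℤ} {η : Pre V} (h : η ∈ (forms A).part k) (s t : unitInterval) :
    evalAt t (deRham [η]) = dtMul (derivT (fun _ t => evalAt t η) s t) := by
  have := (smooth₂_evalAt h).derivT_map (LinearMap.fst ℝ V V) s t
  exact Prod.ext rfl this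

/-- The de Rham differential of the value of an operator on forms. -/
theorem evalAt_deRham_apply {Φ : Op (Pre V) (Pre V)}
    {F : unitInterval → unitInterval → Op (V × V) (V × V)} (hF : SmoothFam F) {ε : ℝ}
    (hε : ε * ε = 1) (he : ∀ t, ELin (sgPair A.sg) dtMul ε (F 0 t))
    (hsg : ∀ v, A.sg (A.sg v) = v)
    (h : ∀ t L, evalAt t (Φ L) = F 0 t (L.map (evalAt t))) {L : List (Pre V)}
    (hL : IsHomog (forms A) L) (t : unitInterval) :
    evalAt t (deRham [Φ L]) = dtMul (dT F 0 t (L.map (evalAt t))) +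
      ε • split₃ (fun x y z => F 0 t ((x.map (forms A).sg).map (evalAt t) ++
        evalAt t (deRham y) :: z.map (evalAt t))) L := by
  have hs := smooth₂_apply_evalAt hF hL
  have hsm : ∀ u ∈ (L.map fun (η : Pre V) (_ : unitInterval) t => evalAt t η), Smooth₂ u := by
    intro u hu
    obtain ⟨η, hη, rfl⟩ := List.mem_map.1 hu
    obtain ⟨k, hk⟩ := hL η hη
    exact smooth₂_evalAt hk
  have h1 : evalAt t (deRham [Φ L]) =
      dtMul (derivT (fun s t => F s t (L.map (evalAt t))) 0 t) := by
    have h2 := hs.derivT_map (LinearMap.fst ℝ V V) 0 t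
    refine Prod.ext rfl (Eq.trans ?_ h2)
    change vderiv (Φ L).1 t = vderiv _ t
    congr 1
    exact funext fun t => congrArg Prod.fst (h t L)
  have h3 := hF.derivT_apply _ hsm 0 t
  simp only [List.map_map, Function.comp_def, split₃_map] at h3
  rw [h1, h3, map_add, map_split₃, ← split₃_smul]
  congr 1
  refine split₃_congr fun x y z hxyz => ?_
  have hy : evalAt t (deRham y) = dtMul (SmoothFam.derivOp 0 t
      (y.map fun (η : Pre V) (_ : unitInterval) t => evalAt t η)) := by
    match y with
    | [] => exact (map_zero dtMul).symm
    | [η] =>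
      obtain ⟨k, hk⟩ := hL η (by rw [← hxyz]; simp)
      exact evalAt_deRham hk 0 t
    | u :: v :: y => exact (map_zero dtMul).symm
  -- Both signs square to one: `ε` here, and the two applications of the degree sign to the letters
  -- before the derivative.
  rw [hy, he, smul_smul, hε, one_smul]
  congr 3
  simp [evalAt_apply, hsg, forms]

/-- Homogeneity of `a` and `b` is what provides smoothness; `vderiv` is not linear on arbitrary
functions. -/
theorem deRham_linear {x z : List (Pre V)} {k : ℤ} {a b : Pre V} (c : ℝ)
    (ha : a ∈ (forms A).part k) (hb : b ∈ (forms A).part k) :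
    deRham (x ++ (c • a + b) :: z) = c • deRham (x ++ a :: z) + deRham (x ++ b :: z) := by
  match x, z with
  | [], [] =>
    refine evalAt_ext fun t => ?_
    have hab := Submodule.add_mem _ (Submodule.smul_mem _ c ha) hb
    have h1 := (smooth₂_evalAt ha).smul c
    have h2 := smooth₂_evalAt hb
    rw [map_add, map_smul, List.nil_append, List.nil_append, List.nil_append,
      evalAt_deRham hab 0, evalAt_deRham ha 0, evalAt_deRham hb 0, ← map_smul, ← map_add,
      ← (smooth₂_evalAt ha).derivT_smul, ← h1.derivT_add h2]
    rfl
  | [], v :: z => simp [deRham_of_two]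
  | [w], z => simp [deRham_of_two]
  | w :: w' :: x, z => simp [deRham_of_two]

theorem hasDegree_deRham (hA : A.IsDecomposed) : HasDegree (forms A) (forms A) 1 deRham := by
  rw [hasDegree_iff]
  intro l d hl
  match l, hl with
  | [], _ => exact Submodule.zero_mem _
  | [η], ⟨k, hk, h⟩ =>
    have h : d - (k - 1) = 0 := h
    have hs := smooth₂_evalAt hk
    refine ⟨(Submodule.zero_mem ((forms A).part (d + 1 + 1))).1, ?_⟩
    have h1 : Smooth₂ fun (_ : unitInterval) t => η.1 t := hs.map (LinearMap.fst ℝ V V)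
    rw [show d + 1 + 1 - 1 = k by omega]
    refine h1.derivT.isSmooth (hA.proj k) 0 fun t => ?_
    obtain ⟨π, hπ, hπ'⟩ := hA.proj k
    have h2 := h1.derivT_map π 0 t
    have h3 : ∀ t, π (η.1 t) = η.1 t := fun t => hπ' _ (evalAt_mem hk t).1
    simp only [h3] at h2
    rw [h2]
    exact hπ _
  | u :: v :: l, _ => exact Submodule.zero_mem _

theorem evalAt_formsStructure (μ : Op V V) (t : unitInterval) (L : List (Pre V)) :
    evalAt t (formsStructure A μ L) =
      evalAt t (deRham L) + extendPt A 1 μ (fun _ => 0) (L.map (evalAt t)) := by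
  rw [formsStructure, map_add, evalAt_extend]

theorem formsStructure_fst (μ : Op V V) (t : unitInterval) (L : List (Pre V)) :
    (formsStructure A μ L).1 t = μ (L.map fun η => η.1 t) := by
  have : (deRham L).1 t = 0 := by
    match L with
    | [] => rfl
    | [η] => rfl
    | u :: v :: L => rfl
  change (deRham L).1 t + _ = _
  rw [this, zero_add]
  rfl

theorem multilin_zero : Multilin fun _ : List V => (0 : W) := by
  intro x z c a b
  simp

/-- The structure of forms with values in an `A_∞` algebra. -/
theorem isAInf_formsStructure (hA : A.IsDecomposed) {μ : Op V V} (hμ : IsAInf A μ)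
    (mμ : Multilin μ) : IsAInf (forms A) (formsStructure A μ) := by
  let F : unitInterval → unitInterval → Op (V × V) (V × V) := fun _ _ => extendPt A 1 μ fun _ => 0
  have mF : Multilin (extendPt A 1 μ fun _ => 0) := multilin_extendPt mμ multilin_zero
  have hF : SmoothFam F := ⟨fun _ _ => mF, fun l => Smooth₂.const _⟩
  let Φ : Op (Pre V) (Pre V) := extend A 1 (fun _ => μ) fun _ _ => 0
  have hΦ : ∀ t L, evalAt t (Φ L) = F 0 t (L.map (evalAt t)) := fun t L =>
    evalAt_extend 1 _ _ t L
  have hz : HasDegree A A (1 - 1) fun _ => 0 := fun _ _ _ => Submodule.zero_mem _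
  have dΦ : HasDegree (forms A) (forms A) 1 Φ := hasDegree_of_evalAt hA hF
    (fun t => hasDegree_extendPt hμ.cochain.degree hz) hΦ
  have mΦ : Multilin Φ := multilin_of_evalAt (fun _ => mF) hΦ
  have eF : ELin (sgPair A.sg) dtMul (-1) (extendPt A 1 μ fun _ => 0) := by
    simpa using elin_extendPt (A := A) (k := 1) mμ multilin_zero
  refine ⟨?_, ⟨?_, ?_⟩, ?_⟩
  · refine evalAt_ext fun t => ?_
    rw [evalAt_formsStructure]
    simp [deRham, extendPt, dtTerms, markedSum, hμ.uncurved]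
  · intro x z i a b c hx hz ha hb
    change deRham _ + Φ _ = c • (deRham _ + Φ _) + (deRham _ + Φ _)
    rw [deRham_linear c ha hb, mΦ, smul_add]
    abel
  · exact fun ks L h => Submodule.add_mem _ (hasDegree_deRham hA ks L h) (dΦ ks L h)
  · intro L hL
    rw [circ_one]
    refine evalAt_ext fun t => ?_
    have h1 : ins (forms A).sg (formsStructure A μ) (formsStructure A μ) L =
        deRham [formsStructure A μ L] + ins (forms A).sg Φ (formsStructure A μ) L := by
      rw [← ins_of_unary deRham_of_two (forms A).sg]
      exact ins_add_left _ _ _ _ _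
    -- This is `d² = 0`: the de Rham part of the structure has no `dt`-free component.
    have h2 : deRham [formsStructure A μ L] = deRham [Φ L] := by
      have : (formsStructure A μ L).1 = (Φ L).1 := funext fun t => formsStructure_fst μ t L
      simp only [deRham, this]
    have h3 := evalAt_deRham_apply hF (A := A) (ε := -1) (by norm_num) (fun _ => eF) hA.sg_sg hΦ hL t
    have h4 : dT F 0 t (L.map (evalAt t)) = 0 := vderiv_const _ _
    have h5 : evalAt t (ins (forms A).sg Φ (formsStructure A μ) L) =
        split₃ (fun x y z => F 0 t ((x.map (forms A).sg).map (evalAt t) ++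
          evalAt t (deRham y) :: z.map (evalAt t))) L +
        ins (sgPair A.sg) (F 0 t) (F 0 t) (L.map (evalAt t)) := by
      rw [ins, map_split₃, ins, split₃_map, ← split₃_add]
      refine split₃_congr fun x y z _ => ?_
      rw [hΦ, List.map_append, List.map_cons, evalAt_formsStructure, (hF.multilin 0 t).map_add]
      simp only [List.map_map]
      rfl
    -- The extension of `μ` squares to zero: by compatibility with `dt` this reduces to words in
    -- `V`, and there to `μ∘μ = 0` on homogeneous words.
    have h6 : ins (sgPair A.sg) (F 0 t) (F 0 t) = fun _ => 0 := by
      have hsgF : ∀ l, sgPair A.sg (F 0 t l) = (-1 : ℝ) • F 0 t (l.map (sgPair A.sg)) := by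
        intro l
        have := (hasDegree_extendPt hμ.cochain.degree hz).sg_apply (IsDecomposed.pairs hA) mF l
        rw [Int.negOnePow_one, Units.val_neg, Units.val_one, neg_one_smul] at this
        rw [neg_one_smul]
        exact this
      refine ELin.ext (σ := A.sg) (τ := sgPair A.sg) (ε := -1 * -1) (by simp) (mF.ins mF _)
        multilin_zero (eF.ins eF mF hsgF (by simp) (by simp)) (fun x u z => by simp only [map_zero, smul_zero]) fun l => ?_
      have := ins_extendPt_inl (A := A) (k := 1) (k' := 1) (Q' := fun _ => 0) mμ
        (multilin_zero (V := V) (W := V)) mμ (τ := sgPair A.sg) (τ' := A.sg) (by simp) l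
      rw [show ins (sgPair A.sg) (F 0 t) (F 0 t) _ = _ from this]
      have e1 : ins A.sg μ μ l = 0 := by
        have e2 : ins A.sg μ μ = fun _ => 0 := by
          refine Multilin.ext_homog hA (mμ.ins mμ A.sg) multilin_zero fun l hl => ?_
          rw [← circ_one]
          exact hμ.rel l hl
        rw [e2]
      have e3 : ins A.sg (fun _ => (0 : V)) μ l = 0 := split₃_eq_zero fun _ _ _ _ => rfl
      have e4 : ins (fun v => A.sg (A.sg v)) μ (fun _ => 0) l = 0 :=
        split₃_eq_zero fun _ _ _ _ => mμ.map_zero _ _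
      rw [e1, e3, e4]
      simp
    rw [h1, h2, map_add, h3, h4, h5, h6, map_zero]
    simp

/-! ### The tree constructions on forms, computed at points -/

theorem trees_eq_treeSum (A : GradedSpace V) (a : unitInterval → Op V V) (ts : List unitInterval) :
    trees A a ts = treeSum a ts := by
  induction ts with
  | nil =>
    funext l
    match l with
    | [] => rfl
    | [v] => rfl
    | u :: v :: l => rfl
  | cons t ts ih => rw [trees, circ_zero, ih, treeSum]

theorem map_treeSum (T : V →ₗ[ℝ] W) {a : unitInterval → Op V V} {a' : unitInterval → Op W W}
    (h : ∀ s l, T (a s l) = a' s (l.map T)) (ts : List unitInterval) (l : List V) :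
    T (treeSum a ts l) = treeSum a' ts (l.map T) := by
  induction ts generalizing l with
  | nil =>
    match l with
    | [] => exact map_zero T
    | [v] => rfl
    | u :: v :: l => exact map_zero T
  | cons t ts ih => exact map_ins (σ := id) (σ' := id) T T (fun _ => rfl) ih (h t) l

theorem simplexIntegral_eq {a : unitInterval → unitInterval → Op V V} (ha : SmoothFam a)
    (ℓ : Module.Dual ℝ V) (i : ℕ) (s t : unitInterval) (l : List V) :
    simplexIntegral i s 1 (fun ts => ℓ (treeSum (fun s => a s t) ts l)) =
      (-1) ^ i * ℓ (pathTerm a i s t l) := by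
  have := simplexIntegral_treeSum ha ℓ t i s (ι := Unit) Finset.univ fun _ => l
  simp only [Finset.univ_unique, Finset.sum_singleton] at this
  rw [← this, ← mul_assoc, ← mul_pow]
  simp

namespace SqForm

variable {α : SqForm V}

/-- Evaluation at `t` intertwines the collapsed operators with `opA`, hence also their tree sums.
The tests on forms are point evaluations followed by functionals, so the integrals defining `Ĝ` are
those of `pathTerm` at each `t`. -/
theorem IsForm.evalAt_Ghat (hα : α.IsForm A 1) (t : unitInterval) (L : List (Pre V)) :
    evalAt t (α.Ghat A L) = opG A α 0 t (L.map (evalAt t)) := by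
  have h : ∀ i, (-1 : ℝ) ^ i • represented (forms A).test (fun ψ => simplexIntegral i 0 1
      fun ts => ψ (trees (forms A) (α.collapse1 A) ts L)) =
      (fun t => (pathTerm (opA A α) i 0 t (L.map (evalAt t))).1,
        fun t => (pathTerm (opA A α) i 0 t (L.map (evalAt t))).2) := by
    intro i
    have hT : ∀ t ts, evalAt t (trees (forms A) (α.collapse1 A) ts L) =
        treeSum (fun s => opA A α s t) ts (L.map (evalAt t)) := by
      intro t ts
      rw [trees_eq_treeSum]
      exact map_treeSum _ (fun s l => evalAt_extend 0 _ _ t l) ts L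
    rw [represented_eq (forms A).test_separates (w := (-1 : ℝ) ^ i •
      ((fun t => (pathTerm (opA A α) i 0 t (L.map (evalAt t))).1,
        fun t => (pathTerm (opA A α) i 0 t (L.map (evalAt t))).2) : Pre V))]
    · rw [smul_smul, ← mul_pow]
      simp
    · rintro ψ ⟨ℓ, -, t, rfl | rfl⟩
      · refine Eq.trans ?_ (Eq.trans (simplexIntegral_eq hα.smoothFam_opA
          (ℓ ∘ₗ LinearMap.fst ℝ V V) i 0 t (L.map (evalAt t))).symm ?_)
        · simp
        · simp only [← hT]
          rfl
      · refine Eq.trans ?_ (Eq.trans (simplexIntegral_eq hα.smoothFam_opA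
          (ℓ ∘ₗ LinearMap.snd ℝ V V) i 0 t (L.map (evalAt t))).symm ?_)
        · simp
        · simp only [← hT]
          rfl
  rw [Ghat, pathMap]
  simp only [h, map_sum, opG, pathOp, List.length_map]
  rfl

/-- Taking the `dt`-free component intertwines `opA` with `a`, so the integrals agree term by term.
The additional term `i = n` of `Ĝ` is a multiple of `dt` and is not seen by this component. -/
theorem IsForm.F_eq (hA : A.IsDecomposed) (hα : α.IsForm A 1) (h0 : α.Uncurved)
    (h1 : α.OneOneZero) (t : unitInterval) (l : List V) :
    α.F A t l = (opG A α 0 t (l.map fun v => (v, 0))).1 := by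
  have ha := hα.isNilFamily_opA hA h0 h1
  have h : ∀ i, (-1 : ℝ) ^ i • represented A.test (fun ψ => simplexIntegral i 0 1
      fun ts => ψ (trees A (fun s => α.cs s t) ts l)) =
      (pathTerm (opA A α) i 0 t (l.map fun v => (v, 0))).1 := by
    intro i
    have hT : ∀ ts, trees A (fun s => α.cs s t) ts l = LinearMap.fst ℝ V V
        (treeSum (fun s => opA A α s t) ts (l.map fun v => (v, 0))) := by
      intro ts
      rw [trees_eq_treeSum, map_treeSum (LinearMap.fst ℝ V V) (a' := fun s => α.cs s t)
        fun s l => rfl]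
      simp [Function.comp_def]
    rw [represented_eq A.test_separates (w := (-1 : ℝ) ^ i •
      (pathTerm (opA A α) i 0 t (l.map fun v => (v, 0))).1)]
    · rw [smul_smul, ← mul_pow]
      simp
    · intro ℓ _
      refine Eq.trans ?_ (Eq.trans (simplexIntegral_eq hα.smoothFam_opA
          (ℓ ∘ₗ LinearMap.fst ℝ V V) i 0 t (l.map fun v => (v, 0))).symm ?_)
      · simp
      · simp only [hT]
        rfl
  rw [F, pathMap]
  simp only [h, add_zero]
  have hn : (pathTerm (opA A α) l.length 0 t (l.map fun v => (v, 0))).1 = 0 :=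
    congrArg Prod.snd (ha.E_pathTerm_eq_zero l.length 0 t (l.map fun v => (v, 0)) (by simp))
  rw [opG, pathOp, Prod.fst_sum, List.length_map, Finset.sum_range_succ, hn, add_zero]

theorem collapse0_eq {s₀ : unitInterval} (h : α.ConstantOnEdge s₀) :
    α.collapse0 A s₀ = formsStructure A (α.c0 s₀ 0) := by
  have h1 : α.c0 s₀ = fun _ => α.c0 s₀ 0 := funext fun t => funext fun l => (h t l).1
  have h2 : α.ct s₀ = fun _ _ => 0 := funext fun t => funext fun l => (h t l).2
  funext L
  rw [collapse0, h1, h2, formsStructure]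

theorem IsMC.isAInf_c0 (hα : α.IsMC A) (h0 : α.Uncurved) (s t : unitInterval) :
    IsAInf A (α.c0 s t) where
  uncurved := (h0 s t).1
  cochain := ⟨fun x z _ a b c _ _ _ _ => hα.isForm.h0.smoothFam.multilin s t x z c a b,
    hα.isForm.h0.degree s t⟩
  rel l _ := by rw [circ_one]; exact hα.ins_c0_c0 s t l

theorem IsForm.multilin_Ghat (hα : α.IsForm A 1) : Multilin (α.Ghat A) :=
  multilin_of_evalAt (fun t => (smoothFam_pathOp hα.smoothFam_opA).multilin 0 t) hα.evalAt_Ghat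

theorem IsForm.hasDegree_Ghat (hA : A.IsDecomposed) (hα : α.IsForm A 1) :
    HasDegree (forms A) (forms A) 0 (α.Ghat A) :=
  hasDegree_of_evalAt hA (smoothFam_pathOp hα.smoothFam_opA) (fun t =>
    HasDegree.pathOp (IsDecomposed.pairs hA) hα.smoothFam_opA hα.hasDegree_opA 0 t) hα.evalAt_Ghat

/-- At each `t`, the Leibniz rule expands `d (Ĝ L)` into `dt ∂ₜG`, which `blocks_opG` absorbs, and
the terms with `d` applied to an argument, which are the de Rham terms of `Ĝ ∘ α̂⁰`. -/
theorem IsMC.blocks_Ghat (hA : A.IsDecomposed) (hα : α.IsMC A) (h0 : α.Uncurved)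
    (h1 : α.OneOneZero) {L : List (Pre V)} (hL : IsHomog (forms A) L) (hne : L ≠ []) :
    blocks (α.collapse0 A 1) (α.Ghat A) L =
      ins (forms A).sg (α.Ghat A) (α.collapse0 A 0) L := by
  have ha := hα.isForm.isNilFamily_opA hA h0 h1
  have hG : SmoothFam (opG A α) := smoothFam_pathOp hα.isForm.smoothFam_opA
  have ev := hα.isForm.evalAt_Ghat
  refine evalAt_ext fun t => ?_
  have e1 : blocks (α.collapse0 A 1) (α.Ghat A) L = deRham [α.Ghat A L] +
      blocks (extend A 1 (α.c0 1) (α.ct 1)) (α.Ghat A) L := by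
    rw [← blocks_of_unary (m := deRham) (F := α.Ghat A) deRham_of_two hne]
    exact blocks_add _ _ _ _
  have e2 : evalAt t (blocks (extend A 1 (α.c0 1) (α.ct 1)) (α.Ghat A) L) =
      blocks (opM A α 1 t) (opG A α 0 t) (L.map (evalAt t)) :=
    map_blocks (m' := opM A α 1 t) (evalAt t) (evalAt t) (evalAt t)
      (fun L => evalAt_extend 1 (α.c0 1) (α.ct 1) t L) (ev t) L
  have e3 := evalAt_deRham_apply hG (A := A) (ε := 1) (by norm_num)
    (fun t => ha.elin_pathOp 0 t) hA.sg_sg ev hL t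
  have e4 : evalAt t (ins (forms A).sg (α.Ghat A) (α.collapse0 A 0) L) =
      split₃ (fun x y z => opG A α 0 t ((x.map (forms A).sg).map (evalAt t) ++
        evalAt t (deRham y) :: z.map (evalAt t))) L +
      ins (sgPair A.sg) (opG A α 0 t) (opM A α 0 t) (L.map (evalAt t)) := by
    rw [ins, map_split₃, ins, split₃_map, ← split₃_add]
    refine split₃_congr fun x y z _ => ?_
    rw [ev, List.map_append, List.map_cons, collapse0, map_add, evalAt_extend,
      (hG.multilin 0 t).map_add]
    simp only [List.map_map]
    rfl
  rw [e1, map_add, e2, e3, e4, ← hα.blocks_opG hA h0 h1, one_smul]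
  abel

theorem IsMC.isAInfMorphism_Ghat (hA : A.IsDecomposed) (hα : α.IsMC A) (h0 : α.Uncurved)
    (h1 : α.OneOneZero) (he0 : α.ConstantOnEdge 0) (he1 : α.ConstantOnEdge 1) :
    IsAInfMorphism (forms A) (formsStructure A (α.c0 0 0)) (forms A)
      (formsStructure A (α.c0 1 0)) (α.Ghat A) where
  source := isAInf_formsStructure hA (hα.isAInf_c0 h0 0 0) (hα.isForm.h0.smoothFam.multilin 0 0)
  target := isAInf_formsStructure hA (hα.isAInf_c0 h0 1 0) (hα.isForm.h0.smoothFam.multilin 1 0)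
  cochain := ⟨fun x z _ a b c _ _ _ _ => hα.isForm.multilin_Ghat x z c a b,
    hα.isForm.hasDegree_Ghat hA⟩
  rel L hne hL := by
    rw [sum_composition_eq_blocks, circ_one, ← collapse0_eq he0, ← collapse0_eq he1]
    exact hα.blocks_Ghat hA h0 h1 hL hne

end SqForm

theorem const_mem {k : ℤ} {v : V} (hv : v ∈ A.part k) : const v ∈ (forms A).part k :=
  ⟨⟨1, fun _ _ => 1, fun _ => v, fun _ => contDiff_const, fun _ => hv, fun x => by simp [const]⟩,
    ⟨0, Fin.elim0, Fin.elim0, fun i => i.elim0, fun i => i.elim0, fun x => by simp [const]⟩⟩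

theorem formsStructure_const {μ : Op V V} (mμ : Multilin μ) (l : List V) :
    const (μ l) = formsStructure A μ (l.map const) := by
  refine evalAt_ext fun t => ?_
  have h : evalAt t (deRham (l.map const)) = (0 : V × V) := by
    match l with
    | [] => rfl
    | [v] => exact Prod.ext rfl (vderiv_const v t)
    | u :: v :: l => rfl
  rw [evalAt_formsStructure, h, zero_add, List.map_map]
  exact (extendPt_inl (A := A) (k := 1) (Q := fun _ => 0) mμ l).symm

/-- An `A_∞` morphism of forms restricts to an `A_∞` morphism on constants. -/
theorem IsAInfMorphism.comp_const {μ : Op V V} {m : Op (Pre V) (Pre V)} {G : Op (Pre V) (Pre V)}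
    {B : GradedSpace (Pre V)} (hμ : IsAInf A μ) (mμ : Multilin μ) (mG : Multilin G)
    (hG : IsAInfMorphism (forms A) (formsStructure A μ) B m G) :
    IsAInfMorphism A μ B m fun l => G (l.map const) where
  source := hμ
  target := hG.target
  cochain := by
    refine ⟨fun x z i a b c hx hz ha hb => ?_, ?_⟩
    · have hc : const (c • a + b) = c • const a + const b :=
        Prod.ext rfl (funext fun _ => by simp [const])
      simpa [hc] using mG (x.map const) (z.map const) c (const a) (const b)
    · rw [hasDegree_iff]
      intro l d hl
      exact hasDegree_iff.1 hG.cochain.degree _ d (hl.map fun k v hv => const_mem hv)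
  rel l hne hl := by
    have hl' : IsHomog (forms A) (l.map const) := by
      intro u hu
      obtain ⟨v, hv, rfl⟩ := List.mem_map.1 hu
      obtain ⟨k, hk⟩ := hl v hv
      exact ⟨k, const_mem hk⟩
    have h := hG.rel (l.map const) (by simpa using hne) hl'
    rw [sum_composition_eq_blocks, circ_one] at h ⊢
    refine (map_blocks (m' := m) (F' := G) LinearMap.id id const (fun l => by simp)
      (fun l => rfl) l).trans (h.trans ?_)
    refine (map_ins (f := fun l => G (l.map const)) LinearMap.id const ?_ (fun l => rfl)
      (fun l => formsStructure_const mμ l) l).symm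
    exact fun v => Prod.ext rfl (funext fun _ => by simp [const, forms])

/-- An `A_∞` morphism to forms gives `A_∞` morphisms at all points. -/
theorem IsAInfMorphism.comp_eval {B : GradedSpace W} {μ : Op V V} {ν : Op W W} {φ : Op V (Pre W)}
    (hν : IsAInf B ν) (hφ : IsAInfMorphism A μ (forms B) (formsStructure B ν) φ)
    (t : unitInterval) : IsAInfMorphism A μ B ν fun l => (φ l).1 t where
  source := hφ.source
  target := hν
  cochain := by
    refine ⟨fun x z i a b c hx hz ha hb => ?_, fun ks l h => ?_⟩
    · rw [hφ.cochain.linear x z i a b c hx hz ha hb]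
      rfl
    · exact (evalAt_mem (hφ.cochain.degree ks l h) t).1
  rel l hne hl := by
    have h := hφ.rel l hne hl
    rw [sum_composition_eq_blocks, circ_one] at h ⊢
    -- The `dt`-free value at `t` annihilates the de Rham term and so carries the structure of forms
    -- strictly to `ν`.
    let T : Pre W →ₗ[ℝ] W := LinearMap.fst ℝ W W ∘ₗ evalAt t
    have h' := congrArg T h
    rw [comp_ins, map_blocks (m' := ν) (F' := fun l => (φ l).1 t) T T id
      (fun l => formsStructure_fst ν t l) (fun l => by rw [List.map_id]; rfl), List.map_id] at h'
    exact h'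

end forms

end AInf

/-! ### Assembly of the theorem -/

theorem mainTheorem3 {V : Type*} [AddCommGroup V] [Module ℝ V] (𝒱 : ℤ → Submodule ℝ V)
    [DirectSum.Decomposition 𝒱] (α : AInf.SqForm V)
    (hα : α.IsMC (AInf.gradedSpace 𝒱))
    (hα0 : α.Uncurved)
    (hα11 : α.OneOneZero)
    (hedge0 : α.ConstantOnEdge 0) (hedge1 : α.ConstantOnEdge 1) :
    α.collapse0 (AInf.gradedSpace 𝒱) 0 =
      AInf.formsStructure (AInf.gradedSpace 𝒱) (α.c0 0 0) ∧
    α.collapse0 (AInf.gradedSpace 𝒱) 1 =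
      AInf.formsStructure (AInf.gradedSpace 𝒱) (α.c0 1 0) ∧
    AInf.IsAInfMorphism
      (AInf.forms (AInf.gradedSpace 𝒱)) (AInf.formsStructure (AInf.gradedSpace 𝒱) (α.c0 0 0))
      (AInf.forms (AInf.gradedSpace 𝒱)) (AInf.formsStructure (AInf.gradedSpace 𝒱) (α.c0 1 0))
      (α.Ghat (AInf.gradedSpace 𝒱)) ∧
    (∀ l : List V, l ≠ [] → AInf.IsHomog (AInf.gradedSpace 𝒱) l → ∀ t : unitInterval,
      (α.Ghat (AInf.gradedSpace 𝒱) (l.map AInf.const)).1 t = α.F (AInf.gradedSpace 𝒱) t l) ∧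
    AInf.IsDifferentialHomotopy
      (AInf.gradedSpace 𝒱) (α.c0 0 0) (AInf.gradedSpace 𝒱) (α.c0 1 0)
      (fun t => α.F (AInf.gradedSpace 𝒱) t)
      (fun t l => (α.Ghat (AInf.gradedSpace 𝒱) (l.map AInf.const)).2 t) := by
  have hA := AInf.isDecomposed_gradedSpace 𝒱
  have hG := hα.isAInfMorphism_Ghat hA hα0 hα11 hedge0 hedge1
  have hφ := AInf.IsAInfMorphism.comp_const (hα.isAInf_c0 hα0 0 0)
    (hα.isForm.h0.smoothFam.multilin 0 0) hα.isForm.multilin_Ghat hG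
  have hF : ∀ t l, (α.Ghat (AInf.gradedSpace 𝒱) (l.map AInf.const)).1 t = α.F (AInf.gradedSpace 𝒱) t l := by
    intro t l
    rw [hα.isForm.F_eq hA hα0 hα11]
    have := congrArg Prod.fst (hα.isForm.evalAt_Ghat t (l.map AInf.const))
    rwa [List.map_map] at this
  refine ⟨AInf.SqForm.collapse0_eq hedge0, AInf.SqForm.collapse0_eq hedge1, hG, fun l _ _ t => hF t l,
    fun t => ?_, _, hφ, fun l _ _ => Prod.ext (funext fun t => hF t l) rfl⟩
  -- The morphism property of `F_t` is obtained from that of `φ` by evaluation at `t`.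
  have := AInf.IsAInfMorphism.comp_eval (hα.isAInf_c0 hα0 1 0) hφ t
  rwa [show (fun l => (α.Ghat (AInf.gradedSpace 𝒱) (l.map AInf.const)).1 t) =
      α.F (AInf.gradedSpace 𝒱) t from
    funext fun l => hF t l] at this
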